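/- **Theorem 3 (Heat-Hyperbolic).** Let $n\ge 1$, let $\mathbb H^n=\{w=(x_1,\dots,x_n)\in\mathbb R^n:\ x_n>0\}$, with volume $d\mu(w)=x_n^{-n}\,dx_1\cdots dx_n$ and distance $\rho(w,w')\ge 0$ given by $\cosh^2(\rho(w,w')/2)=\frac{|w-w'|^2}{4x_nx_n'}+1$, and let $$\mathcal L_n=x_n^2\sum_{j=1}^n\frac{\partial^2}{\partial x_j^2}+(2-n)x_n\frac{\partial}{\partial x_n}+\frac{(n-1)^2}{4}.$$ Let $V_0\in C_0^\infty(\mathbb H^n)$ (complex valued). Consider the Cauchy problem $$\mathcal L_nV(t,w)=\frac{\partial}{\partial t}V(t,w)\quad (t>0,\ w\in\mathbb H^n),\qquad V(0,w)=V_0(w)\quad (w\in\mathbb H^n),$$ for functions $V$ that are continuous on $[0,\infty)\times\mathbb H^n$, that have on $(0,\infty)\times\mathbb H^n$ continuous derivatives of first order in $t$ and up to second order in $w$, and that satisfy the growth condition: for every $T>0$ there are constants $A,a$ such that for all $R>0$ $$\int_0^T\int_{\{w\in\mathbb H^n:\ \rho(w_0,w)<R\}}|V(t,w)|^2\,d\mu(w)\,dt\le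 A\,e^{aR^2},\qquad w_0=(0,\dots,0,1).$$ This problem has exactly one solution $V$, and for $t>0$ it is given by the absolutely convergent integral $$V(t,w)=\int_{\mathbb H^n}K_n(t,w,w')V_0(w')\,d\mu(w'),$$ where, for every $0<\sigma<2\pi$, $$K_n(t,w,w')=\frac{\Gamma((n+1)/2)}{2^{(n+1)/2}\pi^{n/2}t^{1/2}}\cdot\frac1{2\pi i}\int_{\sigma-i\infty}^{\sigma+i\infty}\frac{e^{y^2/4t}\,\sin y}{(\cosh\rho(w,w')-\cos y)^{(n+1)/2}}\,dy .$$ The contour is the upward vertical line $\operatorname{Re}y=\sigma$, the contour integral converges absolutely, and the power is the principal one. -/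

import Mathlib

open MeasureTheory Set
open scoped ContDiff

/-- The index of the last coordinate `x_n` of `ℝⁿ`, for `n ≥ 1`. -/
def lastIndex (n : ℕ) [NeZero n] : Fin n :=
  ⟨n - 1, Nat.sub_one_lt (NeZero.ne n)⟩

/-- The half space model of hyperbolic space, `ℍⁿ = {w ∈ ℝⁿ : x_n > 0}`. -/
def hypSpace (n : ℕ) [NeZero n] : Set (EuclideanSpace ℝ (Fin n)) :=
  {w | 0 < w (lastIndex n)}

/-- The base point `(0, …, 0, 1)` of `ℍⁿ`. -/
noncomputable def hypOrigin (n : ℕ) [NeZero n] : EuclideanSpace ℝ (Fin n) :=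
  EuclideanSpace.single (lastIndex n) 1

/-- The hyperbolic volume `dμ(w) = dx_1 ⋯ dx_n / x_n ^ n` on `ℍⁿ`, as a measure on `ℝⁿ` carried by
`ℍⁿ`. -/
noncomputable def hypMeasure (n : ℕ) [NeZero n] : Measure (EuclideanSpace ℝ (Fin n)) :=
  (volume.restrict (hypSpace n)).withDensity
    fun w => ENNReal.ofReal (1 / w (lastIndex n) ^ n)

/-- The hyperbolic distance on `ℍⁿ`: `sinh (ρ / 2) = |w - w'| / (2 √(x_n x_n'))`. -/
noncomputable def hypDist {n : ℕ} [NeZero n] (w w' : EuclideanSpace ℝ (Fin n)) : ℝ :=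
  2 * Real.arsinh (dist w w' / (2 * √(w (lastIndex n) * w' (lastIndex n))))

/-- The hyperbolic distance is nonnegative. -/
theorem hypDist_nonneg {n : ℕ} [NeZero n] (w w' : EuclideanSpace ℝ (Fin n)) :
    0 ≤ hypDist w w' :=
  mul_nonneg zero_le_two (Real.arsinh_nonneg_iff.2 (by positivity))

/-- The usual formula `cosh² (ρ / 2) = |w - w'|² / (4 x_n x_n') + 1`. -/
theorem cosh_sq_half_hypDist {n : ℕ} [NeZero n] {w w' : EuclideanSpace ℝ (Fin n)}
    (hw : w ∈ hypSpace n) (hw' : w' ∈ hypSpace n) :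
    Real.cosh (hypDist w w' / 2) ^ 2 =
      dist w w' ^ 2 / (4 * w (lastIndex n) * w' (lastIndex n)) + 1 := by
  have h : 0 < w (lastIndex n) * w' (lastIndex n) := mul_pos hw hw'
  rw [Real.cosh_sq, hypDist, mul_div_cancel_left₀ _ (two_ne_zero' ℝ), Real.sinh_arsinh, div_pow,
    mul_pow, Real.sq_sqrt h.le]
  ring

/-- The (shifted) Laplace-Beltrami operator of `ℍⁿ`,
`𝓛_n = x_n² Δ + (2 - n) x_n ∂/∂x_n + (n - 1)² / 4`, where `Δ` is the Euclidean Laplacian. -/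
noncomputable def hypLaplacian {n : ℕ} [NeZero n] (f : EuclideanSpace ℝ (Fin n) → ℂ)
    (w : EuclideanSpace ℝ (Fin n)) : ℂ :=
  (w (lastIndex n) : ℂ) ^ 2 * Laplacian.laplacian f w
    + (2 - (n : ℂ)) * (w (lastIndex n) : ℂ)
        * fderiv ℝ f w (EuclideanSpace.single (lastIndex n) 1)
    + ((n : ℂ) - 1) ^ 2 / 4 * f w

/-- `V` is a classical (`C^{1,2}`) solution of the heat Cauchy problem `𝓛_n V = ∂V/∂t` on
`(0, ∞) × ℍⁿ` with `V(0, ·) = V₀`, continuous on `[0, ∞) × ℍⁿ`. Only the values `V t w` with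
`0 ≤ t` and `w ∈ ℍⁿ` are relevant. -/
structure IsHypHeatSolution (n : ℕ) [NeZero n] (V₀ : EuclideanSpace ℝ (Fin n) → ℂ)
    (V : ℝ → EuclideanSpace ℝ (Fin n) → ℂ) : Prop where
  continuousOn : ContinuousOn (fun p : ℝ × EuclideanSpace ℝ (Fin n) => V p.1 p.2)
    (Ici 0 ×ˢ hypSpace n)
  differentiableAt_time : ∀ t > 0, ∀ w ∈ hypSpace n, DifferentiableAt ℝ (fun s => V s w) t
  continuousOn_deriv_time :
    ContinuousOn (fun p : ℝ × EuclideanSpace ℝ (Fin n) => deriv (fun s => V s p.2) p.1)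
      (Ioi 0 ×ˢ hypSpace n)
  contDiffOn_space : ∀ t > 0, ContDiffOn ℝ 2 (V t) (hypSpace n)
  continuousOn_fderiv_space :
    ContinuousOn (fun p : ℝ × EuclideanSpace ℝ (Fin n) => fderiv ℝ (V p.1) p.2)
      (Ioi 0 ×ˢ hypSpace n)
  continuousOn_fderiv_fderiv_space :
    ContinuousOn (fun p : ℝ × EuclideanSpace ℝ (Fin n) => fderiv ℝ (fderiv ℝ (V p.1)) p.2)
      (Ioi 0 ×ˢ hypSpace n)
  heat_eq : ∀ t > 0, ∀ w ∈ hypSpace n, hypLaplacian (V t) w = deriv (fun s => V s w) t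
  initial : ∀ w ∈ hypSpace n, V 0 w = V₀ w

/-- The uniqueness class of the heat equation: on every bounded time interval `(0, T)`, the square
of the `L²` norm of `V` over `(0, T)` times the hyperbolic ball of radius `R` grows at most like
`exp (a R²)`. It contains every function that is bounded on each `(0, T) × ℍⁿ`, every function with
`|V| ≤ A exp (a ρ²)` there, and every function that is in `L²` of each `(0, T) × ℍⁿ`. -/
def HasGaussianGrowth (n : ℕ) [NeZero n] (V : ℝ → EuclideanSpace ℝ (Fin n) → ℂ) : Prop :=
  ∀ T > 0, ∃ A a : ℝ, ∀ R > 0,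
    ∫⁻ t in Ioo 0 T, ∫⁻ w in {w | hypDist (hypOrigin n) w < R}, ‖V t w‖ₑ ^ 2 ∂(hypMeasure n)
      ≤ ENNReal.ofReal (A * Real.exp (a * R ^ 2))

/-- The integrand `exp (y² / 4t) sin y / (cosh ρ(w, w') - cos y) ^ ((n + 1) / 2)`, with the
principal branch of the power. -/
noncomputable def hypHeatIntegrand (n : ℕ) [NeZero n] (t : ℝ) (w w' : EuclideanSpace ℝ (Fin n))
    (y : ℂ) : ℂ :=
  Complex.exp (y ^ 2 / (4 * (t : ℂ))) * Complex.sin y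
    / ((Real.cosh (hypDist w w') : ℂ) - Complex.cos y) ^ (((n : ℂ) + 1) / 2)

/-- The contour integral `∫_{σ - i∞}^{σ + i∞} f(y) dy` along the upward vertical line `Re y = σ`. -/
noncomputable def verticalLineIntegral (f : ℂ → ℂ) (σ : ℝ) : ℂ :=
  Complex.I * ∫ b : ℝ, f ((σ : ℂ) + (b : ℂ) * Complex.I)

/-- The heat kernel `K_n(t, w, w')` of `ℍⁿ`, as a normalized contour integral over `Re y = σ`. -/
noncomputable def hypHeatKernel (n : ℕ) [NeZero n] (σ t : ℝ) (w w' : EuclideanSpace ℝ (Fin n)) :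
    ℂ :=
  ((Real.Gamma (((n : ℝ) + 1) / 2)
      / (2 ^ (((n : ℝ) + 1) / 2) * Real.pi ^ ((n : ℝ) / 2) * t ^ ((1 : ℝ) / 2)) : ℝ) : ℂ)
    * (1 / (2 * (Real.pi : ℂ) * Complex.I) * verticalLineIntegral (hypHeatIntegrand n t w w') σ)

/-! ### Gaussian integrals along a vertical line -/

/-! Put z = cosh ρ and a = (n + 1)/2. Up to a constant the kernel is a superposition of the
functions sin y (z - cos y)^(-a) with the weight t^(-1/2) exp(y²/4t). On the line y = π + ib the
base of the power is the positive number z + cosh b, and the weight solves the one-dimensional heat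
equation ∂_t = ∂_b². On sinh b (z + cosh b)^(-a) the operator ∂_b² acts as (z² - 1)∂_z² + nz∂_z + (n
- 1)²/4 (`hasDerivAt_sinhProfileDeriv`), and this is 𝓛_n on functions of cosh ρ
(`hypLaplacian_comp_coshDist`). Two integrations by parts in b therefore give the heat equation for
the kernel (`hypLaplacian_heatProfile`). Since V₀ has compact support in the half space, all
derivatives pass under the integral over w'.

For t → 0 the contour is moved to Re y = √t (`integral_contourIntegrand_eq`). The substitutions y =
√t(1 + is) and w' = w + √t u turn the solution into an integral over u whose integrand converges to
a Euclidean heat kernel, for the metric frozen at the limit point, times the data there. It is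
dominated by a multiple of (1 + |u|²)^(-(n+1)/2), which is integrable on ℝⁿ. This yields the initial
value with joint continuity (`tendsto_heatSolution_zero`) and, with two cruder bounds, boundedness
on each (0, T] × ℍⁿ (`exists_norm_heatSolution_le`), hence the growth condition. The limiting
contour integral is evaluated by a differential equation in r and a recursion in a
(`heatConst_mul_integral_euclideanIntegrand`).

Uniqueness is a weighted energy argument. The function r = log cosh ρ is smooth with hyperbolic
gradient at most 1. The weight φ(r)² exp(-r²/(4(s - t)) - κt), with a cutoff φ that falls from 1 to
0 between R and 2R, is chosen so that the time derivative of the Gaussian absorbs its own gradient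
and κ absorbs the zeroth-order term. Only an error carried by R ≤ r ≤ 2R is left
(`energy_pointwise_le`). On a short time step δ the Gaussian there is at most exp(-R²/(8δ)), which
compensates the growth exp(aR²) of the mass and leaves O(R⁻²). A solution with zero data thus
vanishes on one step, and steps of a fixed length reach every time (`IsHypHeatSolution.eq_zero`). -/

theorem exp_mul_abs_mul_exp_neg_le {c : ℝ} (hc : 0 < c) (N b : ℝ) :
    Real.exp (N * |b|) * Real.exp (-c * b ^ 2) ≤
      Real.exp (N ^ 2 / (2 * c)) * Real.exp (-(c / 2) * b ^ 2) := by
  rw [← Real.exp_add, ← Real.exp_add, Real.exp_le_exp]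
  have h : N ^ 2 / (2 * c) + -(c / 2) * b ^ 2 - (N * |b| + -c * b ^ 2)
      = (c * |b| - N) ^ 2 / (2 * c) := by
    rw [← sq_abs b]; field_simp; ring
  have : 0 ≤ (c * |b| - N) ^ 2 / (2 * c) := by positivity
  linarith

theorem integrable_exp_mul_abs_mul_exp_neg {c : ℝ} (hc : 0 < c) (N : ℝ) :
    Integrable (fun b : ℝ => Real.exp (N * |b|) * Real.exp (-c * b ^ 2)) := by
  refine Integrable.mono' ((integrable_exp_neg_mul_sq (half_pos hc)).const_mul
    (Real.exp (N ^ 2 / (2 * c)))) (by fun_prop) (Filter.Eventually.of_forall fun b => ?_)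
  rw [Real.norm_of_nonneg (by positivity)]
  exact exp_mul_abs_mul_exp_neg_le hc N b

theorem cosh_le_exp_abs (b : ℝ) : Real.cosh b ≤ Real.exp |b| := by
  rw [← Real.cosh_abs, Real.cosh_eq]
  have : Real.exp (-|b|) ≤ Real.exp |b| := Real.exp_le_exp.2 (by linarith [abs_nonneg b])
  linarith

theorem abs_sinh_le_exp_abs (b : ℝ) : |Real.sinh b| ≤ Real.exp |b| := by
  refine le_trans ?_ (cosh_le_exp_abs b)
  rw [Real.abs_sinh, ← Real.cosh_abs]
  exact (Real.sinh_lt_cosh _).le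

theorem abs_le_exp_abs (b : ℝ) : |b| ≤ Real.exp |b| := by
  linarith [Real.add_one_le_exp |b|]

/-- The Gaussian `t ^ (-1/2) exp (y² / 4t)` on the line `y = π + i b`. -/
noncomputable def lineGaussian (t b : ℝ) : ℂ :=
  (((√t)⁻¹ : ℝ) : ℂ) * Complex.exp (((Real.pi : ℂ) + b * Complex.I) ^ 2 / (4 * (t : ℂ)))

theorem norm_exp_sq_div (σ b t : ℝ) :
    ‖Complex.exp (((σ : ℂ) + b * Complex.I) ^ 2 / (4 * (t : ℂ)))‖ =
      Real.exp (σ ^ 2 / (4 * t)) * Real.exp (-(1 / (4 * t)) * b ^ 2) := by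
  rw [Complex.norm_exp, ← Real.exp_add]
  congr 1
  have : ((σ : ℂ) + b * Complex.I) ^ 2 / (4 * (t : ℂ)) =
      ((σ ^ 2 / (4 * t) + -(1 / (4 * t)) * b ^ 2 : ℝ) : ℂ)
        + ((2 * σ * b / (4 * t) : ℝ) : ℂ) * Complex.I := by
    push_cast
    linear_combination (b : ℂ) ^ 2 / (4 * (t : ℂ)) * Complex.I_sq
  rw [this]
  simp [-Complex.ofReal_add, -Complex.ofReal_mul, -Complex.ofReal_div]

theorem norm_lineGaussian_le {τ T t : ℝ} (hτ : 0 < τ) (h₁ : τ ≤ t) (h₂ : t ≤ T) (b : ℝ) :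
    ‖lineGaussian t b‖ ≤
      (√τ)⁻¹ * Real.exp (Real.pi ^ 2 / (4 * τ)) * Real.exp (-(1 / (4 * T)) * b ^ 2) := by
  have ht : 0 < t := hτ.trans_le h₁
  rw [lineGaussian, norm_mul, norm_exp_sq_div, Complex.norm_real,
    Real.norm_of_nonneg (by positivity), ← mul_assoc]
  have hs : 0 < √τ := Real.sqrt_pos.2 hτ
  gcongr

theorem continuous_lineGaussian (t : ℝ) : Continuous (lineGaussian t) := by
  unfold lineGaussian; fun_prop

theorem integrable_lineGaussian_mul {t : ℝ} (ht : 0 < t) {f : ℝ → ℂ} (hf : Continuous f)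
    {C N : ℝ} (hC : ∀ b, ‖f b‖ ≤ C * Real.exp (N * |b|)) :
    Integrable (fun b => lineGaussian t b * f b) := by
  refine Integrable.mono' ((integrable_exp_mul_abs_mul_exp_neg (c := 1 / (4 * t)) (by positivity)
    N).const_mul ((√t)⁻¹ * Real.exp (Real.pi ^ 2 / (4 * t)) * C))
    ((continuous_lineGaussian t).mul hf).aestronglyMeasurable
    (Filter.Eventually.of_forall fun b => ?_)
  rw [norm_mul]
  calc _ ≤ ((√t)⁻¹ * Real.exp (Real.pi ^ 2 / (4 * t)) * Real.exp (-(1 / (4 * t)) * b ^ 2)) *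
        (C * Real.exp (N * |b|)) :=
      mul_le_mul (norm_lineGaussian_le ht le_rfl le_rfl b) (hC b) (norm_nonneg _) (by positivity)
    _ = _ := by ring

theorem hasDerivAt_lineGaussian {t : ℝ} (ht : 0 < t) (b : ℝ) :
    HasDerivAt (lineGaussian t)
      (lineGaussian t b * (((Real.pi : ℂ) + b * Complex.I) * Complex.I / (2 * t))) b := by
  have h1 : HasDerivAt (fun b : ℝ => ((Real.pi : ℂ) + b * Complex.I)) Complex.I b := by
    simpa using ((Complex.ofRealCLM.hasDerivAt (x := b)).mul_const Complex.I).const_add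
      (Real.pi : ℂ)
  have h2 := (((h1.pow 2).div_const (4 * (t : ℂ))).cexp).const_mul (((√t)⁻¹ : ℝ) : ℂ)
  refine h2.congr_deriv ?_
  have : (t : ℂ) ≠ 0 := by exact_mod_cast ht.ne'
  simp only [lineGaussian, Pi.pow_apply]
  field_simp
  ring

/-- As y = π + ib moves in the direction i, the second b-derivative of t^(-1/2) exp(y²/4t) is minus
its second y-derivative, and this equals the time derivative. So the Gaussian solves ∂_t = ∂_b²: the
factor found here is the one that appears in `integral_lineGaussian_deriv_deriv_mul`. -/
theorem hasDerivAt_lineGaussian_time {t : ℝ} (ht : 0 < t) (b : ℝ) :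
    HasDerivAt (fun t => lineGaussian t b)
      (lineGaussian t b * (-1 / (2 * t) - ((Real.pi : ℂ) + b * Complex.I) ^ 2 / (4 * t ^ 2))) t := by
  have hs : √t ≠ 0 := (Real.sqrt_pos.2 ht).ne'
  have h1 : HasDerivAt (fun t : ℝ => (((√t)⁻¹ : ℝ) : ℂ)) ((-(1 / (2 * √t)) / (√t) ^ 2 : ℝ) : ℂ) t :=
    ((Real.hasDerivAt_sqrt ht.ne').inv hs).ofReal_comp
  have htc : (t : ℂ) ≠ 0 := by exact_mod_cast ht.ne'
  have h2 : HasDerivAt (fun t : ℝ => ((Real.pi : ℂ) + b * Complex.I) ^ 2 / (4 * (t : ℂ)))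
      (-(((Real.pi : ℂ) + b * Complex.I) ^ 2 / (4 * t ^ 2))) t := by
    have h3 : HasDerivAt (fun t : ℝ => 4 * (t : ℂ)) 4 t := by
      simpa using (Complex.ofRealCLM.hasDerivAt (x := t)).const_mul (4 : ℂ)
    refine ((h3.fun_inv (by simpa using htc)).const_mul
      (((Real.pi : ℂ) + b * Complex.I) ^ 2)).congr_deriv ?_
    field_simp
  refine (h1.mul h2.cexp).congr_deriv ?_
  rw [Real.sq_sqrt ht.le]
  simp only [lineGaussian]
  have hsc : ((√t : ℝ) : ℂ) ≠ 0 := by exact_mod_cast hs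
  push_cast
  field_simp
  ring

/-! ### The profile `k_a(t, z)` of the heat kernel -/

/-- The function `sinh b (z + cosh b) ^ (-a)`. -/
noncomputable def sinhProfile (a z b : ℝ) : ℝ := Real.sinh b * (z + Real.cosh b) ^ (-a)

theorem abs_mul_rpow_neg_le {z a : ℝ} (hz : 0 < z) (ha : 0 ≤ a) {s N : ℝ} (b : ℝ)
    (hs : |s| ≤ Real.exp (N * |b|)) :
    |s * (z + Real.cosh b) ^ (-a)| ≤ z ^ (-a) * Real.exp (N * |b|) := by
  have hD : 0 < z + Real.cosh b := by positivity
  rw [abs_mul, abs_of_pos (Real.rpow_pos_of_pos hD _), mul_comm]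
  have : (z + Real.cosh b) ^ (-a) ≤ z ^ (-a) :=
    Real.rpow_le_rpow_of_nonpos hz (by linarith [Real.cosh_pos b]) (by linarith)
  gcongr

theorem abs_sinhProfile_le {z a : ℝ} (hz : 0 < z) (ha : 0 ≤ a) (b : ℝ) :
    |sinhProfile a z b| ≤ z ^ (-a) * Real.exp (1 * |b|) :=
  abs_mul_rpow_neg_le hz ha b (by simpa using abs_sinh_le_exp_abs b)

theorem continuous_add_cosh_rpow {z : ℝ} (hz : 0 < z) (a : ℝ) :
    Continuous fun b => (z + Real.cosh b) ^ (-a) :=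
  (continuous_const.add Real.continuous_cosh).rpow_const
    fun b => Or.inl (add_pos hz (Real.cosh_pos b)).ne'

theorem continuous_sinhProfile {z : ℝ} (hz : 0 < z) (a : ℝ) : Continuous (sinhProfile a z) :=
  Real.continuous_sinh.mul (continuous_add_cosh_rpow hz a)

theorem hasDerivAt_add_cosh_rpow {z : ℝ} (hz : 0 < z) (a b : ℝ) :
    HasDerivAt (fun b => (z + Real.cosh b) ^ (-a))
      (-a * Real.sinh b * (z + Real.cosh b) ^ (-(a + 1))) b := by
  have hD : z + Real.cosh b ≠ 0 := by positivity
  refine (((Real.hasDerivAt_cosh b).const_add z).rpow_const (p := -a) (Or.inl hD)).congr_deriv ?_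
  rw [show -(a + 1) = -a - 1 by ring]; ring

theorem hasDerivAt_sinhProfile_left {z : ℝ} (hz : 0 < z) (a b : ℝ) :
    HasDerivAt (fun z => sinhProfile a z b) (-a * sinhProfile (a + 1) z b) z := by
  have hD : z + Real.cosh b ≠ 0 := by positivity
  refine ((((hasDerivAt_id z).add_const (Real.cosh b)).rpow_const (p := -a)
    (Or.inl hD)).const_mul (Real.sinh b)).congr_deriv ?_
  rw [sinhProfile, show -(a + 1) = -a - 1 by ring]; simp only [id]; ring

/-- The derivative of `sinhProfile a z` in `b`. -/
noncomputable def sinhProfileDeriv (a z b : ℝ) : ℝ :=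
  Real.cosh b * (z + Real.cosh b) ^ (-a) - a * (Real.sinh b ^ 2 * (z + Real.cosh b) ^ (-(a + 1)))

theorem hasDerivAt_sinhProfile {z : ℝ} (hz : 0 < z) (a b : ℝ) :
    HasDerivAt (sinhProfile a z) (sinhProfileDeriv a z b) b := by
  refine ((Real.hasDerivAt_sinh b).mul (hasDerivAt_add_cosh_rpow hz a b)).congr_deriv ?_
  rw [sinhProfileDeriv]; ring

/-- The identity behind the kernel. Writing P_a for the profile, it says ∂_b² P_a = (z² - 1)∂_z² P_a
+ (2a - 1)z ∂_z P_a + (a - 1)² P_a, with the z-derivatives expressed through ∂_z P_a = -a P_{a+1}.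
For 2a - 1 = n the right side is 𝓛_n on functions of z = cosh ρ. -/
theorem hasDerivAt_sinhProfileDeriv {z : ℝ} (hz : 0 < z) (a b : ℝ) :
    HasDerivAt (sinhProfileDeriv a z)
      (a * (a + 1) * (z ^ 2 - 1) * sinhProfile (a + 2) z b
        - (2 * a - 1) * a * z * sinhProfile (a + 1) z b + (a - 1) ^ 2 * sinhProfile a z b) b := by
  refine (((Real.hasDerivAt_cosh b).mul (hasDerivAt_add_cosh_rpow hz a b)).sub
    ((((Real.hasDerivAt_sinh b).pow 2).mul
      (hasDerivAt_add_cosh_rpow hz (a + 1) b)).const_mul a)).congr_deriv ?_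
  have hD : 0 < z + Real.cosh b := by positivity
  have e1 : (z + Real.cosh b) ^ (-a) = (z + Real.cosh b) ^ 2 * (z + Real.cosh b) ^ (-(a + 2)) := by
    rw [← Real.rpow_natCast, ← Real.rpow_add hD]; congr 1; push_cast; ring
  have e2 : (z + Real.cosh b) ^ (-(a + 1)) = (z + Real.cosh b) * (z + Real.cosh b) ^ (-(a + 2)) := by
    nth_rewrite 2 [← Real.rpow_one (z + Real.cosh b)]
    rw [← Real.rpow_add hD]; congr 1; ring
  have e3 : a + 1 + 1 = a + 2 := by ring
  simp only [sinhProfile, Pi.pow_apply]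
  rw [e3, e1, e2]
  have hc := Real.cosh_sq b
  -- All powers have been reduced to the exponent -(a + 2) of D = z + cosh b. This form of z² - 1 is
  -- where cosh² - sinh² = 1 enters; the rest is polynomial algebra.
  have : (z:ℝ) ^ 2 - 1 = (z + Real.cosh b) ^ 2 - 2 * (z + Real.cosh b) * Real.cosh b
      + Real.sinh b ^ 2 := by linear_combination hc
  set S := Real.sinh b
  set c := Real.cosh b
  set P := (z + c) ^ (-(a + 2))
  rw [this]
  push_cast
  ring

theorem abs_sinhProfileDeriv_le {z a : ℝ} (hz : 0 < z) (ha : 0 ≤ a) (b : ℝ) :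
    |sinhProfileDeriv a z b| ≤ (z ^ (-a) + a * z ^ (-(a + 1))) * Real.exp (2 * |b|) := by
  rw [sinhProfileDeriv]
  refine (abs_sub _ _).trans ?_
  rw [abs_mul a, abs_of_nonneg ha, add_mul, mul_assoc]
  refine add_le_add (abs_mul_rpow_neg_le hz ha b ?_)
    (mul_le_mul_of_nonneg_left (abs_mul_rpow_neg_le hz (by linarith) b ?_) ha)
  · rw [abs_of_pos (Real.cosh_pos b)]
    exact (cosh_le_exp_abs b).trans (Real.exp_le_exp.2 (by linarith [abs_nonneg b]))
  · rw [abs_pow, two_mul, Real.exp_add, sq]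
    gcongr <;> exact abs_sinh_le_exp_abs b

theorem continuous_sinhProfileDeriv {z : ℝ} (hz : 0 < z) (a : ℝ) :
    Continuous (sinhProfileDeriv a z) :=
  continuous_iff_continuousAt.2 fun b => (hasDerivAt_sinhProfileDeriv hz a b).continuousAt

/-- The heat kernel of `ℍⁿ` as a function of `z = cosh ρ`, up to normalization, for
`a = (n + 1) / 2`. -/
noncomputable def heatProfile (a t z : ℝ) : ℂ :=
  ∫ b : ℝ, lineGaussian t b * (sinhProfile a z b : ℂ)

theorem integrable_heatProfile {a t z : ℝ} (ha : 0 ≤ a) (ht : 0 < t) (hz : 0 < z) :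
    Integrable fun b : ℝ => lineGaussian t b * (sinhProfile a z b : ℂ) :=
  integrable_lineGaussian_mul ht (Complex.continuous_ofReal.comp (continuous_sinhProfile hz a))
    fun b => by rw [Complex.norm_real]; exact abs_sinhProfile_le hz ha b

theorem norm_pi_add_mul_I_le (b : ℝ) :
    ‖(Real.pi : ℂ) + b * Complex.I‖ ≤ (Real.pi + 1) * Real.exp |b| := by
  refine (norm_add_le _ _).trans ?_
  simp only [norm_mul, Complex.norm_real, Complex.norm_I, mul_one, Real.norm_eq_abs,
    abs_of_pos Real.pi_pos, add_mul, one_mul]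
  have := Real.one_le_exp (abs_nonneg b)
  have h := abs_le_exp_abs b
  nlinarith [Real.pi_pos]

/-- Differentiation in z only raises the exponent a by one. The domination is uniform for x > z/2,
where negative powers of x + cosh b are bounded by those of z/2. -/
theorem hasDerivAt_heatProfile_right {a t z : ℝ} (ha : 0 ≤ a) (ht : 0 < t) (hz : 0 < z) :
    HasDerivAt (fun z => heatProfile a t z) (-a * heatProfile (a + 1) t z) z := by
  have hz2 : 0 < z / 2 := half_pos hz
  have key := hasDerivAt_integral_of_dominated_loc_of_deriv_le (μ := volume)
    (F := fun z b => lineGaussian t b * (sinhProfile a z b : ℂ))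
    (F' := fun z b => lineGaussian t b * ((-a * sinhProfile (a + 1) z b : ℝ) : ℂ))
    (bound := fun b => ((√t)⁻¹ * Real.exp (Real.pi ^ 2 / (4 * t)) * (a * (z / 2) ^ (-(a + 1)))) *
      (Real.exp (1 * |b|) * Real.exp (-(1 / (4 * t)) * b ^ 2)))
    (Ioi_mem_nhds (half_lt_self hz))
    (by
      filter_upwards [Ioi_mem_nhds hz] with x hx
      exact (integrable_heatProfile ha ht hx).aestronglyMeasurable)
    (integrable_heatProfile ha ht hz)
    (by
      refine ((continuous_lineGaussian t).mul (Complex.continuous_ofReal.comp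
        (continuous_const.mul (continuous_sinhProfile hz (a + 1))))).aestronglyMeasurable)
    (Filter.Eventually.of_forall fun b x hx => by
      have hx0 : 0 < x := hz2.trans hx
      rw [norm_mul, Complex.norm_real, Real.norm_eq_abs, abs_mul, abs_neg, abs_of_nonneg ha]
      have h1 := abs_sinhProfile_le hx0 (by linarith : 0 ≤ a + 1) b
      have h2 : x ^ (-(a + 1)) ≤ (z / 2) ^ (-(a + 1)) :=
        Real.rpow_le_rpow_of_nonpos hz2 hx.le (by linarith)
      calc _ ≤ ((√t)⁻¹ * Real.exp (Real.pi ^ 2 / (4 * t)) * Real.exp (-(1 / (4 * t)) * b ^ 2)) *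
            (a * ((z / 2) ^ (-(a + 1)) * Real.exp (1 * |b|))) := by
            refine mul_le_mul (norm_lineGaussian_le ht le_rfl le_rfl b) ?_ (by positivity)
              (by positivity)
            refine mul_le_mul_of_nonneg_left (h1.trans ?_) ha
            gcongr
        _ = _ := by ring)
    ((integrable_exp_mul_abs_mul_exp_neg (by positivity) 1).const_mul _)
    (Filter.Eventually.of_forall fun b x hx =>
      ((hasDerivAt_sinhProfile_left (hz2.trans hx) a b).ofReal_comp).const_mul _)
  refine key.2.congr_deriv ?_
  rw [heatProfile, ← integral_const_mul]
  congr 1; ext b; push_cast; ring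

/-- The integral of `k` against the second derivative of the Gaussian. -/
theorem integral_lineGaussian_deriv_deriv_mul {a t z : ℝ} (ha : 0 ≤ a) (ht : 0 < t) (hz : 0 < z) :
    ∫ b : ℝ, lineGaussian t b *
      (-1 / (2 * t) - ((Real.pi : ℂ) + b * Complex.I) ^ 2 / (4 * t ^ 2)) * (sinhProfile a z b : ℂ) =
    a * (a + 1) * (z ^ 2 - 1) * heatProfile (a + 2) t z
        - (2 * a - 1) * a * z * heatProfile (a + 1) t z + (a - 1) ^ 2 * heatProfile a t z := by
  have htc : (t : ℂ) ≠ 0 := by exact_mod_cast ht.ne'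
  set L : ℝ → ℂ := fun b => ((Real.pi : ℂ) + b * Complex.I) * Complex.I / (2 * t) with hL
  have hLc : Continuous L := by rw [hL]; fun_prop
  have hLb : ∀ b, ‖L b‖ ≤ ((Real.pi + 1) / (2 * t)) * Real.exp |b| := fun b => by
    rw [hL]
    simp only [norm_mul, norm_div, Complex.norm_I, mul_one, Complex.norm_real, Complex.norm_ofNat,
      Real.norm_eq_abs, abs_of_pos ht]
    rw [div_mul_eq_mul_div]
    gcongr
    exact norm_pi_add_mul_I_le b
  have hL' : ∀ b, HasDerivAt L (-1 / (2 * t)) b := fun b => by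
    have h1 : HasDerivAt (fun b : ℝ => ((Real.pi : ℂ) + b * Complex.I)) Complex.I b := by
      simpa using ((Complex.ofRealCLM.hasDerivAt (x := b)).mul_const Complex.I).const_add
        (Real.pi : ℂ)
    exact ((h1.mul_const Complex.I).div_const _).congr_deriv (by rw [Complex.I_mul_I])
  have hg : ∀ b, HasDerivAt (lineGaussian t) (lineGaussian t b * L b) b :=
    fun b => hasDerivAt_lineGaussian ht b
  have hg' : ∀ b, HasDerivAt (fun b => lineGaussian t b * L b) (lineGaussian t b *
      (-1 / (2 * t) - ((Real.pi : ℂ) + b * Complex.I) ^ 2 / (4 * t ^ 2))) b := fun b => by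
    refine ((hg b).mul (hL' b)).congr_deriv ?_
    simp only [hL]
    linear_combination lineGaussian t b * ((Real.pi : ℂ) + b * Complex.I) ^ 2 / (4 * t ^ 2) *
      Complex.I_sq
  have hφ : ∀ b, HasDerivAt (fun b => (sinhProfile a z b : ℂ)) (sinhProfileDeriv a z b : ℂ) b :=
    fun b => (hasDerivAt_sinhProfile hz a b).ofReal_comp
  have hφ' := fun b => (hasDerivAt_sinhProfileDeriv hz a b).ofReal_comp
  have cφ : ∀ a, Continuous fun b => (sinhProfile a z b : ℂ) :=
    fun a => Complex.continuous_ofReal.comp (continuous_sinhProfile hz a)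
  have cφ' : Continuous fun b => (sinhProfileDeriv a z b : ℂ) :=
    Complex.continuous_ofReal.comp (continuous_sinhProfileDeriv hz a)
  have bφ : ∀ b, ‖(sinhProfile a z b : ℂ)‖ ≤ z ^ (-a) * Real.exp (1 * |b|) :=
    fun b => by rw [Complex.norm_real]; exact abs_sinhProfile_le hz ha b
  have bφ' : ∀ b, ‖(sinhProfileDeriv a z b : ℂ)‖ ≤
      (z ^ (-a) + a * z ^ (-(a + 1))) * Real.exp (2 * |b|) :=
    fun b => by rw [Complex.norm_real]; exact abs_sinhProfileDeriv_le hz ha b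
  have bL : ∀ {f : ℝ → ℂ} {C N : ℝ}, (∀ b, ‖f b‖ ≤ C * Real.exp (N * |b|)) → ∀ b,
      ‖L b * f b‖ ≤ ((Real.pi + 1) / (2 * t) * C) * Real.exp ((N + 1) * |b|) := by
    intro f C N hf b
    rw [norm_mul]
    calc _ ≤ (((Real.pi + 1) / (2 * t)) * Real.exp |b|) * (C * Real.exp (N * |b|)) :=
          mul_le_mul (hLb b) (hf b) (norm_nonneg _) (by positivity)
      _ = _ := by rw [add_mul, Real.exp_add, one_mul]; ring
  have i0 := integrable_lineGaussian_mul ht (hLc.mul (cφ a)) (bL bφ)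
  have i1 := integrable_lineGaussian_mul ht (hLc.mul cφ') (bL bφ')
  have i2 := integrable_lineGaussian_mul ht (hLc.mul (hLc.mul (cφ a))) (bL (bL bφ))
  have i3 := integrable_heatProfile ha ht hz
  have i4 := integrable_lineGaussian_mul ht cφ' bφ'
  have i5 : Integrable fun b : ℝ => lineGaussian t b * ((a * (a + 1) * (z ^ 2 - 1) *
      sinhProfile (a + 2) z b - (2 * a - 1) * a * z * sinhProfile (a + 1) z b
      + (a - 1) ^ 2 * sinhProfile a z b : ℝ) : ℂ) := by
    have := ((((integrable_heatProfile (by linarith : 0 ≤ a + 2) ht hz).const_mul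
      ((a * (a + 1) * (z ^ 2 - 1) : ℝ) : ℂ)).sub
      ((integrable_heatProfile (by linarith : 0 ≤ a + 1) ht hz).const_mul
      (((2 * a - 1) * a * z : ℝ) : ℂ)))).add (i3.const_mul (((a - 1) ^ 2 : ℝ) : ℂ))
    refine this.congr (Filter.Eventually.of_forall fun b => ?_)
    simp only [Pi.add_apply, Pi.sub_apply]; push_cast; ring
  -- Two integrations by parts carry ∂_b² from the Gaussian to the profile. Every product that has
  -- to be integrable is the Gaussian times O(exp(N|b|)).
  have ibp1 := integral_mul_deriv_eq_deriv_mul_of_integrable (u := fun b => (sinhProfile a z b : ℂ))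
    (v := fun b => lineGaussian t b * L b) (fun b _ => hφ b) (fun b _ => hg' b)
    (by
      have : Integrable fun b : ℝ => lineGaussian t b *
          (-1 / (2 * t) * (sinhProfile a z b : ℂ)) + lineGaussian t b *
          (L b * (L b * (sinhProfile a z b : ℂ))) := by
        refine Integrable.add ?_ i2
        exact (i3.const_mul (-1 / (2 * t : ℂ))).congr (Filter.Eventually.of_forall fun b => by ring)
      refine this.congr (Filter.Eventually.of_forall fun b => ?_)
      simp only [hL, Pi.mul_apply]
      linear_combination lineGaussian t b * sinhProfile a z b *
        ((Real.pi : ℂ) + b * Complex.I) ^ 2 / (4 * t ^ 2) * Complex.I_sq)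
    (i1.congr (Filter.Eventually.of_forall fun b => by simp only [Pi.mul_apply]; ring))
    (i0.congr (Filter.Eventually.of_forall fun b => by simp only [Pi.mul_apply]; ring))
  have ibp2 := integral_mul_deriv_eq_deriv_mul_of_integrable
    (u := fun b => (sinhProfileDeriv a z b : ℂ)) (v := lineGaussian t)
    (fun b _ => hφ' b) (fun b _ => hg b)
    (i1.congr (Filter.Eventually.of_forall fun b => by simp only [Pi.mul_apply]; ring))
    (i5.congr (Filter.Eventually.of_forall fun b => by simp only [Pi.mul_apply]; ring))
    (i4.congr (Filter.Eventually.of_forall fun b => by simp only [Pi.mul_apply]; ring))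
  have e1 : ∫ b : ℝ, lineGaussian t b *
      (-1 / (2 * t) - ((Real.pi : ℂ) + b * Complex.I) ^ 2 / (4 * t ^ 2)) * (sinhProfile a z b : ℂ)
      = ∫ b : ℝ, lineGaussian t b * ((a * (a + 1) * (z ^ 2 - 1) *
      sinhProfile (a + 2) z b - (2 * a - 1) * a * z * sinhProfile (a + 1) z b
      + (a - 1) ^ 2 * sinhProfile a z b : ℝ) : ℂ) := by
    rw [show (∫ b : ℝ, lineGaussian t b *
      (-1 / (2 * t) - ((Real.pi : ℂ) + b * Complex.I) ^ 2 / (4 * t ^ 2)) * (sinhProfile a z b : ℂ))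
      = ∫ b : ℝ, (sinhProfile a z b : ℂ) * (lineGaussian t b *
      (-1 / (2 * t) - ((Real.pi : ℂ) + b * Complex.I) ^ 2 / (4 * t ^ 2))) from by
        congr 1; ext b; ring, ibp1, ibp2, neg_neg]
    congr 1; ext b; ring
  rw [e1]
  simp only [heatProfile]
  rw [← integral_const_mul, ← integral_const_mul, ← integral_const_mul, ← integral_sub, ← integral_add]
  · congr 1; ext b; push_cast; ring
  · exact ((integrable_heatProfile (by linarith) ht hz).const_mul _).sub
      ((integrable_heatProfile (by linarith) ht hz).const_mul _)
  · exact i3.const_mul _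
  · exact (integrable_heatProfile (by linarith) ht hz).const_mul _
  · exact (integrable_heatProfile (by linarith) ht hz).const_mul _

/-- The time derivative falls on the Gaussian alone, where ∂_t = ∂_b²; integration by parts then
moves it to the profile. The result is the heat equation in the variables (t, z). -/
theorem hasDerivAt_heatProfile_left {a t z : ℝ} (ha : 0 ≤ a) (ht : 0 < t) (hz : 0 < z) :
    HasDerivAt (fun t => heatProfile a t z)
      (a * (a + 1) * (z ^ 2 - 1) * heatProfile (a + 2) t z
        - (2 * a - 1) * a * z * heatProfile (a + 1) t z + (a - 1) ^ 2 * heatProfile a t z) t := by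
  have ht2 : 0 < t / 2 := half_pos ht
  rw [← integral_lineGaussian_deriv_deriv_mul ha ht hz]
  refine (hasDerivAt_integral_of_dominated_loc_of_deriv_le (μ := volume)
    (F := fun t b => lineGaussian t b * (sinhProfile a z b : ℂ))
    (F' := fun t b => lineGaussian t b *
      (-1 / (2 * t) - ((Real.pi : ℂ) + b * Complex.I) ^ 2 / (4 * t ^ 2)) * (sinhProfile a z b : ℂ))
    (bound := fun b => ((√(t / 2))⁻¹ * Real.exp (Real.pi ^ 2 / (4 * (t / 2))) *
      (1 / (2 * (t / 2)) + (Real.pi + 1) ^ 2 / (4 * (t / 2) ^ 2)) * z ^ (-a)) *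
      (Real.exp (3 * |b|) * Real.exp (-(1 / (4 * (2 * t))) * b ^ 2)))
    (Ioo_mem_nhds (half_lt_self ht) (by linarith : t < 2 * t))
    (by
      filter_upwards [Ioi_mem_nhds ht] with x hx
      exact (integrable_heatProfile ha hx hz).aestronglyMeasurable)
    (integrable_heatProfile ha ht hz)
    (by
      refine (((continuous_lineGaussian t).mul ?_).mul (Complex.continuous_ofReal.comp
        (continuous_sinhProfile hz a))).aestronglyMeasurable
      fun_prop)
    (Filter.Eventually.of_forall fun b x hx => ?_)
    ((integrable_exp_mul_abs_mul_exp_neg (by positivity) 3).const_mul _)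
    (Filter.Eventually.of_forall fun b x hx =>
      (hasDerivAt_lineGaussian_time (ht2.trans hx.1) b).mul_const _)).2
  have hx0 : 0 < x := ht2.trans hx.1
  have h1 := abs_sinhProfile_le hz ha b
  have h2 := norm_lineGaussian_le ht2 hx.1.le hx.2.le b
  have h3 : ‖-1 / (2 * (x : ℂ)) - ((Real.pi : ℂ) + b * Complex.I) ^ 2 / (4 * (x : ℂ) ^ 2)‖ ≤
      (1 / (2 * (t / 2)) + (Real.pi + 1) ^ 2 / (4 * (t / 2) ^ 2)) * Real.exp (2 * |b|) := by
    refine (norm_sub_le _ _).trans ?_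
    simp only [norm_div, norm_mul, norm_pow, norm_neg, norm_one, Complex.norm_ofNat,
      Complex.norm_real, Real.norm_eq_abs, abs_of_pos hx0]
    rw [add_mul]
    refine add_le_add ?_ ?_
    · have h4 : 1 ≤ Real.exp (2 * |b|) := Real.one_le_exp (by positivity)
      calc 1 / (2 * x) ≤ 1 / (2 * (t / 2)) := by gcongr; exact hx.1.le
        _ ≤ _ := le_mul_of_one_le_right (by positivity) h4
    · calc ‖(Real.pi : ℂ) + b * Complex.I‖ ^ 2 / (4 * x ^ 2)
          ≤ ((Real.pi + 1) * Real.exp |b|) ^ 2 / (4 * (t / 2) ^ 2) := by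
            gcongr
            · exact norm_pi_add_mul_I_le b
            · exact hx.1.le
        _ = _ := by rw [mul_pow, ← Real.exp_nat_mul]; push_cast; ring
  rw [norm_mul, norm_mul, Complex.norm_real, Real.norm_eq_abs]
  calc _ ≤ ((√(t / 2))⁻¹ * Real.exp (Real.pi ^ 2 / (4 * (t / 2))) *
        Real.exp (-(1 / (4 * (2 * t))) * b ^ 2)) *
        ((1 / (2 * (t / 2)) + (Real.pi + 1) ^ 2 / (4 * (t / 2) ^ 2)) * Real.exp (2 * |b|)) *
        (z ^ (-a) * Real.exp (1 * |b|)) := by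
        gcongr
    _ = _ := by
        rw [show (3 : ℝ) * |b| = 2 * |b| + 1 * |b| by ring, Real.exp_add]; ring

theorem continuousOn_heatProfile {a : ℝ} (ha : 0 ≤ a) :
    ContinuousOn (fun p : ℝ × ℝ => heatProfile a p.1 p.2) (Ioi 0 ×ˢ Ioi 0) := by
  rintro ⟨t, z⟩ ⟨ht, hz⟩
  replace ht : 0 < t := ht
  replace hz : 0 < z := hz
  have ht2 : 0 < t / 2 := half_pos ht
  have hz2 : 0 < z / 2 := half_pos hz
  refine ContinuousAt.continuousWithinAt ?_
  have hnhds : Ioo (t / 2) (2 * t) ×ˢ Ioi (z / 2) ∈ nhds (t, z) :=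
    prod_mem_nhds (Ioo_mem_nhds (half_lt_self ht) (by linarith)) (Ioi_mem_nhds (half_lt_self hz))
  refine continuousAt_of_dominated (bound := fun b => ((√(t / 2))⁻¹ *
      Real.exp (Real.pi ^ 2 / (4 * (t / 2))) * (z / 2) ^ (-a)) *
      (Real.exp (1 * |b|) * Real.exp (-(1 / (4 * (2 * t))) * b ^ 2))) ?_ ?_
    ((integrable_exp_mul_abs_mul_exp_neg (by positivity) 1).const_mul _) ?_
  · filter_upwards [hnhds] with p hp
    exact (integrable_heatProfile ha (ht2.trans hp.1.1) (hz2.trans hp.2)).aestronglyMeasurable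
  · filter_upwards [hnhds] with p hp
    refine Filter.Eventually.of_forall fun b => ?_
    rw [norm_mul, Complex.norm_real, Real.norm_eq_abs]
    have h1 := abs_sinhProfile_le (hz2.trans hp.2) ha b
    have h2 : p.2 ^ (-a) ≤ (z / 2) ^ (-a) :=
      Real.rpow_le_rpow_of_nonpos hz2 hp.2.le (by linarith)
    have h3 := norm_lineGaussian_le ht2 hp.1.1.le hp.1.2.le b
    calc _ ≤ ((√(t / 2))⁻¹ * Real.exp (Real.pi ^ 2 / (4 * (t / 2))) *
          Real.exp (-(1 / (4 * (2 * t))) * b ^ 2)) * ((z / 2) ^ (-a) * Real.exp (1 * |b|)) :=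
          mul_le_mul h3 (h1.trans (by gcongr)) (abs_nonneg _) (by positivity)
      _ = _ := by ring
  · refine Filter.Eventually.of_forall fun b => ?_
    have hD : z + Real.cosh b ≠ 0 := (add_pos hz (Real.cosh_pos b)).ne'
    have h1 : ContinuousAt (fun p : ℝ × ℝ => lineGaussian p.1 b) (t, z) :=
      ContinuousAt.comp (f := Prod.fst) (g := fun t => lineGaussian t b)
        (hasDerivAt_lineGaussian_time ht b).continuousAt
        continuousAt_fst
    have h2 : ContinuousAt (fun p : ℝ × ℝ => sinhProfile a p.2 b) (t, z) :=
      ContinuousAt.comp (f := Prod.snd) (g := fun z => sinhProfile a z b)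
        (hasDerivAt_sinhProfile_left hz a b).continuousAt continuousAt_snd
    exact h1.mul (Complex.continuous_ofReal.continuousAt.comp h2)

section

/-- Both partial derivatives are combinations of `heatProfile` with exponents a, a + 1 and a + 2,
hence jointly continuous; continuous partial derivatives give strict differentiability. -/
theorem hasStrictFDerivAt_heatProfile {a t z : ℝ} (ha : 0 ≤ a) (ht : 0 < t) (hz : 0 < z) :
    HasStrictFDerivAt (fun p : ℝ × ℝ => heatProfile a p.1 p.2)
      ((ContinuousLinearMap.fst ℝ ℝ ℝ).smulRight
        (a * (a + 1) * (z ^ 2 - 1) * heatProfile (a + 2) t z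
        - (2 * a - 1) * a * z * heatProfile (a + 1) t z + (a - 1) ^ 2 * heatProfile a t z)
      + (ContinuousLinearMap.snd ℝ ℝ ℝ).smulRight (-a * heatProfile (a + 1) t z)) (t, z) := by
  have hU : (Ioi 0 ×ˢ Ioi 0 : Set (ℝ × ℝ)) ∈ nhds (t, z) :=
    prod_mem_nhds (Ioi_mem_nhds ht) (Ioi_mem_nhds hz)
  have hc : ∀ {a : ℝ}, 0 ≤ a → ContinuousAt (fun p : ℝ × ℝ => heatProfile a p.1 p.2) (t, z) :=
    fun ha => (continuousOn_heatProfile ha).continuousAt hU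
  have h := hasStrictFDerivAt_uncurry_coprod (𝕜 := ℝ) (u := (t, z)) (f := heatProfile a)
    (f₁ := fun t z => (1 : ℝ →L[ℝ] ℝ).smulRight (a * (a + 1) * (z ^ 2 - 1) * heatProfile (a + 2) t z
        - (2 * a - 1) * a * z * heatProfile (a + 1) t z + (a - 1) ^ 2 * heatProfile a t z))
    (f₂ := fun t z => (1 : ℝ →L[ℝ] ℝ).smulRight (-a * heatProfile (a + 1) t z))
    (by
      filter_upwards [hU] with v hv
      exact (hasDerivAt_heatProfile_left ha hv.1 hv.2).hasFDerivAt.congr_fderiv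
        (by ext; simp [Function.HasUncurry.uncurry]))
    (by
      filter_upwards [hU] with v hv
      exact (hasDerivAt_heatProfile_right ha hv.1 hv.2).hasFDerivAt.congr_fderiv
        (by ext; simp [Function.HasUncurry.uncurry]))
    (by
      have h0 := hc ha
      have h1 := hc (by linarith : 0 ≤ a + 1)
      have h2 := hc (by linarith : 0 ≤ a + 2)
      refine (ContinuousLinearMap.smulRightL ℝ ℝ ℂ (1 : ℝ →L[ℝ] ℝ)).continuous.continuousAt.comp
        (f := fun v : ℝ × ℝ => (a * (a + 1) * ((v.2 : ℂ) ^ 2 - 1) * heatProfile (a + 2) v.1 v.2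
        - (2 * a - 1) * a * v.2 * heatProfile (a + 1) v.1 v.2
        + (a - 1) ^ 2 * heatProfile a v.1 v.2)) ?_
      fun_prop)
    (by
      have h1 := hc (by linarith : 0 ≤ a + 1)
      refine (ContinuousLinearMap.smulRightL ℝ ℝ ℂ (1 : ℝ →L[ℝ] ℝ)).continuous.continuousAt.comp
        (f := fun v : ℝ × ℝ => -(a : ℂ) * heatProfile (a + 1) v.1 v.2) ?_
      fun_prop)
  refine h.congr_fderiv ?_
  ext <;> simp [Function.HasUncurry.uncurry]

/-- The derivative is expressed by members of the same family with larger exponents, so an induction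
on the order of differentiability closes once it runs over all a ≥ 0 together. -/
theorem contDiffOn_heatProfile {a : ℝ} (ha : 0 ≤ a) :
    ContDiffOn ℝ ∞ (fun p : ℝ × ℝ => heatProfile a p.1 p.2) (Ioi 0 ×ˢ Ioi 0) := by
  have hU : IsOpen (Ioi 0 ×ˢ Ioi 0 : Set (ℝ × ℝ)) := isOpen_Ioi.prod isOpen_Ioi
  refine contDiffOn_infty.2 fun m => ?_
  induction m generalizing a with
  | zero => exact contDiffOn_zero.2 (continuousOn_heatProfile ha)
  | succ m ih =>
    rw [Nat.cast_add, Nat.cast_one, contDiffOn_succ_iff_fderiv_of_isOpen hU]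
    refine ⟨fun p hp => (hasStrictFDerivAt_heatProfile ha hp.1 hp.2).hasFDerivAt.differentiableAt
      |>.differentiableWithinAt, by simp, ?_⟩
    have h0 := ih ha
    have h1 := ih (by linarith : 0 ≤ a + 1)
    have h2 := ih (by linarith : 0 ≤ a + 2)
    have hz : ContDiffOn ℝ m (fun v : ℝ × ℝ => (v.2 : ℂ)) (Ioi 0 ×ˢ Ioi 0) :=
      (Complex.ofRealCLM.contDiff.comp contDiff_snd).contDiffOn
    refine ContDiffOn.congr (f := fun v : ℝ × ℝ =>
      (ContinuousLinearMap.fst ℝ ℝ ℝ).smulRight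
        (a * (a + 1) * ((v.2 : ℂ) ^ 2 - 1) * heatProfile (a + 2) v.1 v.2
        - (2 * a - 1) * a * v.2 * heatProfile (a + 1) v.1 v.2
        + (a - 1) ^ 2 * heatProfile a v.1 v.2)
      + (ContinuousLinearMap.snd ℝ ℝ ℝ).smulRight (-(a : ℂ) * heatProfile (a + 1) v.1 v.2)) ?_
      fun p hp => (hasStrictFDerivAt_heatProfile ha hp.1 hp.2).hasFDerivAt.fderiv
    refine ContDiffOn.add ?_ ?_
    · refine (ContinuousLinearMap.smulRightL ℝ (ℝ × ℝ) ℂ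
        (ContinuousLinearMap.fst ℝ ℝ ℝ)).contDiff.comp_contDiffOn ?_
      exact (((contDiffOn_const.mul ((hz.pow 2).sub contDiffOn_const)).mul h2).sub
        ((contDiffOn_const.mul hz).mul h1)).add (contDiffOn_const.mul h0)
    · refine (ContinuousLinearMap.smulRightL ℝ (ℝ × ℝ) ℂ
        (ContinuousLinearMap.snd ℝ ℝ ℝ)).contDiff.comp_contDiffOn ?_
      exact contDiffOn_const.mul h1

/-! ### Integrals with parameters of compactly supported smooth functions -/

section ParametricIntegral

variable {P G : Type*} [NormedAddCommGroup G]
  [NormedSpace ℝ G] [MeasurableSpace G] [BorelSpace G] [FiniteDimensional ℝ G]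
  {μ : Measure G} [μ.IsAddHaarMeasure]

/-- An integral over G is the value at 0 of a convolution with the constant 1. In this way the
theorems on convolutions with a parameter give smoothness and derivatives of parametric integrals.
-/
theorem convolution_one_apply_zero (Φ : P → G → ℂ) (p : P) :
    (convolution (fun _ : G => (1 : ℝ)) (Φ p) (ContinuousLinearMap.lsmul ℝ ℝ) μ) 0
      = ∫ x, Φ p x ∂μ := by
  simp only [convolution, ContinuousLinearMap.lsmul_apply, one_smul, zero_sub]
  exact integral_neg_eq_self (Φ p) μ

variable [NormedAddCommGroup P] [NormedSpace ℝ P] {s : Set P} {k : Set G} {Φ : P → G → ℂ}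

theorem contDiffOn_parametric_integral (hs : IsOpen s) (hk : IsCompact k)
    (h0 : ∀ p ∈ s, ∀ x, x ∉ k → Φ p x = 0)
    (hΦ : ContDiffOn ℝ ∞ (fun q : P × G => Φ q.1 q.2) (s ×ˢ univ)) :
    ContDiffOn ℝ ∞ (fun p => ∫ x, Φ p x ∂μ) s := by
  have := contDiffOn_convolution_right_with_param_comp (n := ⊤) (μ := μ) (v := fun _ : P => (0 : G))
    (ContinuousLinearMap.lsmul ℝ ℝ) contDiffOn_const hs hk (fun p x hp hx => h0 p hp x hx)
    (f := fun _ : G => (1 : ℝ)) (locallyIntegrable_const 1) hΦ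
  simpa only [convolution_one_apply_zero] using this

theorem fderiv_eq_fderiv_prod_of_contDiffOn (hs : IsOpen s)
    (hΦ : ContDiffOn ℝ ∞ (fun q : P × G => Φ q.1 q.2) (s ×ˢ univ)) {p : P} (hp : p ∈ s) (v : P)
    (x : G) : fderiv ℝ (fun p => Φ p x) p v = fderiv ℝ (fun q : P × G => Φ q.1 q.2) (p, x) (v, 0) := by
  have hd : DifferentiableAt ℝ (fun q : P × G => Φ q.1 q.2) (p, x) :=
    (hΦ.contDiffAt ((hs.prod isOpen_univ).mem_nhds ⟨hp, mem_univ _⟩)).differentiableAt (by simp)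
  have h1 : HasFDerivAt (fun p : P => (p, x)) (ContinuousLinearMap.inl ℝ P G) p :=
    hasFDerivAt_prodMk_left p x
  change fderiv ℝ ((fun q : P × G => Φ q.1 q.2) ∘ fun p => (p, x)) p v = _
  rw [(hd.hasFDerivAt.comp p h1).fderiv]
  simp

theorem contDiffOn_fderiv_parameter (hs : IsOpen s)
    (hΦ : ContDiffOn ℝ ∞ (fun q : P × G => Φ q.1 q.2) (s ×ˢ univ)) (v : P) :
    ContDiffOn ℝ ∞ (fun q : P × G => fderiv ℝ (fun p => Φ p q.2) q.1 v) (s ×ˢ univ) := by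
  refine ContDiffOn.congr (f := fun q => fderiv ℝ (fun q : P × G => Φ q.1 q.2) q (v, 0)) ?_
    fun q hq => fderiv_eq_fderiv_prod_of_contDiffOn hs hΦ hq.1 v q.2
  exact (((contDiffOn_infty_iff_fderiv_of_isOpen (hs.prod isOpen_univ)).1 hΦ).2).clm_apply
    contDiffOn_const

theorem fderiv_parameter_eq_zero {G : Type*} {k : Set G} {Φ : P → G → ℂ} (hs : IsOpen s)
    (h0 : ∀ p ∈ s, ∀ x, x ∉ k → Φ p x = 0) (v : P) :
    ∀ p ∈ s, ∀ x, x ∉ k → fderiv ℝ (fun p => Φ p x) p v = 0 := by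
  intro p hp x hx
  have : (fun p => Φ p x) =ᶠ[nhds p] fun _ => 0 := by
    filter_upwards [hs.mem_nhds hp] with q hq using h0 q hq x hx
  rw [this.fderiv_eq]; simp

theorem fderiv_parametric_integral (hs : IsOpen s) (hk : IsCompact k)
    (h0 : ∀ p ∈ s, ∀ x, x ∉ k → Φ p x = 0)
    (hΦ : ContDiffOn ℝ ∞ (fun q : P × G => Φ q.1 q.2) (s ×ˢ univ)) {p : P} (hp : p ∈ s) (v : P) :
    fderiv ℝ (fun p => ∫ x, Φ p x ∂μ) p v = ∫ x, fderiv ℝ (fun p => Φ p x) p v ∂μ := by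
  have hO : IsOpen (s ×ˢ univ : Set (P × G)) := hs.prod isOpen_univ
  have hloc : LocallyIntegrable (fun _ : G => (1 : ℝ)) μ := locallyIntegrable_const 1
  have h1 := hasFDerivAt_convolution_right_with_param (μ := μ) (f := fun _ : G => (1 : ℝ))
    (ContinuousLinearMap.lsmul ℝ ℝ) hs hk (fun p x hp hx => h0 p hp x hx)
    hloc (hΦ.of_le (by simp)) (p, 0) hp
  have h2 : HasFDerivAt (fun p : P => (p, (0 : G))) (ContinuousLinearMap.inl ℝ P G) p :=
    hasFDerivAt_prodMk_left p 0
  have h3 := h1.comp p h2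
  have e : ((fun q : P × G => (convolution (fun _ : G => (1 : ℝ)) (Φ q.1)
      (ContinuousLinearMap.lsmul ℝ ℝ) μ) q.2) ∘ fun p : P => (p, (0 : G)))
      = fun p => ∫ x, Φ p x ∂μ := by
    ext p; exact convolution_one_apply_zero Φ p
  rw [e] at h3
  have hcont : Continuous fun x : G => fderiv ℝ (fun q : P × G => Φ q.1 q.2) (p, x) :=
    (hΦ.continuousOn_fderiv_of_isOpen hO (by simp)).comp_continuous (by fun_prop)
      fun x => ⟨hp, mem_univ _⟩
  have hsupp : HasCompactSupport fun x : G => fderiv ℝ (fun q : P × G => Φ q.1 q.2) (p, x) := by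
    refine HasCompactSupport.intro hk fun x hx => ?_
    have : (fun q : P × G => Φ q.1 q.2) =ᶠ[nhds (p, x)] fun _ => 0 := by
      filter_upwards [(hs.prod hk.isClosed.isOpen_compl).mem_nhds (⟨hp, hx⟩ : (p, x) ∈ s ×ˢ kᶜ)]
        with q hq using h0 q.1 hq.1 q.2 hq.2
    rw [this.fderiv_eq]; simp
  rw [h3.fderiv]
  simp only [ContinuousLinearMap.comp_apply, ContinuousLinearMap.inl_apply]
  -- Evaluating the operator-valued convolution at the vector (v, 0) brings the evaluation under the
  -- integral.
  refine (convolution_precompR_apply (ContinuousLinearMap.lsmul ℝ ℝ) hloc hsupp hcont 0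
    (v, 0)).trans ?_
  have := convolution_one_apply_zero (μ := μ)
    (fun (p : P) x => fderiv ℝ (fun q : P × G => Φ q.1 q.2) (p, x) (v, 0)) p
  rw [this]
  congr 1; ext x
  exact (fderiv_eq_fderiv_prod_of_contDiffOn hs hΦ hp v x).symm

end ParametricIntegral

end

section

/-! ### The function `cosh ρ` -/

variable {n : ℕ} [NeZero n]

theorem two_le_infty : (2 : ℕ∞ω) ≤ ∞ := WithTop.coe_le_coe.2 le_top

/-- The function `cosh ρ(w, w')` on the half space. -/
noncomputable def coshDist (w w' : EuclideanSpace ℝ (Fin n)) : ℝ :=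
  1 + ‖w - w'‖ ^ 2 / (2 * (w (lastIndex n) * w' (lastIndex n)))

theorem cosh_hypDist {w w' : EuclideanSpace ℝ (Fin n)} (hw : w ∈ hypSpace n)
    (hw' : w' ∈ hypSpace n) : Real.cosh (hypDist w w') = coshDist w w' := by
  have h := cosh_sq_half_hypDist hw hw'
  have h2 := Real.cosh_two_mul (hypDist w w' / 2)
  rw [Real.sinh_sq, h, mul_div_cancel₀ _ (two_ne_zero' ℝ)] at h2
  rw [h2, coshDist, dist_eq_norm]
  have h3 : 0 < w (lastIndex n) := hw
  have h4 : 0 < w' (lastIndex n) := hw'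
  field_simp
  ring

theorem one_le_coshDist {w w' : EuclideanSpace ℝ (Fin n)} (hw : w ∈ hypSpace n)
    (hw' : w' ∈ hypSpace n) : 1 ≤ coshDist w w' := by
  rw [← cosh_hypDist hw hw']; exact Real.one_le_cosh _

theorem coshDist_pos {w w' : EuclideanSpace ℝ (Fin n)} (hw : w ∈ hypSpace n)
    (hw' : w' ∈ hypSpace n) : 0 < coshDist w w' := zero_lt_one.trans_le (one_le_coshDist hw hw')

theorem isOpen_hypSpace : IsOpen (hypSpace n) :=
  isOpen_lt continuous_const (by fun_prop)

theorem contDiff_coordinate {n : ℕ} (i : Fin n) :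
    ContDiff ℝ ∞ fun w : EuclideanSpace ℝ (Fin n) => w i :=
  (EuclideanSpace.proj (𝕜 := ℝ) i).contDiff

theorem contDiffOn_coshDist : ContDiffOn ℝ ∞
    (fun p : EuclideanSpace ℝ (Fin n) × EuclideanSpace ℝ (Fin n) => coshDist p.1 p.2)
    (hypSpace n ×ˢ hypSpace n) := by
  unfold coshDist
  refine contDiffOn_const.add (ContDiffOn.div ?_ ?_ ?_)
  · exact ((contDiff_fst.sub contDiff_snd).norm_sq ℝ).contDiffOn
  · exact (contDiff_const.mul (((contDiff_coordinate _).comp contDiff_fst).mul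
      ((contDiff_coordinate _).comp contDiff_snd))).contDiffOn
  · rintro ⟨w, w'⟩ ⟨hw, hw'⟩
    have h3 : 0 < w (lastIndex n) := hw
    have h4 : 0 < w' (lastIndex n) := hw'
    positivity

theorem contDiffOn_coshDist_left {w' : EuclideanSpace ℝ (Fin n)} (hw' : w' ∈ hypSpace n) :
    ContDiffOn ℝ ∞ (fun w => coshDist w w') (hypSpace n) :=
  ContDiffOn.comp (g := fun p : EuclideanSpace ℝ (Fin n) × EuclideanSpace ℝ (Fin n) =>
    coshDist p.1 p.2) (f := fun w => (w, w')) contDiffOn_coshDist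
    (contDiff_id.prodMk contDiff_const).contDiffOn fun _ hw => ⟨hw, hw'⟩

/-- The partial derivative of `coshDist` in `w_i`. -/
noncomputable def coshDistPartial (w' : EuclideanSpace ℝ (Fin n)) (i : Fin n)
    (w : EuclideanSpace ℝ (Fin n)) : ℝ :=
  (w i - w' i) / (w (lastIndex n) * w' (lastIndex n))
    - (EuclideanSpace.single i (1 : ℝ)) (lastIndex n) *
      (‖w - w'‖ ^ 2 / (2 * (w (lastIndex n) ^ 2 * w' (lastIndex n))))

/-- The second partial derivative of `coshDist` in `w_i`. -/
noncomputable def coshDistPartialTwo (w' : EuclideanSpace ℝ (Fin n)) (i : Fin n)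
    (w : EuclideanSpace ℝ (Fin n)) : ℝ :=
  1 / (w (lastIndex n) * w' (lastIndex n))
        - 2 * (EuclideanSpace.single i (1 : ℝ)) (lastIndex n) * (w i - w' i)
          / (w (lastIndex n) ^ 2 * w' (lastIndex n))
        + (EuclideanSpace.single i (1 : ℝ)) (lastIndex n) ^ 2 * ‖w - w'‖ ^ 2
          / (w (lastIndex n) ^ 3 * w' (lastIndex n))

theorem norm_sq_line {n : ℕ} (w w' : EuclideanSpace ℝ (Fin n)) (i : Fin n) (s : ℝ) :
    ‖w + s • EuclideanSpace.single i (1 : ℝ) - w'‖ ^ 2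
      = ‖w - w'‖ ^ 2 + 2 * s * (w i - w' i) + s ^ 2 := by
  rw [show w + s • EuclideanSpace.single i (1 : ℝ) - w'
    = (w - w') + s • EuclideanSpace.single i (1 : ℝ) by abel, norm_add_sq_real, norm_smul,
    inner_smul_right, EuclideanSpace.inner_single_right]
  simp
  ring

theorem hasDerivAt_line_aux {x c : ℝ} : HasDerivAt (fun s : ℝ => x + s * c) c 0 := by
  simpa using ((hasDerivAt_id (0 : ℝ)).mul_const c).const_add x

theorem hasDerivAt_norm_sq_line {n : ℕ} (w w' : EuclideanSpace ℝ (Fin n)) (i : Fin n) :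
    HasDerivAt (fun s : ℝ => ‖w + s • EuclideanSpace.single i (1 : ℝ) - w'‖ ^ 2)
      (2 * (w i - w' i)) 0 := by
  simp only [norm_sq_line]
  have h1 := (((hasDerivAt_id (0 : ℝ)).const_mul 2).mul_const (w i - w' i)).const_add
    (‖w - w'‖ ^ 2)
  refine (h1.add ((hasDerivAt_id (0 : ℝ)).pow 2)).congr_deriv ?_
  simp

theorem hasDerivAt_coshDist_line {w w' : EuclideanSpace ℝ (Fin n)} (hw : w ∈ hypSpace n)
    (hw' : w' ∈ hypSpace n) (i : Fin n) :
    HasDerivAt (fun s : ℝ => coshDist (w + s • EuclideanSpace.single i (1 : ℝ)) w')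
      (coshDistPartial w' i w) 0 := by
  have h3 : w (lastIndex n) ≠ 0 := ne_of_gt hw
  have h4 : w' (lastIndex n) ≠ 0 := ne_of_gt hw'
  have hx := hasDerivAt_line_aux (x := w (lastIndex n))
    (c := (EuclideanSpace.single i (1 : ℝ)) (lastIndex n))
  have := ((hasDerivAt_norm_sq_line w w' i).div ((hx.mul_const (w' (lastIndex n))).const_mul 2)
    (by simp [h3, h4])).const_add 1
  refine this.congr_deriv ?_
  simp only [zero_smul, add_zero, zero_mul, coshDistPartial]
  field_simp

theorem hasDerivAt_coshDistPartial_line {w w' : EuclideanSpace ℝ (Fin n)} (hw : w ∈ hypSpace n)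
    (hw' : w' ∈ hypSpace n) (i : Fin n) :
    HasDerivAt (fun s : ℝ => coshDistPartial w' i (w + s • EuclideanSpace.single i (1 : ℝ)))
      (coshDistPartialTwo w' i w) 0 := by
  have h3 : w (lastIndex n) ≠ 0 := ne_of_gt hw
  have h4 : w' (lastIndex n) ≠ 0 := ne_of_gt hw'
  have hx := hasDerivAt_line_aux (x := w (lastIndex n))
    (c := (EuclideanSpace.single i (1 : ℝ)) (lastIndex n))
  have hi : HasDerivAt (fun s : ℝ => (w + s • EuclideanSpace.single i (1 : ℝ)) i - w' i) 1 0 := by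
    simpa using (hasDerivAt_line_aux (x := w i) (c := 1)).sub_const (w' i)
  have := (hi.div (hx.mul_const (w' (lastIndex n))) (by simp [h3, h4])).sub
    (((hasDerivAt_norm_sq_line w w' i).div (((hx.pow 2).mul_const (w' (lastIndex n))).const_mul 2)
    (by simp [h3, h4])).const_mul ((EuclideanSpace.single i (1 : ℝ)) (lastIndex n)))
  refine this.congr_deriv ?_
  simp only [zero_smul, add_zero, zero_mul, Pi.pow_apply, coshDistPartialTwo]
  field_simp
  ring

/-- Reduces partial derivatives to one-variable calculus along w + s e_i, which is how the
derivatives of `coshDist` and of its compositions are found. -/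
theorem fderiv_apply_eq_of_hasDerivAt_line {F : Type*} [NormedAddCommGroup F] [NormedSpace ℝ F]
    {E : Type*} [NormedAddCommGroup E] [NormedSpace ℝ E] {f : E → F} {w v : E} {f' : F}
    (hf : DifferentiableAt ℝ f w) (h : HasDerivAt (fun s : ℝ => f (w + s • v)) f' 0) :
    fderiv ℝ f w v = f' := by
  rw [← hf.lineDeriv_eq_fderiv]; exact h.deriv

theorem differentiableAt_coshDist {w w' : EuclideanSpace ℝ (Fin n)} (hw : w ∈ hypSpace n)
    (hw' : w' ∈ hypSpace n) : DifferentiableAt ℝ (fun w => coshDist w w') w :=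
  ((contDiffOn_coshDist_left hw').contDiffAt (isOpen_hypSpace.mem_nhds hw)).differentiableAt
    (by simp)

theorem fderiv_coshDist {w w' : EuclideanSpace ℝ (Fin n)} (hw : w ∈ hypSpace n)
    (hw' : w' ∈ hypSpace n) (i : Fin n) :
    fderiv ℝ (fun w => coshDist w w') w (EuclideanSpace.single i 1) = coshDistPartial w' i w :=
  fderiv_apply_eq_of_hasDerivAt_line (differentiableAt_coshDist hw hw')
    (hasDerivAt_coshDist_line hw hw' i)

theorem contDiffOn_coshDistPartial {w' : EuclideanSpace ℝ (Fin n)} (hw' : w' ∈ hypSpace n)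
    (i : Fin n) : ContDiffOn ℝ ∞ (coshDistPartial w' i) (hypSpace n) := by
  refine ContDiffOn.congr (((contDiffOn_infty_iff_fderiv_of_isOpen isOpen_hypSpace).1
    (contDiffOn_coshDist_left hw')).2.clm_apply contDiffOn_const) fun w hw =>
      (fderiv_coshDist hw hw' i).symm

/-- The factor is a Kronecker delta for the last index. Keeping it in the formulas treats the last
coordinate and the other ones uniformly. -/
theorem sum_single_last (f : Fin n → ℝ) :
    ∑ i, (EuclideanSpace.single i (1 : ℝ)) (lastIndex n) * f i = f (lastIndex n) := by
  simp [Finset.sum_ite_eq]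

/-- `|∇ cosh ρ|² = cosh² ρ - 1` for the hyperbolic gradient. -/
theorem sum_coshDistPartial_sq {w w' : EuclideanSpace ℝ (Fin n)} (hw : w ∈ hypSpace n)
    (hw' : w' ∈ hypSpace n) :
    w (lastIndex n) ^ 2 * ∑ i, coshDistPartial w' i w ^ 2 = coshDist w w' ^ 2 - 1 := by
  have h3 : w (lastIndex n) ≠ 0 := ne_of_gt hw
  have h4 : w' (lastIndex n) ≠ 0 := ne_of_gt hw'
  set x := w (lastIndex n) with hx
  set x' := w' (lastIndex n) with hx'
  set q := ‖w - w'‖ ^ 2 with hq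
  have hsum : q = ∑ i, (w i - w' i) ^ 2 := by
    rw [hq, EuclideanSpace.norm_sq_eq]; simp
  have e : ∀ i, coshDistPartial w' i w ^ 2 = (1 / (x * x') ^ 2) * (w i - w' i) ^ 2
      + (EuclideanSpace.single i (1 : ℝ)) (lastIndex n) *
        (-(w i - w' i) * q / (x ^ 3 * x' ^ 2)
          + (EuclideanSpace.single i (1 : ℝ)) (lastIndex n) * (q ^ 2 / (4 * (x ^ 4 * x' ^ 2)))) := by
    intro i
    rw [coshDistPartial, ← hx, ← hx', ← hq]
    field_simp
    ring
  simp only [e, Finset.sum_add_distrib, ← Finset.mul_sum, ← hsum, sum_single_last]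
  rw [coshDist, ← hx, ← hx', ← hq]
  simp only [PiLp.single_apply, if_true]
  field_simp
  ring

theorem sum_coshDistPartialTwo (w w' : EuclideanSpace ℝ (Fin n)) :
    ∑ i, coshDistPartialTwo w' i w = n / (w (lastIndex n) * w' (lastIndex n))
      - 2 * (w (lastIndex n) - w' (lastIndex n)) / (w (lastIndex n) ^ 2 * w' (lastIndex n))
      + ‖w - w'‖ ^ 2 / (w (lastIndex n) ^ 3 * w' (lastIndex n)) := by
  have e : ∀ i, coshDistPartialTwo w' i w = 1 / (w (lastIndex n) * w' (lastIndex n)) +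
      (EuclideanSpace.single i (1 : ℝ)) (lastIndex n) *
        (-2 * (w i - w' i) / (w (lastIndex n) ^ 2 * w' (lastIndex n)) +
        (EuclideanSpace.single i (1 : ℝ)) (lastIndex n) *
          (‖w - w'‖ ^ 2 / (w (lastIndex n) ^ 3 * w' (lastIndex n)))) :=
    fun i => by rw [coshDistPartialTwo]; ring
  simp only [e]
  rw [Finset.sum_add_distrib, sum_single_last]
  simp only [Finset.sum_const, Finset.card_univ, Fintype.card_fin, PiLp.single_apply, if_true,
    nsmul_eq_mul]
  ring

theorem laplacian_eq_sum_fderiv {n : ℕ} {f : EuclideanSpace ℝ (Fin n) → ℂ}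
    {w : EuclideanSpace ℝ (Fin n)}
    (hf : DifferentiableAt ℝ (fderiv ℝ f) w) :
    Laplacian.laplacian f w = ∑ i, fderiv ℝ (fun w => fderiv ℝ f w (EuclideanSpace.single i 1)) w
      (EuclideanSpace.single i 1) := by
  rw [InnerProductSpace.laplacian_eq_iteratedFDeriv_orthonormalBasis f
    (EuclideanSpace.basisFun (Fin n) ℝ)]
  refine Finset.sum_congr rfl fun i _ => ?_
  rw [iteratedFDeriv_two_apply, fderiv_clm_apply hf (differentiableAt_const _)]
  simp

/-- By the chain rule f'' is multiplied by |∇ cosh ρ|² = cosh² ρ - 1 and f' by (x_n²Δ + (2 - n)x_n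
∂_n) cosh ρ = n cosh ρ. -/
theorem hypLaplacian_comp_coshDist {f f' f'' : ℝ → ℂ}
    (hf : ∀ z > 0, HasDerivAt f (f' z) z) (hf' : ∀ z > 0, HasDerivAt f' (f'' z) z)
    {w w' : EuclideanSpace ℝ (Fin n)} (hw : w ∈ hypSpace n) (hw' : w' ∈ hypSpace n)
    (hs : ContDiffOn ℝ 2 f (Ioi 0)) :
    hypLaplacian (fun w => f (coshDist w w')) w =
      ((coshDist w w' : ℂ) ^ 2 - 1) * f'' (coshDist w w')
        + n * coshDist w w' * f' (coshDist w w') + ((n : ℂ) - 1) ^ 2 / 4 * f (coshDist w w') := by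
  have h3 : w (lastIndex n) ≠ 0 := ne_of_gt hw
  have h4 : w' (lastIndex n) ≠ 0 := ne_of_gt hw'
  have hcomp : ContDiffOn ℝ 2 (fun w => f (coshDist w w')) (hypSpace n) :=
    hs.comp ((contDiffOn_coshDist_left hw').of_le two_le_infty)
      fun v hv => coshDist_pos hv hw'
  have hd1 : ∀ v ∈ hypSpace n, ∀ i, fderiv ℝ (fun w => f (coshDist w w')) v
      (EuclideanSpace.single i 1) = coshDistPartial w' i v • f' (coshDist v w') := by
    intro v hv i
    refine fderiv_apply_eq_of_hasDerivAt_line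
      ((hcomp.contDiffAt (isOpen_hypSpace.mem_nhds hv)).differentiableAt (by simp)) ?_
    refine HasDerivAt.scomp (0 : ℝ) ?_ (hasDerivAt_coshDist_line hv hw' i)
    simpa using hf _ (coshDist_pos hv hw')
  have hd2 : ∀ i, fderiv ℝ (fun v => fderiv ℝ (fun w => f (coshDist w w')) v
      (EuclideanSpace.single i 1)) w (EuclideanSpace.single i 1) =
      coshDistPartial w' i w • (coshDistPartial w' i w • f'' (coshDist w w'))
      + (coshDistPartialTwo w' i w) • f' (coshDist w w') := by
    intro i
    have hev : (fun v => fderiv ℝ (fun w => f (coshDist w w')) v (EuclideanSpace.single i 1))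
        =ᶠ[nhds w] fun v => coshDistPartial w' i v • f' (coshDist v w') := by
      filter_upwards [isOpen_hypSpace.mem_nhds hw] with v hv using hd1 v hv i
    rw [hev.fderiv_eq]
    have hdp := ((contDiffOn_coshDistPartial hw' i).contDiffAt
      (isOpen_hypSpace.mem_nhds hw)).differentiableAt (by simp)
    have hdf : DifferentiableAt ℝ (fun v => f' (coshDist v w')) w :=
      (hf' _ (coshDist_pos hw hw')).differentiableAt.comp w (differentiableAt_coshDist hw hw')
    refine fderiv_apply_eq_of_hasDerivAt_line (hdp.smul hdf) ?_
    have hl : HasDerivAt (fun s : ℝ => f' (coshDist (w + s • EuclideanSpace.single i (1 : ℝ)) w'))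
        (coshDistPartial w' i w • f'' (coshDist w w')) 0 := by
      refine HasDerivAt.scomp (0 : ℝ) ?_ (hasDerivAt_coshDist_line hw hw' i)
      simpa using hf' _ (coshDist_pos hw hw')
    refine ((hasDerivAt_coshDistPartial_line hw hw' i).smul hl).congr_deriv ?_
    simp only [zero_smul, add_zero]
  have hdd : DifferentiableAt ℝ (fderiv ℝ (fun w => f (coshDist w w'))) w :=
    ((hcomp.contDiffAt (isOpen_hypSpace.mem_nhds hw)).fderiv_right (m := 1)
      (by norm_num)).differentiableAt (by simp)
  rw [hypLaplacian, laplacian_eq_sum_fderiv hdd, hd1 w hw]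
  simp only [hd2, smul_smul, Finset.sum_add_distrib, ← Finset.sum_smul]
  have hsq := sum_coshDistPartial_sq hw hw'
  set x := w (lastIndex n) with hx
  set x' := w' (lastIndex n) with hx'
  set q := ‖w - w'‖ ^ 2 with hq
  have hz : coshDist w w' = 1 + q / (2 * (x * x')) := rfl
  have hlast : coshDistPartial w' (lastIndex n) w = (x - x') / (x * x') - q / (2 * (x ^ 2 * x')) := by
    rw [coshDistPartial]; simp [← hx, ← hx', ← hq]
  rw [sum_coshDistPartialTwo, hlast, ← hx, ← hx', ← hq]
  -- The second-order and drift parts of 𝓛_n, applied to cosh ρ itself, give n cosh ρ.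
  have key : x ^ 2 * (n / (x * x') - 2 * (x - x') / (x ^ 2 * x') + q / (x ^ 3 * x'))
      + (2 - n) * x * ((x - x') / (x * x') - q / (2 * (x ^ 2 * x'))) = n * coshDist w w' := by
    rw [hz]; field_simp; ring
  have hsq' : (x : ℂ) ^ 2 * ((∑ i, coshDistPartial w' i w * coshDistPartial w' i w : ℝ) : ℂ)
      = (coshDist w w' : ℂ) ^ 2 - 1 := by
    simp only [← sq]
    rw [← Complex.ofReal_pow, ← Complex.ofReal_mul, hsq]; push_cast; rfl
  have key' := congrArg (fun r : ℝ => (r : ℂ)) key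
  simp only [Complex.real_smul]
  push_cast at key' ⊢ hsq'
  linear_combination f'' (coshDist w w') * hsq' + f' (coshDist w w') * key'

/-- The heat kernel profile solves the heat equation. -/
theorem hypLaplacian_heatProfile {t : ℝ} (ht : 0 < t) {w w' : EuclideanSpace ℝ (Fin n)}
    (hw : w ∈ hypSpace n) (hw' : w' ∈ hypSpace n) :
    hypLaplacian (fun w => heatProfile (((n : ℝ) + 1) / 2) t (coshDist w w')) w =
      deriv (fun s => heatProfile (((n : ℝ) + 1) / 2) s (coshDist w w')) t := by
  set a : ℝ := ((n : ℝ) + 1) / 2 with ha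
  have ha0 : 0 ≤ a := by positivity
  have hs : ContDiffOn ℝ 2 (fun z => heatProfile a t z) (Ioi 0) :=
    ((contDiffOn_heatProfile ha0).comp (contDiff_const.prodMk contDiff_id).contDiffOn
      fun z hz => ⟨ht, hz⟩).of_le two_le_infty
  rw [hypLaplacian_comp_coshDist (f' := fun z => -a * heatProfile (a + 1) t z)
    (f'' := fun z => a * (a + 1) * heatProfile (a + 2) t z)
    (fun z hz => hasDerivAt_heatProfile_right ha0 ht hz) (fun z hz => ?_) hw hw' hs,
    (hasDerivAt_heatProfile_left ha0 ht (coshDist_pos hw hw')).deriv]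
  -- With a = (n + 1)/2 the coefficients 2a - 1 and (a - 1)² of the equation for the profile become
  -- n and (n - 1)²/4.
  · have : (n : ℂ) = 2 * (a : ℂ) - 1 := by rw [ha]; push_cast; ring
    rw [this]; ring
  · refine ((hasDerivAt_heatProfile_right (by linarith : 0 ≤ a + 1) ht hz).const_mul
      (-(a : ℂ))).congr_deriv ?_
    rw [show a + 1 + 1 = a + 2 by ring]
    push_cast; ring

end

section

/-! ### The contour integral -/

/-- The integrand of the heat kernel as a function of `z = cosh ρ`, with `a = (n + 1) / 2`. -/
noncomputable def contourIntegrand (a t z : ℝ) (y : ℂ) : ℂ :=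
  Complex.exp (y ^ 2 / (4 * (t : ℂ))) * Complex.sin y / ((z : ℂ) - Complex.cos y) ^ (a : ℂ)

theorem sub_cos_eq (z σ b : ℝ) : (z : ℂ) - Complex.cos ((σ : ℂ) + b * Complex.I) =
    ((z - Real.cos σ * Real.cosh b : ℝ) : ℂ) + ((Real.sin σ * Real.sinh b : ℝ) : ℂ) * Complex.I := by
  rw [Complex.cos_add_mul_I]; push_cast; ring

theorem re_sub_cos (z σ b : ℝ) :
    ((z : ℂ) - Complex.cos ((σ : ℂ) + b * Complex.I)).re = z - Real.cos σ * Real.cosh b := by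
  rw [sub_cos_eq]
  simp only [Complex.add_re, Complex.add_im, Complex.re_ofReal_mul, Complex.im_ofReal_mul,
    Complex.ofReal_re, Complex.ofReal_im, Complex.I_re, Complex.I_im]
  ring

theorem im_sub_cos (z σ b : ℝ) :
    ((z : ℂ) - Complex.cos ((σ : ℂ) + b * Complex.I)).im = Real.sin σ * Real.sinh b := by
  rw [sub_cos_eq]
  simp only [Complex.add_re, Complex.add_im, Complex.re_ofReal_mul, Complex.im_ofReal_mul,
    Complex.ofReal_re, Complex.ofReal_im, Complex.I_re, Complex.I_im]
  ring

theorem cos_lt_one_of_mem_Ioo {σ : ℝ} (hσ : σ ∈ Ioo 0 (2 * Real.pi)) : Real.cos σ < 1 := by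
  refine lt_of_le_of_ne (Real.cos_le_one σ) fun h => ?_
  have := (Real.cos_eq_one_iff_of_lt_of_lt (by linarith [hσ.1, Real.pi_pos]) hσ.2).1 h
  exact hσ.1.ne' this

/-- The imaginary part sin σ sinh b vanishes only for b = 0, where the real part is z - cos σ > 0,
or for σ = π, where it is z + cosh b > 0. Hence the principal power is holomorphic throughout the
strip 0 < Re y < 2π. -/
theorem sub_cos_mem_slitPlane {z σ : ℝ} (hz : 1 ≤ z) (hσ : σ ∈ Ioo 0 (2 * Real.pi)) (b : ℝ) :
    (z : ℂ) - Complex.cos ((σ : ℂ) + b * Complex.I) ∈ Complex.slitPlane := by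
  rw [Complex.mem_slitPlane_iff, re_sub_cos, im_sub_cos]
  have hc := cos_lt_one_of_mem_Ioo hσ
  by_cases hb : b = 0
  · left; subst hb; simp; linarith
  by_cases hs : Real.sin σ = 0
  · left
    have h1 := Real.sin_sq_add_cos_sq σ
    have h2 : Real.cos σ = -1 := by
      rw [hs] at h1
      have : (Real.cos σ - 1) * (Real.cos σ + 1) = 0 := by linear_combination h1
      rcases mul_eq_zero.1 this with h | h <;> linarith
    rw [h2]; linarith [Real.cosh_pos b]
  · right
    exact mul_ne_zero hs (by simpa using hb)

/-- With c = cos σ and C = cosh b one has |z - cos y|² = z² + C² - 2zCc - 1 + c². For c ≥ 0 the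
inequality 2zC ≤ z² + C² leaves (1 - c)(z² + C² - 1 - c); for c ≤ 0 the expression is at least z².
The bound is uniform in b and degenerates only at the edges of the strip. -/
theorem le_norm_sub_cos {z : ℝ} (hz : 1 ≤ z) (σ b : ℝ) :
    (1 - Real.cos σ) / 4 * z ≤ ‖(z : ℂ) - Complex.cos ((σ : ℂ) + b * Complex.I)‖ := by
  have h0 := Real.cos_le_one σ
  have h0' := Real.neg_one_le_cos σ
  refine le_of_sq_le_sq ?_ (norm_nonneg _) 
  rw [← Complex.normSq_eq_norm_sq, Complex.normSq_apply, re_sub_cos, im_sub_cos]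
  have h1 := Real.sin_sq_add_cos_sq σ
  have h2 := Real.cosh_sq b
  have h3 := Real.one_le_cosh b
  set c := Real.cos σ
  set C := Real.cosh b
  have e : (z - c * C) * (z - c * C) + Real.sin σ * Real.sinh b * (Real.sin σ * Real.sinh b)
      = z ^ 2 + C ^ 2 - 2 * (z * C) * c - 1 + c ^ 2 := by
    linear_combination (Real.sinh b ^ 2) * h1 - (1 - c ^ 2) * h2
  rw [e]
  have h5 : 1 ≤ z ^ 2 := one_le_pow₀ hz
  have h6 : 1 ≤ C ^ 2 := one_le_pow₀ h3
  have h7 : 2 * (z * C) ≤ z ^ 2 + C ^ 2 := by nlinarith [sq_nonneg (z - C)]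
  have h8 : 0 < z * C := by positivity
  rcases le_total 0 c with hc | hc
  · have h9 : (1 - c) * (z ^ 2 + C ^ 2 - 1 - c) ≤ z ^ 2 + C ^ 2 - 2 * (z * C) * c - 1 + c ^ 2 := by
      nlinarith [mul_le_mul_of_nonneg_right h7 hc]
    refine le_trans ?_ h9
    have : (1 - c) * (z ^ 2 / 16) ≤ z ^ 2 + C ^ 2 - 1 - c := by nlinarith
    nlinarith [mul_le_mul_of_nonneg_left this (sub_nonneg.2 h0)]
  · have h9 : z ^ 2 ≤ z ^ 2 + C ^ 2 - 2 * (z * C) * c - 1 + c ^ 2 := by nlinarith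
    refine le_trans ?_ h9
    have : ((1 - c) / 4) ^ 2 ≤ 1 := by nlinarith
    nlinarith [mul_le_mul_of_nonneg_right this (sq_nonneg z)]

theorem norm_sin_add_mul_I_le (σ b : ℝ) :
    ‖Complex.sin ((σ : ℂ) + b * Complex.I)‖ ≤ Real.exp |b| := by
  refine le_trans ?_ (cosh_le_exp_abs b)
  refine le_of_sq_le_sq ?_ (Real.cosh_pos b).le
  rw [← Complex.normSq_eq_norm_sq, Complex.normSq_apply, Complex.sin_add_mul_I]
  simp only [← Complex.ofReal_cos, ← Complex.ofReal_sin, ← Complex.ofReal_cosh,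
    ← Complex.ofReal_sinh, Complex.add_re, Complex.add_im, Complex.mul_re, Complex.mul_im,
    Complex.ofReal_re, Complex.ofReal_im, Complex.I_re, Complex.I_im]
  have h1 := Real.sin_sq_add_cos_sq σ
  have h2 := Real.cosh_sq b
  nlinarith [sq_nonneg (Real.cos σ)]

/-- A lower bound m for 1 - cos σ, in place of that number itself, makes the estimate uniform over a
compact set of abscissas, as the shift of the contour requires. -/
theorem norm_contourIntegrand_le {a t z m σ : ℝ} (ha : 0 ≤ a) (hz : 1 ≤ z) (hm : 0 < m)
    (hmσ : m ≤ 1 - Real.cos σ) (b : ℝ) :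
    ‖contourIntegrand a t z ((σ : ℂ) + b * Complex.I)‖ ≤
      Real.exp (σ ^ 2 / (4 * t)) / (m / 4 * z) ^ a *
        (Real.exp (1 * |b|) * Real.exp (-(1 / (4 * t)) * b ^ 2)) := by
  rw [contourIntegrand, norm_div, norm_mul, norm_exp_sq_div, Complex.norm_cpow_real]
  have h0 : 0 < m / 4 * z := by positivity
  have h1 : m / 4 * z ≤ ‖(z : ℂ) - Complex.cos ((σ : ℂ) + b * Complex.I)‖ :=
    le_trans (by gcongr) (le_norm_sub_cos hz σ b)
  have h2 := norm_sin_add_mul_I_le σ b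
  calc _ ≤ Real.exp (σ ^ 2 / (4 * t)) * Real.exp (-(1 / (4 * t)) * b ^ 2) * Real.exp |b| /
        (m / 4 * z) ^ a := by gcongr
    _ = _ := by rw [one_mul]; ring

theorem continuous_contourIntegrand {a t z σ : ℝ} (hz : 1 ≤ z) (hσ : σ ∈ Ioo 0 (2 * Real.pi)) :
    Continuous fun b : ℝ => contourIntegrand a t z ((σ : ℂ) + b * Complex.I) := by
  unfold contourIntegrand
  refine Continuous.div (by fun_prop) ?_ fun b => ?_
  · exact Continuous.cpow (by fun_prop) continuous_const fun b => sub_cos_mem_slitPlane hz hσ b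
  · rw [Complex.cpow_ne_zero_iff]
    exact Or.inl (Complex.slitPlane_ne_zero (sub_cos_mem_slitPlane hz hσ b))

theorem integrable_contourIntegrand {a t z σ : ℝ} (ha : 0 ≤ a) (ht : 0 < t) (hz : 1 ≤ z)
    (hσ : σ ∈ Ioo 0 (2 * Real.pi)) :
    Integrable fun b : ℝ => contourIntegrand a t z ((σ : ℂ) + b * Complex.I) := by
  have hc := cos_lt_one_of_mem_Ioo hσ
  exact Integrable.mono' ((integrable_exp_mul_abs_mul_exp_neg (c := 1 / (4 * t)) (by positivity)
    1).const_mul _) (continuous_contourIntegrand hz hσ).aestronglyMeasurable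
    (Filter.Eventually.of_forall fun b =>
      norm_contourIntegrand_le ha hz (sub_pos.2 hc) le_rfl b)

theorem differentiableAt_contourIntegrand {a t z σ : ℝ} (hz : 1 ≤ z)
    (hσ : σ ∈ Ioo 0 (2 * Real.pi)) (b : ℝ) :
    DifferentiableAt ℂ (contourIntegrand a t z) ((σ : ℂ) + b * Complex.I) := by
  have h := sub_cos_mem_slitPlane hz hσ b
  unfold contourIntegrand
  refine DifferentiableAt.div (by fun_prop) ?_ ?_
  · exact DifferentiableAt.cpow (by fun_prop) (by fun_prop) h
  · rw [Complex.cpow_ne_zero_iff]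
    exact Or.inl (Complex.slitPlane_ne_zero h)

theorem tendsto_exp_mul_abs_mul_exp_neg {c : ℝ} (hc : 0 < c) (N : ℝ) :
    Filter.Tendsto (fun b : ℝ => Real.exp (N * |b|) * Real.exp (-c * b ^ 2)) Filter.atTop
      (nhds 0) := by
  have h : Filter.Tendsto (fun b : ℝ => Real.exp (N ^ 2 / (2 * c)) * Real.exp (-(c / 2) * b ^ 2))
      Filter.atTop (nhds 0) := by
    rw [← mul_zero (Real.exp (N ^ 2 / (2 * c)))]
    refine Filter.Tendsto.const_mul _ (Real.tendsto_exp_atBot.comp ?_)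
    exact (Filter.tendsto_pow_atTop two_ne_zero).const_mul_atTop_of_neg (by linarith)
  exact squeeze_zero (fun b => by positivity) (fun b => exp_mul_abs_mul_exp_neg_le hc N b) h

/-- The contour integral does not depend on the abscissa of the contour. -/
theorem integral_contourIntegrand_eq {a t z σ σ' : ℝ} (ha : 0 ≤ a) (ht : 0 < t) (hz : 1 ≤ z)
    (hσ : σ ∈ Ioo 0 (2 * Real.pi)) (hσ' : σ' ∈ Ioo 0 (2 * Real.pi)) :
    ∫ b : ℝ, contourIntegrand a t z ((σ : ℂ) + b * Complex.I) =
      ∫ b : ℝ, contourIntegrand a t z ((σ' : ℂ) + b * Complex.I) := by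
  set f := contourIntegrand a t z with hf
  have hsub : uIcc σ σ' ⊆ Ioo 0 (2 * Real.pi) := Set.OrdConnected.uIcc_subset inferInstance hσ hσ'
  -- Between the two abscissas 1 - cos is continuous and positive on a compact interval.
  obtain ⟨m, hm, hmle⟩ : ∃ m > 0, ∀ x ∈ uIcc σ σ', m ≤ 1 - Real.cos x := by
    obtain ⟨x, hx, hmin⟩ := isCompact_uIcc.exists_isMinOn (nonempty_uIcc (a := σ) (b := σ'))
      (f := fun x => 1 - Real.cos x) (by fun_prop)
    exact ⟨1 - Real.cos x, sub_pos.2 (cos_lt_one_of_mem_Ioo (hsub hx)), fun y hy => hmin hy⟩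
  set K := Real.exp ((2 * Real.pi) ^ 2 / (4 * t)) / (m / 4 * z) ^ a with hK
  have hbound : ∀ x ∈ uIcc σ σ', ∀ b : ℝ, ‖f ((x : ℂ) + b * Complex.I)‖ ≤
      K * (Real.exp (1 * |b|) * Real.exp (-(1 / (4 * t)) * b ^ 2)) := fun x hx b => by
    refine (norm_contourIntegrand_le ha hz hm (hmle x hx) b).trans ?_
    have h1 : 0 < x := (hsub hx).1
    have h2 : x ≤ 2 * Real.pi := (hsub hx).2.le
    rw [hK]
    gcongr
  -- The horizontal sides, at height R for s = 1 and -R for s = -1, tend to 0 by the Gaussian decay.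
  have hhor : ∀ s : ℝ, s = 1 ∨ s = -1 → Filter.Tendsto (fun R : ℝ =>
      ∫ x in σ..σ', f ((x : ℂ) + ((s * R : ℝ) : ℂ) * Complex.I)) Filter.atTop (nhds 0) := by
    intro s hs
    have hlim : Filter.Tendsto (fun R : ℝ => K * (Real.exp (1 * |R|) *
        Real.exp (-(1 / (4 * t)) * R ^ 2)) * |σ' - σ|) Filter.atTop (nhds 0) := by
      have := ((tendsto_exp_mul_abs_mul_exp_neg (c := 1 / (4 * t)) (by positivity) 1).const_mul
        K).mul_const |σ' - σ|
      simpa using this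
    refine squeeze_zero_norm (fun R => ?_) hlim
    refine intervalIntegral.norm_integral_le_of_norm_le_const fun x hx => ?_
    refine (hbound x (uIoc_subset_uIcc hx) (s * R)).trans ?_
    rcases hs with rfl | rfl <;> simp
  -- Cauchy's theorem on the rectangle with vertical sides Re y = σ, σ' and heights ±R.
  have hrect : ∀ R : ℝ, (((∫ x in σ..σ', f ((x : ℂ) + ((-1 * R : ℝ) : ℂ) * Complex.I)) -
      ∫ x in σ..σ', f ((x : ℂ) + ((1 * R : ℝ) : ℂ) * Complex.I)) +
      Complex.I • ∫ b in (-R)..R, f ((σ' : ℂ) + b * Complex.I)) -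
      Complex.I • ∫ b in (-R)..R, f ((σ : ℂ) + b * Complex.I) = 0 := by
    intro R
    have := Complex.integral_boundary_rect_eq_zero_of_differentiableOn f
      ((σ : ℂ) + ((-R : ℝ) : ℂ) * Complex.I) ((σ' : ℂ) + (R : ℂ) * Complex.I) ?_
    · simpa using this
    · intro y hy
      refine DifferentiableAt.differentiableWithinAt ?_
      have hre : y.re ∈ uIcc σ σ' := by simpa using hy.1
      have := differentiableAt_contourIntegrand (a := a) (t := t) hz (hsub hre) y.im
      rwa [Complex.re_add_im] at this
  have hv := fun {σ : ℝ} (hσ : σ ∈ Ioo 0 (2 * Real.pi)) =>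
    intervalIntegral_tendsto_integral (integrable_contourIntegrand (a := a) ha ht hz hσ)
      Filter.tendsto_neg_atTop_atBot Filter.tendsto_id
  have hlim := (((hhor (-1) (Or.inr rfl)).sub (hhor 1 (Or.inl rfl))).add
    ((hv hσ').const_smul Complex.I)).sub ((hv hσ).const_smul Complex.I)
  have h0 := tendsto_nhds_unique (hlim.congr hrect) tendsto_const_nhds
  simp only [sub_zero, zero_add, smul_eq_mul] at h0
  rw [← mul_sub] at h0
  exact (sub_eq_zero.1 ((mul_eq_zero.1 h0).resolve_left Complex.I_ne_zero)).symm

/-- On this line sin y = -i sinh b and z - cos y = z + cosh b > 0, so the complex power is a real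
one. The factor √t compensates the t^(-1/2) that is built into `lineGaussian`. -/
theorem contourIntegrand_pi {a t z : ℝ} (ht : 0 < t) (hz : 1 ≤ z) (b : ℝ) :
    contourIntegrand a t z ((Real.pi : ℂ) + b * Complex.I) =
      (-Complex.I * (√t : ℂ)) * (lineGaussian t b * (sinhProfile a z b : ℂ)) := by
  have hD : 0 < z + Real.cosh b := by positivity
  have hs : (√t : ℂ) ≠ 0 := by exact_mod_cast (Real.sqrt_pos.2 ht).ne'
  have h1 : Complex.sin ((Real.pi : ℂ) + b * Complex.I) = -(Real.sinh b : ℂ) * Complex.I := by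
    rw [Complex.sin_add_mul_I]; simp
  have h2 : (z : ℂ) - Complex.cos ((Real.pi : ℂ) + b * Complex.I) = ((z + Real.cosh b : ℝ) : ℂ) := by
    rw [Complex.cos_add_mul_I]; simp
  rw [contourIntegrand, h1, h2, ← Complex.ofReal_cpow hD.le, lineGaussian, sinhProfile,
    Real.rpow_neg hD.le]
  have h3 : (((z + Real.cosh b) ^ a : ℝ) : ℂ) ≠ 0 := by
    exact_mod_cast (Real.rpow_pos_of_pos hD a).ne'
  push_cast at h3 ⊢
  field_simp

/-- The normalization of the heat kernel. -/
noncomputable def heatConst (n : ℕ) : ℝ :=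
  Real.Gamma (((n : ℝ) + 1) / 2) /
    (2 ^ (((n : ℝ) + 1) / 2) * Real.pi ^ ((n : ℝ) / 2)) / (2 * Real.pi)

/-! ### The heat kernel in terms of the profile -/

variable {n : ℕ} [NeZero n]

theorem hypHeatIntegrand_eq (t : ℝ) {w w' : EuclideanSpace ℝ (Fin n)} (hw : w ∈ hypSpace n)
    (hw' : w' ∈ hypSpace n) :
    hypHeatIntegrand n t w w' = contourIntegrand (((n : ℝ) + 1) / 2) t (coshDist w w') := by
  ext y
  rw [hypHeatIntegrand, contourIntegrand, cosh_hypDist hw hw']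
  push_cast
  rfl

/-- The i in dy = i db cancels that of 1/(2πi), and 1/(2π) is part of `heatConst`. The abscissa σ'
is free: π serves the differential equation, √t the small times, and 1 the bound for t ≥ 1. -/
theorem hypHeatKernel_eq_contour {σ σ' t : ℝ} (hσ : σ ∈ Ioo 0 (2 * Real.pi))
    (hσ' : σ' ∈ Ioo 0 (2 * Real.pi)) (ht : 0 < t) {w w' : EuclideanSpace ℝ (Fin n)}
    (hw : w ∈ hypSpace n) (hw' : w' ∈ hypSpace n) :
    hypHeatKernel n σ t w w' = ((heatConst n / √t : ℝ) : ℂ) *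
      ∫ b : ℝ, contourIntegrand (((n : ℝ) + 1) / 2) t (coshDist w w') ((σ' : ℂ) + b * Complex.I) := by
  rw [hypHeatKernel, hypHeatIntegrand_eq t hw hw', verticalLineIntegral,
    integral_contourIntegrand_eq (by positivity) ht (one_le_coshDist hw hw') hσ hσ',
    ← Real.sqrt_eq_rpow]
  have h1 : (Real.pi : ℂ) ≠ 0 := by exact_mod_cast Real.pi_ne_zero
  have h2 := Complex.I_ne_zero
  have hs : (√t : ℂ) ≠ 0 := by exact_mod_cast (Real.sqrt_pos.2 ht).ne'
  rw [heatConst]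
  push_cast
  field_simp

theorem hypHeatKernel_eq_heatProfile {σ t : ℝ} (hσ : σ ∈ Ioo 0 (2 * Real.pi)) (ht : 0 < t)
    {w w' : EuclideanSpace ℝ (Fin n)} (hw : w ∈ hypSpace n) (hw' : w' ∈ hypSpace n) :
    hypHeatKernel n σ t w w' = (-Complex.I * (heatConst n : ℂ)) *
      heatProfile (((n : ℝ) + 1) / 2) t (coshDist w w') := by
  rw [hypHeatKernel_eq_contour hσ ⟨Real.pi_pos, by linarith [Real.pi_pos]⟩ ht hw hw', heatProfile]
  simp only [contourIntegrand_pi ht (one_le_coshDist hw hw')]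
  rw [integral_const_mul]
  have hs : (√t : ℂ) ≠ 0 := by exact_mod_cast (Real.sqrt_pos.2 ht).ne'
  push_cast
  field_simp

end

/-! ### The kernel for small time -/

theorem ofReal_mul_cpow {r : ℝ} (hr : 0 < r) {x : ℂ} (hx : x ≠ 0) (a : ℂ) :
    ((r : ℂ) * x) ^ a = (r : ℂ) ^ a * x ^ a := by
  have hr' : (r : ℂ) ≠ 0 := by exact_mod_cast hr.ne'
  rw [Complex.cpow_def_of_ne_zero (mul_ne_zero hr' hx), Complex.cpow_def_of_ne_zero hr',
    Complex.cpow_def_of_ne_zero hx, Complex.log_ofReal_mul hr hx, ← Complex.exp_add,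
    Complex.ofReal_log hr.le, add_mul]

/-- The left side is the integral of sinh over [0, |b|], and sinh is increasing. It lets the
imaginary part sin σ sinh b control a large value of cosh b - 1 in `sub_one_add_sq_le_norm_sub_cos`.
-/
theorem cosh_sub_one_le (b : ℝ) : Real.cosh b - 1 ≤ |b| * |Real.sinh b| := by
  rw [← Real.cosh_abs, Real.abs_sinh, Real.cosh_eq, Real.sinh_eq]
  set c := |b|
  have h1 := Real.add_one_le_exp c
  have h2 := Real.add_one_le_exp (-c)
  have h3 : Real.exp c * Real.exp (-c) = 1 := by rw [← Real.exp_add]; simp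
  have h4 : Real.exp c * (1 - c) ≤ 1 := by nlinarith [Real.exp_pos c]
  have h5 : Real.exp (-c) * (1 + c) ≤ 1 := by nlinarith [Real.exp_pos (-c)]
  nlinarith

theorem abs_sinh_le_mul_exp (b : ℝ) : |Real.sinh b| ≤ |b| * Real.exp |b| := by
  rw [Real.abs_sinh, Real.sinh_eq]
  set c := |b|
  have h2 := Real.add_one_le_exp (-(2 * c))
  have h3 : Real.exp (-c) = Real.exp c * Real.exp (-(2 * c)) := by rw [← Real.exp_add]; ring_nf
  rw [h3]
  nlinarith [Real.exp_pos c]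

/-- The main lower bound for `z - cos y` near `y = 0`. -/
theorem sub_one_add_sq_le_norm_sub_cos {z σ : ℝ} (hz : 1 ≤ z) (h0 : 0 < σ) (h1 : σ ≤ 1) (s : ℝ) :
    z - 1 + σ ^ 2 ≤ 20 * (1 + |s|) *
      ‖(z : ℂ) - Complex.cos ((σ : ℂ) + ((σ * s : ℝ) : ℂ) * Complex.I)‖ := by
  have hre := Complex.re_le_norm ((z : ℂ) - Complex.cos ((σ : ℂ) + ((σ * s : ℝ) : ℂ) * Complex.I))
  have him := Complex.abs_im_le_norm
    ((z : ℂ) - Complex.cos ((σ : ℂ) + ((σ * s : ℝ) : ℂ) * Complex.I))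
  rw [re_sub_cos] at hre
  rw [im_sub_cos] at him
  set N := ‖(z : ℂ) - Complex.cos ((σ : ℂ) + ((σ * s : ℝ) : ℂ) * Complex.I)‖
  have hN : 0 ≤ N := norm_nonneg _
  set b := σ * s with hb
  have hpi := Real.pi_gt_three
  have hcos : Real.cos σ ≤ 1 - σ ^ 2 / 5 := by
    have h2 := Real.cos_le_one_sub_mul_cos_sq (x := σ) (by rw [abs_of_pos h0]; linarith)
    have h3 : (1 : ℝ) / 5 ≤ 2 / Real.pi ^ 2 := by
      rw [div_le_div_iff₀ (by norm_num) (by positivity)]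
      nlinarith [Real.pi_lt_d2]
    nlinarith [sq_nonneg σ]
  have hcos0 : 0 ≤ Real.cos σ := (Real.cos_pos_of_mem_Ioo ⟨by linarith, by linarith⟩).le
  have hsin : σ / 2 ≤ Real.sin σ := by
    have := Real.sin_gt_sub_cube h0
    nlinarith [sq_nonneg σ]
  have hC := Real.one_le_cosh b
  have hs := abs_nonneg s
  -- If cosh b - 1 is small, the real part z - cos σ cosh b still controls z - 1 + σ². Otherwise
  -- cosh b - 1 ≤ σ|s||sinh b| controls it, and this is bounded by the imaginary part because sin σ
  -- ≥ σ/2; here the factor |s| is lost.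
  rcases le_total (Real.cosh b - 1) ((z - 1) / 2 + σ ^ 2 / 10) with h | h
  · have h3 : Real.cos σ * (Real.cosh b - 1) ≤ Real.cosh b - 1 :=
      mul_le_of_le_one_left (by linarith) (Real.cos_le_one σ)
    have h4 : z - 1 + σ ^ 2 ≤ 10 * N := by nlinarith
    nlinarith [mul_nonneg hs hN]
  · have h3 : z - 1 + σ ^ 2 ≤ 10 * (|b| * |Real.sinh b|) := by
      linarith [cosh_sub_one_le b]
    have h4 : σ * |Real.sinh b| ≤ 2 * N := by
      rw [abs_mul, abs_of_pos (by linarith : 0 < Real.sin σ)] at him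
      nlinarith [mul_le_mul_of_nonneg_right hsin (abs_nonneg (Real.sinh b))]
    have h5 : |b| = σ * |s| := by rw [hb, abs_mul, abs_of_pos h0]
    rw [h5] at h3
    nlinarith [mul_le_mul_of_nonneg_left h4 hs]

/-- The factor σ matters: divided by σ = √t, the sine stays bounded as t → 0. -/
theorem norm_sin_le {σ : ℝ} (h0 : 0 < σ) (h1 : σ ≤ 1) (s : ℝ) :
    ‖Complex.sin ((σ : ℂ) + ((σ * s : ℝ) : ℂ) * Complex.I)‖ ≤ σ * Real.exp (2 * |s|) := by
  set b := σ * s with hb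
  have hbs : |b| ≤ |s| := by
    rw [hb, abs_mul, abs_of_pos h0]; exact mul_le_of_le_one_left (abs_nonneg s) h1
  have e : Complex.sin ((σ : ℂ) + (b : ℂ) * Complex.I) = ((Real.sin σ * Real.cosh b : ℝ) : ℂ) +
      ((Real.cos σ * Real.sinh b : ℝ) : ℂ) * Complex.I := by
    rw [Complex.sin_add_mul_I]; push_cast; ring
  rw [e]
  refine (norm_add_le _ _).trans ?_
  rw [norm_mul, Complex.norm_I, mul_one, Complex.norm_real, Complex.norm_real, Real.norm_eq_abs,
    Real.norm_eq_abs, abs_mul, abs_mul, abs_of_pos (Real.cosh_pos b)]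
  have h2 : |Real.sin σ| ≤ σ := by simpa [abs_of_pos h0] using Real.abs_sin_le_abs (x := σ)
  have h3 := Real.abs_cos_le_one σ
  have h4 := cosh_le_exp_abs b
  have h5 := abs_sinh_le_mul_exp b
  have h6 : |b| = σ * |s| := by rw [hb, abs_mul, abs_of_pos h0]
  have h7 : Real.exp |b| ≤ Real.exp |s| := Real.exp_le_exp.2 hbs
  have h8 := Real.add_one_le_exp |s|
  calc _ ≤ σ * Real.exp |s| + 1 * (σ * |s| * Real.exp |s|) := by
        gcongr
        · exact h4.trans h7
        · refine h5.trans ?_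
          rw [h6] at h7 ⊢
          gcongr
    _ = σ * ((|s| + 1) * Real.exp |s|) := by ring
    _ ≤ σ * (Real.exp |s| * Real.exp |s|) := by gcongr
    _ = _ := by rw [← Real.exp_add]; ring_nf

/-- The integrand of the rescaled heat kernel on the line `y = √t (1 + i s)`. -/
noncomputable def scaledIntegrand (a t z s : ℝ) : ℂ :=
  Complex.exp ((1 + s * Complex.I) ^ 2 / 4) *
    (Complex.sin ((√t : ℂ) + ((√t * s : ℝ) : ℂ) * Complex.I) / √t) /
    (((z : ℂ) - Complex.cos ((√t : ℂ) + ((√t * s : ℝ) : ℂ) * Complex.I)) / t) ^ (a : ℂ)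

theorem sqrt_mem_Ioo {t : ℝ} (ht : 0 < t) (ht1 : t ≤ 1) : √t ∈ Ioo 0 (2 * Real.pi) :=
  ⟨Real.sqrt_pos.2 ht, by
    have : √t ≤ 1 := Real.sqrt_le_one.2 ht1
    linarith [Real.pi_gt_three]⟩

/-- After y = √t(1 + is) the exponential no longer contains t. A positive factor t leaves the
principal power as t^a, and the sine contributes √t. -/
theorem contourIntegrand_sqrt {a t z : ℝ} (ht : 0 < t) (ht1 : t ≤ 1) (hz : 1 ≤ z) (s : ℝ) :
    contourIntegrand a t z ((√t : ℂ) + ((√t * s : ℝ) : ℂ) * Complex.I) =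
      ((√t / t ^ a : ℝ) : ℂ) * scaledIntegrand a t z s := by
  have hs0 : 0 < √t := Real.sqrt_pos.2 ht
  have hs : (√t : ℂ) ≠ 0 := by exact_mod_cast hs0.ne'
  have htc : (t : ℂ) ≠ 0 := by exact_mod_cast ht.ne'
  have hsq : (√t : ℂ) ^ 2 = t := by exact_mod_cast Real.sq_sqrt ht.le
  have hD := Complex.slitPlane_ne_zero
    (sub_cos_mem_slitPlane hz (sqrt_mem_Ioo ht ht1) (√t * s))
  rw [contourIntegrand, scaledIntegrand]
  set y : ℂ := (√t : ℂ) + ((√t * s : ℝ) : ℂ) * Complex.I with hy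
  have e1 : y ^ 2 / (4 * (t : ℂ)) = (1 + s * Complex.I) ^ 2 / 4 := by
    rw [hy, ← hsq]; push_cast; field_simp
  have e2 : (z : ℂ) - Complex.cos y = (t : ℂ) * (((z : ℂ) - Complex.cos y) / t) := by field_simp
  rw [e1]
  nth_rewrite 1 [e2]
  rw [ofReal_mul_cpow ht (div_ne_zero hD htc), ← Complex.ofReal_cpow ht.le]
  have h3 : ((t ^ a : ℝ) : ℂ) ≠ 0 := by exact_mod_cast (Real.rpow_pos_of_pos ht a).ne'
  have h4 : (((z : ℂ) - Complex.cos y) / t) ^ (a : ℂ) ≠ 0 := by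
    rw [Complex.cpow_ne_zero_iff]; exact Or.inl (div_ne_zero hD htc)
  push_cast at h3 ⊢
  field_simp

theorem integral_contourIntegrand_sqrt {a t z : ℝ} (ht : 0 < t) (ht1 : t ≤ 1) (hz : 1 ≤ z) :
    ∫ b : ℝ, contourIntegrand a t z ((√t : ℂ) + b * Complex.I) =
      ((t / t ^ a : ℝ) : ℂ) * ∫ s : ℝ, scaledIntegrand a t z s := by
  have hs0 : 0 < √t := Real.sqrt_pos.2 ht
  have h := Measure.integral_comp_mul_left
    (fun b : ℝ => contourIntegrand a t z ((√t : ℂ) + b * Complex.I)) (√t)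
  simp only [contourIntegrand_sqrt ht ht1 hz] at h
  rw [integral_const_mul, abs_of_pos (inv_pos.2 hs0), Complex.real_smul] at h
  have hs : (√t : ℂ) ≠ 0 := by exact_mod_cast hs0.ne'
  have hsq : (√t : ℂ) * √t = t := by exact_mod_cast Real.mul_self_sqrt ht.le
  calc _ = (√t : ℂ) * (((√t)⁻¹ : ℝ) * ∫ b : ℝ, contourIntegrand a t z ((√t : ℂ) + b * Complex.I)) := by
        push_cast; rw [mul_inv_cancel_left₀ hs]
    _ = _ := by rw [← h]; push_cast; rw [← hsq]; ring

/-- The decay in (z - 1)/t is the point. After w' = w + √t u with w' in a compact set and w of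
bounded height, this quotient is at least a multiple of |u|², and for a = (n + 1)/2 the resulting
power of 1 + |u|² is integrable on ℝⁿ. -/
theorem norm_scaledIntegrand_le {a t z : ℝ} (ha : 0 ≤ a) (ht : 0 < t) (ht1 : t ≤ 1) (hz : 1 ≤ z)
    (s : ℝ) : ‖scaledIntegrand a t z s‖ ≤ (Real.exp (1 / 4) * 20 ^ a) *
      ((z - 1) / t + 1) ^ (-a) * (Real.exp ((2 + a) * |s|) * Real.exp (-(1 / 4) * s ^ 2)) := by
  have hs0 : 0 < √t := Real.sqrt_pos.2 ht
  have hs1 : √t ≤ 1 := Real.sqrt_le_one.2 ht1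
  have h1 := sub_one_add_sq_le_norm_sub_cos hz hs0 hs1 s
  have h2 := norm_sin_le hs0 hs1 s
  rw [Real.sq_sqrt ht.le] at h1
  rw [scaledIntegrand, norm_div, norm_mul, Complex.norm_cpow_real, norm_div, norm_div,
    Complex.norm_real, Complex.norm_real, Real.norm_of_nonneg hs0.le, Real.norm_of_nonneg ht.le]
  have h3 : ‖Complex.exp ((1 + s * Complex.I) ^ 2 / 4)‖ =
      Real.exp (1 / 4) * Real.exp (-(1 / 4) * s ^ 2) := by
    have := norm_exp_sq_div 1 s 1
    simpa using this
  rw [h3]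
  set N := ‖(z : ℂ) - Complex.cos ((√t : ℂ) + ((√t * s : ℝ) : ℂ) * Complex.I)‖
  have hq : 0 < (z - 1) / t + 1 := by have : 0 ≤ (z - 1) / t := div_nonneg (by linarith) ht.le; linarith
  have h4 : ((z - 1) / t + 1) / (20 * (1 + |s|)) ≤ N / t := by
    rw [div_le_iff₀ (by positivity), div_mul_eq_mul_div, le_div_iff₀ ht]
    have : ((z - 1) / t + 1) * t = z - 1 + t := by field_simp
    rw [this]; linarith
  have h5 : (1 + |s|) ^ a ≤ Real.exp (a * |s|) := by
    rw [mul_comm a, Real.exp_mul]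
    exact Real.rpow_le_rpow (by positivity) (by linarith [Real.add_one_le_exp |s|]) ha
  calc _ ≤ Real.exp (1 / 4) * Real.exp (-(1 / 4) * s ^ 2) * (√t * Real.exp (2 * |s|) / √t) /
        (((z - 1) / t + 1) / (20 * (1 + |s|))) ^ a := by gcongr
    _ = Real.exp (1 / 4) * Real.exp (-(1 / 4) * s ^ 2) * Real.exp (2 * |s|) *
        (((z - 1) / t + 1) ^ (-a) * (20 ^ a * (1 + |s|) ^ a)) := by
        rw [Real.div_rpow hq.le (by positivity), Real.mul_rpow (by norm_num) (by positivity),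
          Real.rpow_neg hq.le]
        have := (Real.rpow_pos_of_pos hq a).ne'
        field_simp
    _ ≤ Real.exp (1 / 4) * Real.exp (-(1 / 4) * s ^ 2) * Real.exp (2 * |s|) *
        (((z - 1) / t + 1) ^ (-a) * (20 ^ a * Real.exp (a * |s|))) := by gcongr
    _ = _ := by rw [add_mul, Real.exp_add]; ring

theorem continuous_scaledIntegrand {a t z : ℝ} (ht : 0 < t) (ht1 : t ≤ 1) (hz : 1 ≤ z) :
    Continuous (scaledIntegrand a t z) := by
  have h1 : ∀ s, scaledIntegrand a t z s = ((√t / t ^ a : ℝ) : ℂ)⁻¹ *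
      contourIntegrand a t z ((√t : ℂ) + ((√t * s : ℝ) : ℂ) * Complex.I) := fun s => by
    rw [contourIntegrand_sqrt ht ht1 hz, inv_mul_cancel_left₀]
    exact_mod_cast (div_pos (Real.sqrt_pos.2 ht) (Real.rpow_pos_of_pos ht a)).ne'
  rw [show scaledIntegrand a t z = _ from funext h1]
  exact continuous_const.mul ((continuous_contourIntegrand (a := a) (t := t) hz
    (sqrt_mem_Ioo ht ht1)).comp (continuous_const.mul continuous_id))

theorem norm_integral_scaledIntegrand_le {a : ℝ} (ha : 0 ≤ a) : ∃ C : ℝ, 0 ≤ C ∧ ∀ t z : ℝ, 0 < t →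
    t ≤ 1 → 1 ≤ z → ‖∫ s : ℝ, scaledIntegrand a t z s‖ ≤ C * ((z - 1) / t + 1) ^ (-a) := by
  refine ⟨(Real.exp (1 / 4) * 20 ^ a) * ∫ s : ℝ, (Real.exp ((2 + a) * |s|) *
    Real.exp (-(1 / 4) * s ^ 2)), by positivity, fun t z ht ht1 hz => ?_⟩
  refine (norm_integral_le_of_norm_le ((integrable_exp_mul_abs_mul_exp_neg (by norm_num)
    (2 + a)).const_mul _) (Filter.Eventually.of_forall fun s =>
    norm_scaledIntegrand_le ha ht ht1 hz s)).trans (le_of_eq ?_)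
  rw [integral_const_mul]; ring

theorem tendsto_sin_mul_div (η : ℂ) :
    Filter.Tendsto (fun x : ℝ => Complex.sin ((x : ℂ) * η) / x) (nhdsWithin 0 {0}ᶜ) (nhds η) := by
  have h1 : HasDerivAt (fun x : ℝ => Complex.sin ((x : ℂ) * η)) η 0 := by
    have h0 : HasDerivAt (fun x : ℝ => (x : ℂ) * η) η 0 := by
      simpa using (Complex.ofRealCLM.hasDerivAt (x := (0 : ℝ))).mul_const η
    have h2 : HasDerivAt (fun x : ℝ => Complex.sin ((x : ℂ) * η))
        (Complex.cos (((0 : ℝ) : ℂ) * η) * η) 0 := (Complex.hasDerivAt_sin _).comp (0 : ℝ) h0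
    simpa using h2
  refine (hasDerivAt_iff_tendsto_slope.1 h1).congr fun x => ?_
  simp [slope_def_module, div_eq_inv_mul]

theorem tendsto_sqrt_nhdsWithin {α : Type*} {l : Filter α} {T : α → ℝ}
    (hT : Filter.Tendsto T l (nhdsWithin 0 (Ioi 0))) :
    Filter.Tendsto (fun x => √(T x)) l (nhdsWithin 0 {0}ᶜ) := by
  refine tendsto_nhdsWithin_iff.2 ⟨?_, ?_⟩
  · have := (Real.continuous_sqrt.tendsto 0).comp (tendsto_nhds_of_tendsto_nhdsWithin hT)
    simpa [Function.comp_def] using this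
  · filter_upwards [(tendsto_nhdsWithin_iff.1 hT).2] with x hx
    exact (Real.sqrt_pos.2 hx).ne'

theorem add_sq_mem_slitPlane {r : ℝ} (hr : 0 ≤ r) (s : ℝ) :
    (r : ℂ) + (1 + s * Complex.I) ^ 2 / 2 ∈ Complex.slitPlane := by
  have e : (r : ℂ) + (1 + s * Complex.I) ^ 2 / 2 =
      ((r + (1 - s ^ 2) / 2 : ℝ) : ℂ) + (s : ℂ) * Complex.I := by
    push_cast; linear_combination (s : ℂ) ^ 2 / 2 * Complex.I_sq
  rw [Complex.mem_slitPlane_iff, e]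
  simp only [Complex.add_re, Complex.add_im, Complex.re_ofReal_mul, Complex.im_ofReal_mul,
    Complex.ofReal_re, Complex.ofReal_im, Complex.I_re, Complex.I_im]
  by_cases hs : s = 0
  · left; subst hs; norm_num; linarith
  · right; simpa using hs

/-- The rescaled integrand of the Euclidean heat kernel. -/
noncomputable def euclideanIntegrand (a r s : ℝ) : ℂ :=
  Complex.exp ((1 + s * Complex.I) ^ 2 / 4) * (1 + s * Complex.I) *
    ((r : ℂ) + (1 + s * Complex.I) ^ 2 / 2) ^ (-(a : ℂ))

/-- With η = 1 + is, the identity 1 - cos y = 2 sin²(y/2) gives (z - cos y)/t = (z - 1)/t + 2(sin(√t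
η/2)/√t)², which tends to r + η²/2. Time and z run along an arbitrary filter because t and both
points of the half space vary together in the application. -/
theorem tendsto_scaledIntegrand {α : Type*} {l : Filter α} {T Z : α → ℝ} {a r : ℝ} (hr : 0 ≤ r)
    (hT : Filter.Tendsto T l (nhdsWithin 0 (Ioi 0)))
    (hZ : Filter.Tendsto (fun x => (Z x - 1) / T x) l (nhds r)) (s : ℝ) :
    Filter.Tendsto (fun x => scaledIntegrand a (T x) (Z x) s) l (nhds (euclideanIntegrand a r s)) := by
  set η : ℂ := 1 + s * Complex.I with hη
  have hsq := tendsto_sqrt_nhdsWithin hT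
  have h1 := (tendsto_sin_mul_div η).comp hsq
  have h2 := (((tendsto_sin_mul_div (η / 2)).comp hsq).pow 2).const_mul 2
  have h3 := (((Complex.continuous_ofReal.tendsto r).comp hZ).add h2)
  have e4 : (r : ℂ) + 2 * (η / 2) ^ 2 = r + η ^ 2 / 2 := by ring
  rw [e4] at h3
  have h4 := h3.cpow (tendsto_const_nhds (x := (a : ℂ))) (add_sq_mem_slitPlane hr s)
  have hne : ((r : ℂ) + η ^ 2 / 2) ^ (a : ℂ) ≠ 0 := by
    rw [Complex.cpow_ne_zero_iff]
    exact Or.inl (Complex.slitPlane_ne_zero (add_sq_mem_slitPlane hr s))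
  have h5 := (h1.const_mul (Complex.exp (η ^ 2 / 4))).div h4 hne
  have e5 : Complex.exp (η ^ 2 / 4) * η / ((r : ℂ) + η ^ 2 / 2) ^ (a : ℂ) =
      euclideanIntegrand a r s := by
    rw [euclideanIntegrand, ← hη, Complex.cpow_neg, div_eq_mul_inv]
  rw [e5] at h5
  refine h5.congr' ?_
  filter_upwards [(tendsto_nhdsWithin_iff.1 hT).2] with x hx
  replace hx : 0 < T x := hx
  have htc : (T x : ℂ) ≠ 0 := by exact_mod_cast hx.ne'
  have hsqx : (√(T x) : ℂ) ^ 2 = T x := by exact_mod_cast Real.sq_sqrt hx.le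
  have ey : (√(T x) : ℂ) + ((√(T x) * s : ℝ) : ℂ) * Complex.I = (√(T x) : ℂ) * η := by
    rw [hη]; push_cast; ring
  have e6 : Complex.cos ((√(T x) : ℂ) * η) = 1 - 2 * Complex.sin ((√(T x) : ℂ) * (η / 2)) ^ 2 := by
    rw [show (√(T x) : ℂ) * η = 2 * ((√(T x) : ℂ) * (η / 2)) by ring, Complex.cos_two_mul,
      Complex.cos_sq']
    ring
  rw [scaledIntegrand, ey, e6]
  simp only [Pi.div_apply, Function.comp_apply, ← hη]
  congr 2
  push_cast
  rw [div_pow, hsqx]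
  field_simp
  ring

theorem tendsto_integral_scaledIntegrand {α : Type*} {l : Filter α} [l.IsCountablyGenerated]
    {T Z : α → ℝ} {a r : ℝ} (ha : 0 ≤ a) (hr : 0 ≤ r)
    (hT : Filter.Tendsto T l (nhdsWithin 0 (Ioi 0))) (hZ1 : ∀ᶠ x in l, 1 ≤ Z x)
    (hZ : Filter.Tendsto (fun x => (Z x - 1) / T x) l (nhds r)) :
    Filter.Tendsto (fun x => ∫ s : ℝ, scaledIntegrand a (T x) (Z x) s) l
      (nhds (∫ s : ℝ, euclideanIntegrand a r s)) := by
  have hT0 := (tendsto_nhdsWithin_iff.1 hT).2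
  have hT1 : ∀ᶠ x in l, T x ≤ 1 := (tendsto_nhds_of_tendsto_nhdsWithin hT).eventually_le_const
    zero_lt_one
  refine tendsto_integral_filter_of_dominated_convergence (fun s => (Real.exp (1 / 4) * 20 ^ a) *
      (Real.exp ((2 + a) * |s|) * Real.exp (-(1 / 4) * s ^ 2))) ?_ ?_
    ((integrable_exp_mul_abs_mul_exp_neg (by norm_num) (2 + a)).const_mul _)
    (Filter.Eventually.of_forall fun s => tendsto_scaledIntegrand hr hT hZ s)
  · filter_upwards [hT0, hT1, hZ1] with x h0 h1 h2
    exact (continuous_scaledIntegrand h0 h1 h2).aestronglyMeasurable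
  · filter_upwards [hT0, hT1, hZ1] with x h0 h1 h2
    refine Filter.Eventually.of_forall fun s => (norm_scaledIntegrand_le ha h0 h1 h2 s).trans ?_
    have hq : 1 ≤ (Z x - 1) / T x + 1 := by
      have : 0 ≤ (Z x - 1) / T x := div_nonneg (by linarith) (le_of_lt h0)
      linarith
    have h3 : ((Z x - 1) / T x + 1) ^ (-a) ≤ 1 :=
      Real.rpow_le_one_of_one_le_of_nonpos hq (by linarith)
    have h4 : 0 ≤ Real.exp (1 / 4) * 20 ^ a := by positivity
    have : (Real.exp (1 / 4) * 20 ^ a) * ((Z x - 1) / T x + 1) ^ (-a) ≤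
      Real.exp (1 / 4) * 20 ^ a := mul_le_of_le_one_right h4 h3
    gcongr

/-! ### The Euclidean heat kernel as a contour integral -/

theorem one_add_mul_I_ne_zero (s : ℝ) : (1 : ℂ) + s * Complex.I ≠ 0 := by
  intro h
  have := congrArg Complex.re h
  simp at this

theorem norm_exp_one_add_sq (s : ℝ) : ‖Complex.exp ((1 + s * Complex.I) ^ 2 / 4)‖ =
    Real.exp (1 / 4) * Real.exp (-(1 / 4) * s ^ 2) := by
  simpa using norm_exp_sq_div 1 s 1

theorem norm_one_add_mul_I_le (s : ℝ) : ‖(1 : ℂ) + s * Complex.I‖ ≤ Real.exp |s| := by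
  refine (norm_add_le _ _).trans ?_
  simp only [norm_one, norm_mul, Complex.norm_I, Complex.norm_real, Real.norm_eq_abs, mul_one]
  linarith [Real.add_one_le_exp |s|]

theorem le_norm_add_sq {r : ℝ} (hr : 0 ≤ r) (s : ℝ) :
    1 / 2 ≤ ‖(r : ℂ) + (1 + s * Complex.I) ^ 2 / 2‖ := by
  have e : (r : ℂ) + (1 + s * Complex.I) ^ 2 / 2 =
      ((r + (1 - s ^ 2) / 2 : ℝ) : ℂ) + (s : ℂ) * Complex.I := by
    push_cast; linear_combination (s : ℂ) ^ 2 / 2 * Complex.I_sq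
  refine le_of_sq_le_sq ?_ (norm_nonneg _)
  rw [← Complex.normSq_eq_norm_sq, Complex.normSq_apply, e]
  simp only [Complex.add_re, Complex.add_im, Complex.re_ofReal_mul, Complex.im_ofReal_mul,
    Complex.ofReal_re, Complex.ofReal_im, Complex.I_re, Complex.I_im]
  rcases le_total (s ^ 2) (1 / 4) with h | h
  · nlinarith
  · nlinarith [sq_nonneg (r + (1 - s ^ 2) / 2)]

theorem norm_add_sq_cpow_le {a r : ℝ} (ha : 0 ≤ a) (hr : 0 ≤ r) (s : ℝ) :
    ‖((r : ℂ) + (1 + s * Complex.I) ^ 2 / 2) ^ (-(a : ℂ))‖ ≤ 2 ^ a := by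
  rw [← Complex.ofReal_neg, Complex.norm_cpow_real]
  have h := le_norm_add_sq hr s
  calc _ ≤ (1 / 2 : ℝ) ^ (-a) := Real.rpow_le_rpow_of_nonpos (by norm_num) h (by linarith)
    _ = _ := by rw [Real.rpow_neg (by norm_num), one_div, Real.inv_rpow (by norm_num), inv_inv]

theorem continuous_add_sq_cpow {r : ℝ} (hr : 0 ≤ r) (c : ℂ) :
    Continuous fun s : ℝ => ((r : ℂ) + (1 + s * Complex.I) ^ 2 / 2) ^ c :=
  Continuous.cpow (by fun_prop) continuous_const fun s => add_sq_mem_slitPlane hr s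

theorem continuous_euclideanIntegrand {a r : ℝ} (hr : 0 ≤ r) :
    Continuous (euclideanIntegrand a r) := by
  unfold euclideanIntegrand
  exact Continuous.mul (by fun_prop) (continuous_add_sq_cpow hr _)

theorem norm_euclideanIntegrand_le {a r : ℝ} (ha : 0 ≤ a) (hr : 0 ≤ r) (s : ℝ) :
    ‖euclideanIntegrand a r s‖ ≤ (Real.exp (1 / 4) * 2 ^ a) *
      (Real.exp (1 * |s|) * Real.exp (-(1 / 4) * s ^ 2)) := by
  rw [euclideanIntegrand, norm_mul, norm_mul, norm_exp_one_add_sq, one_mul]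
  calc _ ≤ Real.exp (1 / 4) * Real.exp (-(1 / 4) * s ^ 2) * Real.exp |s| * 2 ^ a := by
        gcongr
        · exact norm_one_add_mul_I_le s
        · exact norm_add_sq_cpow_le ha hr s
    _ = _ := by ring

theorem integrable_euclideanIntegrand {a r : ℝ} (ha : 0 ≤ a) (hr : 0 ≤ r) :
    Integrable (euclideanIntegrand a r) :=
  Integrable.mono' ((integrable_exp_mul_abs_mul_exp_neg (by norm_num) 1).const_mul _)
    (continuous_euclideanIntegrand hr).aestronglyMeasurable
    (Filter.Eventually.of_forall fun s => norm_euclideanIntegrand_le ha hr s)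

theorem hasDerivAt_exp_one_add_sq (s : ℝ) :
    HasDerivAt (fun s : ℝ => Complex.exp ((1 + s * Complex.I) ^ 2 / 4))
      (Complex.exp ((1 + s * Complex.I) ^ 2 / 4) * (1 + s * Complex.I) * (Complex.I / 2)) s := by
  have h1 : HasDerivAt (fun s : ℝ => (1 : ℂ) + s * Complex.I) Complex.I s := by
    simpa using ((Complex.ofRealCLM.hasDerivAt (x := s)).mul_const Complex.I).const_add (1 : ℂ)
  refine (((h1.pow 2).div_const 4).cexp).congr_deriv ?_
  simp only [Pi.pow_apply]
  push_cast
  ring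

theorem hasDerivAt_add_sq_cpow {r : ℝ} (hr : 0 ≤ r) (a s : ℝ) :
    HasDerivAt (fun s : ℝ => ((r : ℂ) + (1 + s * Complex.I) ^ 2 / 2) ^ (-(a : ℂ)))
      (-(a : ℂ) * ((r : ℂ) + (1 + s * Complex.I) ^ 2 / 2) ^ (-((a + 1 : ℝ) : ℂ)) *
        ((1 + s * Complex.I) * Complex.I)) s := by
  have h1 : HasDerivAt (fun s : ℝ => (1 : ℂ) + s * Complex.I) Complex.I s := by
    simpa using ((Complex.ofRealCLM.hasDerivAt (x := s)).mul_const Complex.I).const_add (1 : ℂ)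
  have h2 := ((h1.pow 2).div_const 2).const_add (r : ℂ)
  have h3 := ((hasDerivAt_id _).cpow_const (c := -(a : ℂ))
    (add_sq_mem_slitPlane hr s)).scomp s h2
  refine h3.congr_deriv ?_
  rw [show -(a : ℂ) - 1 = -((a + 1 : ℝ) : ℂ) by push_cast; ring, smul_eq_mul]
  simp only [id]
  push_cast
  ring

/-- Integration by parts lowers the exponent. -/
theorem integral_euclideanIntegrand_succ {a r : ℝ} (ha : 0 ≤ a) (hr : 0 ≤ r) :
    ∫ s, euclideanIntegrand a r s = 2 * a * ∫ s, euclideanIntegrand (a + 1) r s := by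
  have h := integral_mul_deriv_eq_deriv_mul_of_integrable (u := fun s : ℝ =>
    ((r : ℂ) + (1 + s * Complex.I) ^ 2 / 2) ^ (-(a : ℂ)))
    (v := fun s : ℝ => Complex.exp ((1 + s * Complex.I) ^ 2 / 4))
    (fun s _ => hasDerivAt_add_sq_cpow hr a s) (fun s _ => hasDerivAt_exp_one_add_sq s)
    (((integrable_euclideanIntegrand ha hr).const_mul (Complex.I / 2)).congr
      (Filter.Eventually.of_forall fun s => by
        simp only [euclideanIntegrand, Pi.mul_apply]; ring))
    (((integrable_euclideanIntegrand (by linarith : 0 ≤ a + 1) hr).const_mul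
      (-(a : ℂ) * Complex.I)).congr (Filter.Eventually.of_forall fun s => by
        simp only [euclideanIntegrand, Pi.mul_apply]; ring))
    (by
      refine Integrable.mono' ((integrable_exp_mul_abs_mul_exp_neg (c := 1 / 4) (by norm_num)
        0).const_mul (Real.exp (1 / 4) * 2 ^ a)) ?_ (Filter.Eventually.of_forall fun s => ?_)
      · exact ((continuous_add_sq_cpow hr _).mul (by fun_prop)).aestronglyMeasurable
      · rw [Pi.mul_apply, norm_mul, norm_exp_one_add_sq, zero_mul, Real.exp_zero, one_mul, mul_comm]
        calc _ ≤ Real.exp (1 / 4) * Real.exp (-(1 / 4) * s ^ 2) * 2 ^ a := by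
              gcongr; exact norm_add_sq_cpow_le ha hr s
          _ = _ := by ring)
  have e1 : ∀ s : ℝ, ((r : ℂ) + (1 + s * Complex.I) ^ 2 / 2) ^ (-(a : ℂ)) *
      (Complex.exp ((1 + s * Complex.I) ^ 2 / 4) * (1 + s * Complex.I) * (Complex.I / 2)) =
      Complex.I / 2 * euclideanIntegrand a r s := fun s => by rw [euclideanIntegrand]; ring
  have e2 : ∀ s : ℝ, -(a : ℂ) * ((r : ℂ) + (1 + s * Complex.I) ^ 2 / 2) ^ (-((a + 1 : ℝ) : ℂ)) *
        ((1 + s * Complex.I) * Complex.I) * Complex.exp ((1 + s * Complex.I) ^ 2 / 4) =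
      -(a : ℂ) * Complex.I * euclideanIntegrand (a + 1) r s :=
    fun s => by rw [euclideanIntegrand]; ring
  simp only [e1, e2, integral_const_mul] at h
  have : Complex.I / 2 * (∫ s, euclideanIntegrand a r s) =
      Complex.I / 2 * (2 * a * ∫ s, euclideanIntegrand (a + 1) r s) := by rw [h]; ring
  exact mul_left_cancel₀ (by simp) this

/-- Writing F_a(r) for the integral, differentiation gives F_a' = -a F_{a+1}, and the recursion F_a
= 2a F_{a+1} of `integral_euclideanIntegrand_succ` closes this into the equation F_a' = -F_a/2. -/
theorem hasDerivAt_integral_euclideanIntegrand {a r : ℝ} (ha : 0 ≤ a) (hr : 0 < r) :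
    HasDerivAt (fun r => ∫ s, euclideanIntegrand a r s)
      (-(1 / 2) * ∫ s, euclideanIntegrand a r s) r := by
  have key := hasDerivAt_integral_of_dominated_loc_of_deriv_le (μ := volume) (x₀ := r)
    (F := fun r s => euclideanIntegrand a r s)
    (F' := fun r s => -(a : ℂ) * euclideanIntegrand (a + 1) r s)
    (bound := fun s => a * ((Real.exp (1 / 4) * 2 ^ (a + 1)) *
      (Real.exp (1 * |s|) * Real.exp (-(1 / 4) * s ^ 2))))
    (Ioi_mem_nhds hr)
    (by
      filter_upwards [Ioi_mem_nhds hr] with x hx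
      exact (continuous_euclideanIntegrand (le_of_lt hx)).aestronglyMeasurable)
    (integrable_euclideanIntegrand ha hr.le)
    ((continuous_euclideanIntegrand hr.le).const_mul _).aestronglyMeasurable
    (Filter.Eventually.of_forall fun s x hx => by
      rw [norm_mul, norm_neg, Complex.norm_real, Real.norm_of_nonneg ha]
      gcongr
      exact norm_euclideanIntegrand_le (by linarith) (le_of_lt hx) s)
    (((integrable_exp_mul_abs_mul_exp_neg (by norm_num) 1).const_mul _).const_mul _)
    (Filter.Eventually.of_forall fun s x hx => by
      have h2 : HasDerivAt (fun x : ℝ => (x : ℂ) + (1 + s * Complex.I) ^ 2 / 2) 1 x := by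
        simpa using (Complex.ofRealCLM.hasDerivAt (x := x)).add_const
          (((1 : ℂ) + s * Complex.I) ^ 2 / 2)
      have h3 := ((hasDerivAt_id _).cpow_const (c := -(a : ℂ))
        (add_sq_mem_slitPlane (le_of_lt hx) s)).scomp x h2
      refine (h3.const_mul (Complex.exp ((1 + s * Complex.I) ^ 2 / 4) *
        (1 + s * Complex.I))).congr_deriv ?_
      rw [euclideanIntegrand, show -(a : ℂ) - 1 = -((a + 1 : ℝ) : ℂ) by push_cast; ring]
      simp only [one_smul, id]
      ring)
  refine key.2.congr_deriv ?_
  rw [integral_const_mul, integral_euclideanIntegrand_succ ha hr.le]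
  ring

theorem continuousOn_integral_euclideanIntegrand {a : ℝ} (ha : 0 ≤ a) :
    ContinuousOn (fun r => ∫ s, euclideanIntegrand a r s) (Ici 0) := by
  refine continuousOn_of_dominated (fun r hr =>
    (continuous_euclideanIntegrand hr).aestronglyMeasurable)
    (fun r hr => Filter.Eventually.of_forall fun s => norm_euclideanIntegrand_le ha hr s)
    ((integrable_exp_mul_abs_mul_exp_neg (by norm_num) 1).const_mul _)
    (Filter.Eventually.of_forall fun s => ?_)
  unfold euclideanIntegrand
  exact continuousOn_const.mul (ContinuousOn.cpow (by fun_prop) continuousOn_const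
    fun r hr => add_sq_mem_slitPlane hr s)

/-- By the differential equation exp(r/2) times the integral is constant. The derivative is known
only for r > 0, so continuity up to r = 0 is used to reach the end point. -/
theorem integral_euclideanIntegrand_eq {a r : ℝ} (ha : 0 ≤ a) (hr : 0 ≤ r) :
    ∫ s, euclideanIntegrand a r s =
      Complex.exp (-(r / 2 : ℝ)) * ∫ s, euclideanIntegrand a 0 s := by
  rcases hr.eq_or_lt with rfl | hr0
  · simp
  set f : ℝ → ℂ := fun x => Complex.exp ((x / 2 : ℝ) : ℂ) * ∫ s, euclideanIntegrand a x s with hf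
  have hcont : ContinuousOn f (Icc 0 r) :=
    ContinuousOn.mul (by fun_prop) ((continuousOn_integral_euclideanIntegrand ha).mono
      Icc_subset_Ici_self)
  have hder : ∀ x ∈ Ioo 0 r, HasDerivAt f 0 x := fun x hx => by
    have h1 : HasDerivAt (fun x : ℝ => Complex.exp ((x / 2 : ℝ) : ℂ))
        (Complex.exp ((x / 2 : ℝ) : ℂ) * ((1 / 2 : ℝ) : ℂ)) x :=
      ((hasDerivAt_id x).div_const 2).ofReal_comp.cexp
    refine (h1.mul (hasDerivAt_integral_euclideanIntegrand ha hx.1)).congr_deriv ?_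
    push_cast; ring
  have h0 : f r = f 0 := by
    have := intervalIntegral.integral_eq_sub_of_hasDerivAt_of_le hr hcont hder
      intervalIntegrable_const
    rw [intervalIntegral.integral_zero] at this
    exact sub_eq_zero.1 this.symm
  simp only [hf] at h0
  have e : Complex.exp ((0 / 2 : ℝ) : ℂ) = 1 := by simp
  rw [e, one_mul] at h0
  rw [← h0, ← mul_assoc, ← Complex.exp_add]
  simp

/-- A Gaussian integral, by completing the square. The parameter p allows division by 1 + is through
an integration over p, and p = 0 gives the value needed for exponent 1/2. -/
theorem integral_exp_one_add_sq_sub (p : ℝ) :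
    ∫ s : ℝ, Complex.exp ((1 + s * Complex.I) ^ 2 / 4 - (1 + s * Complex.I) * p) =
      ((2 * √Real.pi * Real.exp (-p ^ 2) : ℝ) : ℂ) := by
  have h := integral_cexp_quadratic (b := -1 / 4) (by norm_num) (Complex.I * (1 / 2 - p)) (1 / 4 - p)
  have e : ∀ s : ℝ, Complex.exp ((1 + s * Complex.I) ^ 2 / 4 - (1 + s * Complex.I) * p) =
      Complex.exp (-1 / 4 * s ^ 2 + Complex.I * (1 / 2 - p) * s + (1 / 4 - p)) := fun s => by
    congr 1; linear_combination (s : ℂ) ^ 2 / 4 * Complex.I_sq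
  simp only [e]
  rw [h]
  have e1 : (1 / 4 - p - (Complex.I * (1 / 2 - p)) ^ 2 / (4 * (-1 / 4)) : ℂ) = ((-p ^ 2 : ℝ) : ℂ) := by
    push_cast; linear_combination (1 / 2 - (p : ℂ)) ^ 2 * Complex.I_sq
  have e2 : (Real.pi / -(-1 / 4) : ℂ) = ((2 ^ 2 * Real.pi : ℝ) : ℂ) := by push_cast; ring
  rw [e1, e2, show (1 / 2 : ℂ) = ((1 / 2 : ℝ) : ℂ) by push_cast; ring,
    ← Complex.ofReal_cpow (by positivity), ← Real.sqrt_eq_rpow, Real.sqrt_mul (by norm_num),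
    Real.sqrt_sq (by norm_num)]
  push_cast
  ring

/-- Since Re(1 + is) > 0, the quotient 1/(1 + is) is the integral of exp(-(1 + is)p) over p > 0.
Fubini then leaves 2√π times the integral of exp(-p²) over p > 0, which is π. -/
theorem integral_exp_one_add_sq_div :
    ∫ s : ℝ, Complex.exp ((1 + s * Complex.I) ^ 2 / 4) / (1 + s * Complex.I) = (Real.pi : ℂ) := by
  have h1 : ∀ s : ℝ, Complex.exp ((1 + s * Complex.I) ^ 2 / 4) / (1 + s * Complex.I) =
      ∫ p in Ioi (0 : ℝ), Complex.exp ((1 + s * Complex.I) ^ 2 / 4 - (1 + s * Complex.I) * p) := by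
    intro s
    have := integral_exp_mul_complex_Ioi (a := -(1 + s * Complex.I)) (by simp) 0
    have e : ∀ p : ℝ, Complex.exp ((1 + s * Complex.I) ^ 2 / 4 - (1 + s * Complex.I) * p) =
        Complex.exp ((1 + s * Complex.I) ^ 2 / 4) * Complex.exp (-(1 + s * Complex.I) * p) :=
      fun p => by rw [← Complex.exp_add]; congr 1; ring
    simp only [e, integral_const_mul, this]
    have := one_add_mul_I_ne_zero s
    simp only [Complex.ofReal_zero, mul_zero, Complex.exp_zero]
    rw [neg_div_neg_eq, mul_one_div]
  simp only [h1]
  rw [integral_integral_swap]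
  · simp only [integral_exp_one_add_sq_sub]
    rw [integral_complex_ofReal, integral_const_mul]
    have := integral_gaussian_Ioi 1
    simp only [neg_mul, one_mul, div_one] at this
    rw [this]
    push_cast
    have hs : (√Real.pi : ℂ) * √Real.pi = Real.pi := by
      exact_mod_cast Real.mul_self_sqrt Real.pi_pos.le
    linear_combination hs
  · have i1 : Integrable (fun s : ℝ => Real.exp (1 / 4) * Real.exp (-(1 / 4) * s ^ 2)) :=
      (integrable_exp_neg_mul_sq (by norm_num)).const_mul _
    have i2 : IntegrableOn (fun p : ℝ => Real.exp (-p)) (Ioi 0) := integrableOn_exp_neg_Ioi 0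
    refine (i1.mul_prod i2).mono' (by fun_prop) (Filter.Eventually.of_forall fun q => ?_)
    simp only [Function.uncurry]
    rw [Complex.exp_sub, norm_div, norm_exp_one_add_sq, Complex.norm_exp]
    simp [Real.exp_neg, div_eq_mul_inv]

theorem integral_euclideanIntegrand_one : ∫ s, euclideanIntegrand 1 0 s = 2 * Real.pi := by
  rw [← integral_exp_one_add_sq_div, ← integral_const_mul]
  congr 1; ext s
  have := one_add_mul_I_ne_zero s
  rw [euclideanIntegrand, Complex.ofReal_one, Complex.cpow_neg_one, Complex.ofReal_zero]
  field_simp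
  ring

/-- The principal square root of η²/2 is η/√2 because Re η = 1 > 0 for η = 1 + is. So the integrand
collapses to √2 exp(η²/4). -/
theorem integral_euclideanIntegrand_half :
    ∫ s, euclideanIntegrand (1 / 2) 0 s = ((√2 * (2 * √Real.pi) : ℝ) : ℂ) := by
  have h := integral_exp_one_add_sq_sub 0
  simp only [Complex.ofReal_zero, mul_zero, sub_zero] at h
  have : ((√2 * (2 * √Real.pi) : ℝ) : ℂ) = (√2 : ℂ) * ((2 * √Real.pi * Real.exp (-0 ^ 2) : ℝ) : ℂ) := by
    simp
  rw [this, ← h, ← integral_const_mul]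
  congr 1; ext s
  have hs := one_add_mul_I_ne_zero s
  have h2 : (√2 : ℂ) ≠ 0 := by simp
  have hsq : (√2 : ℂ) ^ 2 = 2 := by exact_mod_cast Real.sq_sqrt (zero_le_two (α := ℝ))
  have e : (((0 : ℝ) : ℂ) + (1 + s * Complex.I) ^ 2 / 2) = ((1 + s * Complex.I) / (√2 : ℝ)) ^ 2 := by
    rw [div_pow, hsq]; simp
  rw [euclideanIntegrand, e, Complex.cpow_neg]
  have e2 : (((1 + s * Complex.I) / (√2 : ℝ)) ^ 2) ^ ((1 / 2 : ℝ) : ℂ) =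
      (1 + s * Complex.I) / (√2 : ℝ) := by
    rw [show ((1 / 2 : ℝ) : ℂ) = 2⁻¹ by push_cast; ring]
    refine Complex.sq_cpow_two_inv ?_
    rw [Complex.div_ofReal_re]
    simp
  rw [e2]
  field_simp

/-- Passing from n to n + 2 raises a by one. Then Γ(a)2^a gains the factor 2a, which the recursion
of the integrals removes. The two parities start from the explicit integrals for a = 1/2 and a = 1.
-/
theorem Gamma_mul_integral_euclideanIntegrand (n : ℕ) :
    ((Real.Gamma (((n : ℝ) + 1) / 2) * 2 ^ (((n : ℝ) + 1) / 2) : ℝ) : ℂ) *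
      ∫ s, euclideanIntegrand (((n : ℝ) + 1) / 2) 0 s = 4 * Real.pi := by
  induction n using Nat.twoStepInduction with
  | zero =>
    rw [show (((0 : ℕ) : ℝ) + 1) / 2 = 1 / 2 by norm_num, integral_euclideanIntegrand_half,
      Real.Gamma_one_half_eq, ← Real.sqrt_eq_rpow, ← Complex.ofReal_mul]
    have h1 := Real.mul_self_sqrt Real.pi_pos.le
    have h2 := Real.mul_self_sqrt (zero_le_two (α := ℝ))
    have : √Real.pi * √2 * (√2 * (2 * √Real.pi)) = 4 * Real.pi := by
      linear_combination 4 * h1 + 2 * √Real.pi ^ 2 * h2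
    rw [this]; push_cast; rfl
  | one =>
    rw [show (((1 : ℕ) : ℝ) + 1) / 2 = 1 by norm_num, integral_euclideanIntegrand_one,
      Real.Gamma_one, Real.rpow_one]
    push_cast; ring
  | more n ih _ =>
    have ha : (0 : ℝ) < ((n : ℝ) + 1) / 2 := by positivity
    rw [show (((n + 2 : ℕ) : ℝ) + 1) / 2 = ((n : ℝ) + 1) / 2 + 1 by push_cast; ring]
    set a := ((n : ℝ) + 1) / 2
    rw [Real.Gamma_add_one ha.ne', Real.rpow_add_one (by norm_num), ← ih,
      integral_euclideanIntegrand_succ ha.le le_rfl]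
    push_cast; ring

/-- The constant in the limit of the rescaled heat kernel. -/
theorem heatConst_mul_integral_euclideanIntegrand (n : ℕ) {r : ℝ} (hr : 0 ≤ r) :
    (heatConst n : ℂ) * ∫ s, euclideanIntegrand (((n : ℝ) + 1) / 2) r s =
      (((4 * Real.pi) ^ (-((n : ℝ) / 2)) * Real.exp (-(r / 2)) : ℝ) : ℂ) := by
  have ha : (0 : ℝ) < ((n : ℝ) + 1) / 2 := by positivity
  have h := Gamma_mul_integral_euclideanIntegrand n
  rw [integral_euclideanIntegrand_eq ha.le hr]
  have hG := Real.Gamma_pos_of_pos ha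
  have h2 : (0 : ℝ) < 2 ^ (((n : ℝ) + 1) / 2) := by positivity
  have hGc : ((Real.Gamma (((n : ℝ) + 1) / 2) * 2 ^ (((n : ℝ) + 1) / 2) : ℝ) : ℂ) ≠ 0 := by
    exact_mod_cast (mul_pos hG h2).ne'
  rw [eq_div_of_mul_eq hGc ((mul_comm _ _).trans h), ← Complex.ofReal_neg, ← Complex.ofReal_exp,
    show (4 * Real.pi : ℂ) = ((4 * Real.pi : ℝ) : ℂ) by push_cast; rfl, ← Complex.ofReal_div,
    ← Complex.ofReal_mul, ← Complex.ofReal_mul]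
  congr 1
  have e4 : (4 * Real.pi) ^ (-((n : ℝ) / 2)) =
      2 / ((2 ^ (((n : ℝ) + 1) / 2)) ^ 2 * Real.pi ^ ((n : ℝ) / 2)) := by
    rw [Real.rpow_neg (by positivity), Real.mul_rpow (by norm_num) Real.pi_pos.le]
    have : (4 : ℝ) ^ ((n : ℝ) / 2) * 2 = (2 ^ (((n : ℝ) + 1) / 2)) ^ 2 := by
      rw [show (4 : ℝ) = 2 ^ (2 : ℝ) by norm_num, ← Real.rpow_mul (by norm_num),
        ← Real.rpow_natCast, ← Real.rpow_mul (by norm_num), ← Real.rpow_add_one (by norm_num)]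
      congr 1; push_cast; ring
    rw [← this]
    have h5 : (0 : ℝ) < 4 ^ ((n : ℝ) / 2) := by positivity
    have h6 : (0 : ℝ) < Real.pi ^ ((n : ℝ) / 2) := by positivity
    field_simp
  rw [e4, heatConst]
  have h6 : (0 : ℝ) < Real.pi ^ ((n : ℝ) / 2) := by positivity
  field_simp
  ring

section

/-! ### The solution of the Cauchy problem for positive time -/

variable {n : ℕ} [NeZero n]

theorem fderiv_slice_right {F : ℝ × EuclideanSpace ℝ (Fin n) → ℂ} {t : ℝ}
    {w : EuclideanSpace ℝ (Fin n)} (hF : DifferentiableAt ℝ F (t, w))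
    (v : EuclideanSpace ℝ (Fin n)) :
    fderiv ℝ (fun w => F (t, w)) w v = fderiv ℝ F (t, w) (0, v) := by
  have h1 : HasFDerivAt (fun w : EuclideanSpace ℝ (Fin n) => (t, w))
    (ContinuousLinearMap.inr ℝ ℝ _) w := hasFDerivAt_prodMk_right t w
  change fderiv ℝ (F ∘ fun w => (t, w)) w v = _
  rw [(hF.hasFDerivAt.comp w h1).fderiv]
  simp

theorem deriv_slice_left {F : ℝ × EuclideanSpace ℝ (Fin n) → ℂ} {t : ℝ}
    {w : EuclideanSpace ℝ (Fin n)} (hF : DifferentiableAt ℝ F (t, w)) :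
    HasDerivAt (fun s => F (s, w)) (fderiv ℝ F (t, w) (1, 0)) t := by
  have h1 : HasDerivAt (fun s : ℝ => (s, w)) ((1 : ℝ), (0 : EuclideanSpace ℝ (Fin n))) t :=
    (hasDerivAt_id t).prodMk (hasDerivAt_const t w)
  exact hF.hasFDerivAt.comp_hasDerivAt t h1

theorem isOpen_Ioi_prod_hypSpace : IsOpen (Ioi (0 : ℝ) ×ˢ hypSpace n) :=
  isOpen_Ioi.prod isOpen_hypSpace

theorem contDiffOn_fderiv_apply {F : ℝ × EuclideanSpace ℝ (Fin n) → ℂ}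
    (hF : ContDiffOn ℝ ∞ F (Ioi 0 ×ˢ hypSpace n)) (v : ℝ × EuclideanSpace ℝ (Fin n)) :
    ContDiffOn ℝ ∞ (fun p => fderiv ℝ F p v) (Ioi 0 ×ˢ hypSpace n) :=
  ((contDiffOn_infty_iff_fderiv_of_isOpen isOpen_Ioi_prod_hypSpace).1 hF).2.clm_apply
    contDiffOn_const

theorem ContDiffOn.differentiableAt_of_isOpen {E F : Type*} [NormedAddCommGroup E]
    [NormedSpace ℝ E] [NormedAddCommGroup F] [NormedSpace ℝ F] {f : E → F} {s : Set E}
    (hf : ContDiffOn ℝ ∞ f s) (hs : IsOpen s) {x : E} (hx : x ∈ s) : DifferentiableAt ℝ f x :=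
  (hf.contDiffAt (hs.mem_nhds hx)).differentiableAt (by simp)

theorem contDiffOn_slice {F : ℝ × EuclideanSpace ℝ (Fin n) → ℂ}
    (hF : ContDiffOn ℝ ∞ F (Ioi 0 ×ˢ hypSpace n)) {t : ℝ} (ht : 0 < t) :
    ContDiffOn ℝ ∞ (fun w => F (t, w)) (hypSpace n) :=
  hF.comp (contDiff_const.prodMk contDiff_id).contDiffOn fun w hw => ⟨ht, hw⟩

/-- Written with space-time derivatives in fixed directions, the operator can be exchanged with an
integral by using `fderiv_parametric_integral` once per derivative. -/
theorem hypLaplacian_slice {F : ℝ × EuclideanSpace ℝ (Fin n) → ℂ}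
    (hF : ContDiffOn ℝ ∞ F (Ioi 0 ×ˢ hypSpace n)) {t : ℝ} (ht : 0 < t)
    {w : EuclideanSpace ℝ (Fin n)} (hw : w ∈ hypSpace n) :
    hypLaplacian (fun w => F (t, w)) w = (w (lastIndex n) : ℂ) ^ 2 *
      (∑ i, fderiv ℝ (fun p => fderiv ℝ F p (0, EuclideanSpace.single i 1)) (t, w)
        (0, EuclideanSpace.single i 1))
      + (2 - (n : ℂ)) * (w (lastIndex n) : ℂ) *
        fderiv ℝ F (t, w) (0, EuclideanSpace.single (lastIndex n) 1)
      + ((n : ℂ) - 1) ^ 2 / 4 * F (t, w) := by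
  have hd : ∀ v ∈ hypSpace n, DifferentiableAt ℝ F (t, v) := fun v hv =>
    hF.differentiableAt_of_isOpen isOpen_Ioi_prod_hypSpace ⟨ht, hv⟩
  have hdd : DifferentiableAt ℝ (fderiv ℝ (fun w => F (t, w))) w :=
    ((((contDiffOn_slice hF ht).of_le two_le_infty).contDiffAt
      (isOpen_hypSpace.mem_nhds hw)).fderiv_right (m := 1) (by norm_num)).differentiableAt (by simp)
  rw [hypLaplacian, laplacian_eq_sum_fderiv hdd, fderiv_slice_right (hd w hw)]
  congr 4
  ext i
  have hev : (fun w => fderiv ℝ (fun w => F (t, w)) w (EuclideanSpace.single i 1)) =ᶠ[nhds w]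
      fun w => fderiv ℝ F (t, w) (0, EuclideanSpace.single i 1) := by
    filter_upwards [isOpen_hypSpace.mem_nhds hw] with v hv using fderiv_slice_right (hd v hv) _
  rw [hev.fderiv_eq]
  exact fderiv_slice_right (F := fun p => fderiv ℝ F p (0, EuclideanSpace.single i 1))
    ((contDiffOn_fderiv_apply hF _).differentiableAt_of_isOpen isOpen_Ioi_prod_hypSpace ⟨ht, hw⟩) _

theorem hypLaplacian_mul_const {f : EuclideanSpace ℝ (Fin n) → ℂ}
    (hf : ContDiffOn ℝ ∞ f (hypSpace n)) {w : EuclideanSpace ℝ (Fin n)} (hw : w ∈ hypSpace n)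
    (c : ℂ) : hypLaplacian (fun w => f w * c) w = hypLaplacian f w * c := by
  have h1 : ContDiffAt ℝ 2 f w := (hf.contDiffAt (isOpen_hypSpace.mem_nhds hw)).of_le two_le_infty
  have h2 := h1.laplacian_CLM_comp_left (l := (ContinuousLinearMap.mul ℝ ℂ).flip c)
  have h3 : ((ContinuousLinearMap.mul ℝ ℂ).flip c ∘ f) = fun w => f w * c := rfl
  rw [h3] at h2
  rw [hypLaplacian, hypLaplacian, h2, fderiv_mul_const (h1.differentiableAt (by simp))]
  simp
  ring

/-- The Cauchy data times the density of the hyperbolic volume. -/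
noncomputable def weightedData (V₀ : EuclideanSpace ℝ (Fin n) → ℂ)
    (w : EuclideanSpace ℝ (Fin n)) : ℂ :=
  V₀ w * ((1 / w (lastIndex n) ^ n : ℝ) : ℂ)

/-- The integrand of the solution of the Cauchy problem. -/
noncomputable def heatIntegrand (V₀ : EuclideanSpace ℝ (Fin n) → ℂ)
    (p : ℝ × EuclideanSpace ℝ (Fin n)) (w' : EuclideanSpace ℝ (Fin n)) : ℂ :=
  heatProfile (((n : ℝ) + 1) / 2) p.1 (coshDist p.2 w') * weightedData V₀ w'

/-- The solution of the Cauchy problem for positive time. -/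
noncomputable def heatSolution (V₀ : EuclideanSpace ℝ (Fin n) → ℂ)
    (p : ℝ × EuclideanSpace ℝ (Fin n)) : ℂ :=
  (-Complex.I * (heatConst n : ℂ)) * ∫ w', heatIntegrand V₀ p w'

variable {V₀ : EuclideanSpace ℝ (Fin n) → ℂ}

theorem weightedData_eq_zero {w : EuclideanSpace ℝ (Fin n)} (hw : w ∉ tsupport V₀) :
    weightedData V₀ w = 0 := by
  rw [weightedData, image_eq_zero_of_notMem_tsupport hw, zero_mul]

/-- The density is singular on the boundary of the half space, but V₀ vanishes near every point
outside the half space because its closed support lies inside. -/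
theorem contDiff_weightedData (hV₀ : ContDiff ℝ ∞ V₀) (hsupp : tsupport V₀ ⊆ hypSpace n) :
    ContDiff ℝ ∞ (weightedData V₀) := by
  refine contDiff_iff_contDiffAt.2 fun w => ?_
  by_cases hw : w ∈ hypSpace n
  · have h3 : w (lastIndex n) ≠ 0 := ne_of_gt hw
    refine hV₀.contDiffAt.mul (Complex.ofRealCLM.contDiff.contDiffAt.comp w ?_)
    exact contDiffAt_const.div ((contDiff_coordinate _).contDiffAt.pow n) (pow_ne_zero n h3)
  · have : weightedData V₀ =ᶠ[nhds w] fun _ => 0 := by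
      filter_upwards [(isClosed_tsupport V₀).isOpen_compl.mem_nhds fun h => hw (hsupp h)] with v hv
        using weightedData_eq_zero hv
    exact contDiffAt_const.congr_of_eventuallyEq this

theorem heatIntegrand_eq_zero (p : ℝ × EuclideanSpace ℝ (Fin n)) {w' : EuclideanSpace ℝ (Fin n)}
    (hw : w' ∉ tsupport V₀) : heatIntegrand V₀ p w' = 0 := by
  rw [heatIntegrand, weightedData_eq_zero hw, mul_zero]

theorem contDiffOn_heatProfile_coshDist : ContDiffOn ℝ ∞
    (fun q : (ℝ × EuclideanSpace ℝ (Fin n)) × EuclideanSpace ℝ (Fin n) =>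
      heatProfile (((n : ℝ) + 1) / 2) q.1.1 (coshDist q.1.2 q.2))
    ((Ioi 0 ×ˢ hypSpace n) ×ˢ hypSpace n) := by
  have h1 : ContDiffOn ℝ ∞ (fun q : (ℝ × EuclideanSpace ℝ (Fin n)) × EuclideanSpace ℝ (Fin n) =>
      coshDist q.1.2 q.2) ((Ioi 0 ×ˢ hypSpace n) ×ˢ hypSpace n) :=
    ContDiffOn.comp (g := fun p : EuclideanSpace ℝ (Fin n) × EuclideanSpace ℝ (Fin n) =>
      coshDist p.1 p.2) (f := fun q : (ℝ × EuclideanSpace ℝ (Fin n)) × EuclideanSpace ℝ (Fin n) =>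
        (q.1.2, q.2)) contDiffOn_coshDist
      ((contDiff_snd.comp contDiff_fst).prodMk contDiff_snd).contDiffOn
      fun q hq => ⟨hq.1.2, hq.2⟩
  exact ContDiffOn.comp (g := fun p : ℝ × ℝ => heatProfile (((n : ℝ) + 1) / 2) p.1 p.2)
    (f := fun q : (ℝ × EuclideanSpace ℝ (Fin n)) × EuclideanSpace ℝ (Fin n) =>
      (q.1.1, coshDist q.1.2 q.2)) (contDiffOn_heatProfile (by positivity))
    (ContDiffOn.prodMk (contDiff_fst.comp contDiff_fst).contDiffOn h1)
    fun q hq => ⟨hq.1.1, coshDist_pos hq.1.2 hq.2⟩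

theorem contDiffOn_heatIntegrand (hV₀ : ContDiff ℝ ∞ V₀) (hsupp : tsupport V₀ ⊆ hypSpace n) :
    ContDiffOn ℝ ∞ (fun q : (ℝ × EuclideanSpace ℝ (Fin n)) × EuclideanSpace ℝ (Fin n) =>
      heatIntegrand V₀ q.1 q.2) ((Ioi 0 ×ˢ hypSpace n) ×ˢ univ) := by
  rintro ⟨p, w'⟩ ⟨hp, -⟩
  refine ContDiffAt.contDiffWithinAt ?_
  by_cases hw : w' ∈ hypSpace n
  · exact (contDiffOn_heatProfile_coshDist.contDiffAt
      ((isOpen_Ioi_prod_hypSpace.prod isOpen_hypSpace).mem_nhds ⟨hp, hw⟩)).mul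
      ((contDiff_weightedData hV₀ hsupp).comp contDiff_snd).contDiffAt
  · have : (fun q : (ℝ × EuclideanSpace ℝ (Fin n)) × EuclideanSpace ℝ (Fin n) =>
        heatIntegrand V₀ q.1 q.2) =ᶠ[nhds (p, w')] fun _ => 0 := by
      filter_upwards [(isOpen_univ.prod (isClosed_tsupport V₀).isOpen_compl).mem_nhds
        (⟨mem_univ p, fun h => hw (hsupp h)⟩ : (p, w') ∈ univ ×ˢ (tsupport V₀)ᶜ)] with q hq
        using heatIntegrand_eq_zero q.1 hq.2
    exact contDiffAt_const.congr_of_eventuallyEq this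

theorem contDiffOn_heatSolution (hV₀ : ContDiff ℝ ∞ V₀) (hcomp : HasCompactSupport V₀)
    (hsupp : tsupport V₀ ⊆ hypSpace n) :
    ContDiffOn ℝ ∞ (heatSolution V₀) (Ioi 0 ×ˢ hypSpace n) :=
  contDiffOn_const.mul (contDiffOn_parametric_integral isOpen_Ioi_prod_hypSpace hcomp
    (fun p _ _ hx => heatIntegrand_eq_zero p hx) (contDiffOn_heatIntegrand hV₀ hsupp))

theorem hypLaplacian_heatIntegrand (hsupp : tsupport V₀ ⊆ hypSpace n) {t : ℝ} (ht : 0 < t)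
    {w : EuclideanSpace ℝ (Fin n)} (hw : w ∈ hypSpace n) (w' : EuclideanSpace ℝ (Fin n)) :
    hypLaplacian (fun w => heatIntegrand V₀ (t, w) w') w =
      deriv (fun s => heatIntegrand V₀ (s, w) w') t := by
  by_cases hw' : w' ∈ tsupport V₀
  · have hw'' := hsupp hw'
    have h1 : ContDiffOn ℝ ∞ (fun w => heatProfile (((n : ℝ) + 1) / 2) t (coshDist w w'))
        (hypSpace n) :=
      ContDiffOn.comp (g := fun q : (ℝ × EuclideanSpace ℝ (Fin n)) × EuclideanSpace ℝ (Fin n) =>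
        heatProfile (((n : ℝ) + 1) / 2) q.1.1 (coshDist q.1.2 q.2)) (f := fun w => ((t, w), w'))
        contDiffOn_heatProfile_coshDist
        ((contDiff_const.prodMk contDiff_id).prodMk contDiff_const).contDiffOn
        fun w hw => ⟨⟨ht, hw⟩, hw''⟩
    simp only [heatIntegrand]
    rw [hypLaplacian_mul_const h1 hw, hypLaplacian_heatProfile ht hw hw'', deriv_mul_const]
    exact (hasDerivAt_heatProfile_left (by positivity) ht (coshDist_pos hw hw'')).differentiableAt
  · simp only [heatIntegrand_eq_zero _ hw']
    rw [hypLaplacian]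
    have : Laplacian.laplacian (fun _ : EuclideanSpace ℝ (Fin n) => (0 : ℂ)) w = 0 := by
      rw [InnerProductSpace.laplacian_const]; rfl
    rw [this]; simp

theorem integrable_of_contDiffOn {P G : Type*} [NormedAddCommGroup P] [NormedSpace ℝ P]
    [NormedAddCommGroup G] [NormedSpace ℝ G] [MeasurableSpace G] [BorelSpace G]
    {μ : Measure G} [IsFiniteMeasureOnCompacts μ] {s : Set P} {k : Set G} {Φ : P → G → ℂ}
    (hk : IsCompact k) (h0 : ∀ p ∈ s, ∀ x, x ∉ k → Φ p x = 0)
    (hΦ : ContDiffOn ℝ ∞ (fun q : P × G => Φ q.1 q.2) (s ×ˢ univ)) {p : P} (hp : p ∈ s) :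
    Integrable (Φ p) μ := by
  refine Continuous.integrable_of_hasCompactSupport ?_ (HasCompactSupport.intro hk (h0 p hp))
  exact hΦ.continuousOn.comp_continuous (f := fun x : G => (p, x)) (by fun_prop)
    fun x => ⟨hp, mem_univ _⟩

/-- For each w' the integrand solves the heat equation, and first and second derivatives pass under
the integral over the compact support of V₀. -/
theorem hypLaplacian_heatSolution (hV₀ : ContDiff ℝ ∞ V₀) (hcomp : HasCompactSupport V₀)
    (hsupp : tsupport V₀ ⊆ hypSpace n) {t : ℝ} (ht : 0 < t)
    {w : EuclideanSpace ℝ (Fin n)} (hw : w ∈ hypSpace n) :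
    hypLaplacian (fun w => heatSolution V₀ (t, w)) w =
      deriv (fun s => heatSolution V₀ (s, w)) t := by
  have hO := isOpen_Ioi_prod_hypSpace (n := n)
  have hΦ := contDiffOn_heatIntegrand hV₀ hsupp
  have h0 : ∀ p ∈ Ioi (0 : ℝ) ×ˢ hypSpace n, ∀ x, x ∉ tsupport V₀ → heatIntegrand V₀ p x = 0 :=
    fun p _ x hx => heatIntegrand_eq_zero p hx
  have hΦ1 := fun v => contDiffOn_fderiv_parameter hO hΦ v
  have h01 := fun v => fderiv_parameter_eq_zero hO h0 v
  have hΦ2 := fun v u => contDiffOn_fderiv_parameter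
    (Φ := fun p x => fderiv ℝ (fun p => heatIntegrand V₀ p x) p v) hO (hΦ1 v) u
  have h02 := fun v u => fderiv_parameter_eq_zero hO (h01 v) u
  set J : ℝ × EuclideanSpace ℝ (Fin n) → ℂ := fun p => ∫ w', heatIntegrand V₀ p w' with hJ
  have hp : (t, w) ∈ Ioi (0 : ℝ) ×ˢ hypSpace n := ⟨ht, hw⟩
  have hJs : ContDiffOn ℝ ∞ J (Ioi 0 ×ˢ hypSpace n) :=
    contDiffOn_parametric_integral hO hcomp h0 hΦ
  have hJ1 : ∀ v, ∀ p ∈ Ioi (0 : ℝ) ×ˢ hypSpace n, fderiv ℝ J p v =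
      ∫ x, fderiv ℝ (fun p => heatIntegrand V₀ p x) p v := fun v p hp =>
    fderiv_parametric_integral hO hcomp h0 hΦ hp v
  have hJ2 : ∀ v u, fderiv ℝ (fun p => fderiv ℝ J p v) (t, w) u =
      ∫ x, fderiv ℝ (fun p => fderiv ℝ (fun p => heatIntegrand V₀ p x) p v) (t, w) u := by
    intro v u
    have hev : (fun p => fderiv ℝ J p v) =ᶠ[nhds (t, w)]
        fun p => ∫ x, fderiv ℝ (fun p => heatIntegrand V₀ p x) p v := by
      filter_upwards [hO.mem_nhds hp] with p hp using hJ1 v p hp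
    rw [hev.fderiv_eq]
    exact fderiv_parametric_integral
      (Φ := fun p x => fderiv ℝ (fun p => heatIntegrand V₀ p x) p v) hO hcomp (h01 v) (hΦ1 v) hp u
  have hslice : ∀ x, ContDiffOn ℝ ∞ (fun p => heatIntegrand V₀ p x) (Ioi 0 ×ˢ hypSpace n) :=
    fun x => ContDiffOn.comp (f := fun p => (p, x)) hΦ
      (contDiff_id.prodMk contDiff_const).contDiffOn fun p hp => ⟨hp, mem_univ _⟩
  have hmain : hypLaplacian (fun w => J (t, w)) w = deriv (fun s => J (s, w)) t := by
    rw [hypLaplacian_slice hJs ht hw,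
      (deriv_slice_left (hJs.differentiableAt_of_isOpen hO hp)).deriv, hJ1 _ _ hp, hJ1 _ _ hp]
    simp only [hJ2]
    rw [← integral_finsetSum _ fun i _ => integrable_of_contDiffOn hcomp (h02 _ _) (hΦ2 _ _) hp,
      ← integral_const_mul, ← integral_const_mul, hJ, ← integral_const_mul, ← integral_add,
      ← integral_add]
    · congr 1; ext x
      rw [← hypLaplacian_slice (hslice x) ht hw, hypLaplacian_heatIntegrand hsupp ht hw x]
      exact (deriv_slice_left ((hslice x).differentiableAt_of_isOpen hO hp)).deriv
    · exact ((integrable_finsetSum _ fun i _ =>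
        integrable_of_contDiffOn hcomp (h02 _ _) (hΦ2 _ _) hp).const_mul _).add
        ((integrable_of_contDiffOn hcomp (h01 _) (hΦ1 _) hp).const_mul _)
    · exact (integrable_of_contDiffOn hcomp h0 hΦ hp).const_mul _
    · exact (integrable_finsetSum _ fun i _ =>
        integrable_of_contDiffOn hcomp (h02 _ _) (hΦ2 _ _) hp).const_mul _
    · exact (integrable_of_contDiffOn hcomp (h01 _) (hΦ1 _) hp).const_mul _
  have e : ∀ p, heatSolution V₀ p = J p * (-Complex.I * (heatConst n : ℂ)) := fun p => by
    rw [heatSolution, mul_comm]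
  simp only [e]
  rw [hypLaplacian_mul_const (contDiffOn_slice hJs ht) hw, hmain, deriv_mul_const]
  exact (deriv_slice_left (hJs.differentiableAt_of_isOpen hO hp)).differentiableAt

end

section

/-! ### Boundedness of the solution and its limit at time zero -/

variable {n : ℕ} [NeZero n]

/-- The contour is taken at Re y = √t. The powers of t combine to t/(√t · t^((n+1)/2)) = t^(-n/2),
the inverse of the Jacobian of w' = w + √t u. -/
theorem hypHeatKernel_eq_scaled {σ t : ℝ} (hσ : σ ∈ Ioo 0 (2 * Real.pi)) (ht : 0 < t) (ht1 : t ≤ 1)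
    {w w' : EuclideanSpace ℝ (Fin n)} (hw : w ∈ hypSpace n) (hw' : w' ∈ hypSpace n) :
    hypHeatKernel n σ t w w' = (((√t ^ n)⁻¹ : ℝ) : ℂ) * ((heatConst n : ℂ) *
      ∫ s : ℝ, scaledIntegrand (((n : ℝ) + 1) / 2) t (coshDist w w') s) := by
  rw [hypHeatKernel_eq_contour hσ (sqrt_mem_Ioo ht ht1) ht hw hw',
    integral_contourIntegrand_sqrt ht ht1 (one_le_coshDist hw hw')]
  have hs : 0 < √t := Real.sqrt_pos.2 ht
  have h1 : t ^ (((n : ℝ) + 1) / 2) = √t ^ n * √t := by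
    rw [← pow_succ, Real.sqrt_eq_rpow, ← Real.rpow_natCast, ← Real.rpow_mul ht.le]
    push_cast; congr 1; ring
  have h2 : heatConst n / √t * (t / t ^ (((n : ℝ) + 1) / 2)) = (√t ^ n)⁻¹ * heatConst n := by
    rw [h1]
    nth_rewrite 2 [← Real.mul_self_sqrt ht.le]
    field_simp
  rw [← mul_assoc, ← mul_assoc, ← Complex.ofReal_mul, ← Complex.ofReal_mul, h2]

theorem heatConst_nonneg (n : ℕ) : 0 ≤ heatConst n := by
  have := Real.Gamma_nonneg_of_nonneg (show (0 : ℝ) ≤ ((n : ℝ) + 1) / 2 by positivity)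
  rw [heatConst]; positivity

theorem one_mem_Ioo_two_pi : (1 : ℝ) ∈ Ioo 0 (2 * Real.pi) :=
  ⟨one_pos, by linarith [Real.pi_gt_three]⟩

variable {V₀ : EuclideanSpace ℝ (Fin n) → ℂ}

theorem mul_heatIntegrand (hsupp : tsupport V₀ ⊆ hypSpace n) {σ t : ℝ}
    (hσ : σ ∈ Ioo 0 (2 * Real.pi)) (ht : 0 < t) {w : EuclideanSpace ℝ (Fin n)} (hw : w ∈ hypSpace n)
    (w' : EuclideanSpace ℝ (Fin n)) :
    (-Complex.I * (heatConst n : ℂ)) * heatIntegrand V₀ (t, w) w' =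
      hypHeatKernel n σ t w w' * weightedData V₀ w' := by
  by_cases hw' : w' ∈ tsupport V₀
  · rw [hypHeatKernel_eq_heatProfile hσ ht hw (hsupp hw'), heatIntegrand]; ring
  · rw [heatIntegrand_eq_zero _ hw', weightedData_eq_zero hw', mul_zero, mul_zero]

theorem heatSolution_eq_integral (hsupp : tsupport V₀ ⊆ hypSpace n) {σ t : ℝ}
    (hσ : σ ∈ Ioo 0 (2 * Real.pi)) (ht : 0 < t) {w : EuclideanSpace ℝ (Fin n)}
    (hw : w ∈ hypSpace n) :
    heatSolution V₀ (t, w) = ∫ w', hypHeatKernel n σ t w w' * weightedData V₀ w' := by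
  rw [heatSolution, ← integral_const_mul]
  simp only [mul_heatIntegrand hsupp hσ ht hw]

/-- The integrand of the solution after the substitution `w' = w + √t u`. -/
noncomputable def rescaledIntegrand (V₀ : EuclideanSpace ℝ (Fin n) → ℂ)
    (p : ℝ × EuclideanSpace ℝ (Fin n)) (u : EuclideanSpace ℝ (Fin n)) : ℂ :=
  ((heatConst n : ℂ) * ∫ s : ℝ, scaledIntegrand (((n : ℝ) + 1) / 2) p.1
    (coshDist p.2 (p.2 + √p.1 • u)) s) * weightedData V₀ (p.2 + √p.1 • u)

theorem rescaledIntegrand_eq (hsupp : tsupport V₀ ⊆ hypSpace n) {t : ℝ} (ht : 0 < t) (ht1 : t ≤ 1)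
    {w : EuclideanSpace ℝ (Fin n)} (hw : w ∈ hypSpace n) (u : EuclideanSpace ℝ (Fin n)) :
    rescaledIntegrand V₀ (t, w) u = ((√t ^ n : ℝ) : ℂ) * ((-Complex.I * (heatConst n : ℂ)) *
      heatIntegrand V₀ (t, w) (w + √t • u)) := by
  rw [mul_heatIntegrand hsupp one_mem_Ioo_two_pi ht hw, rescaledIntegrand]
  by_cases hw' : w + √t • u ∈ tsupport V₀
  · rw [hypHeatKernel_eq_scaled one_mem_Ioo_two_pi ht ht1 hw (hsupp hw'), ← mul_assoc, ← mul_assoc,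
      ← Complex.ofReal_mul, mul_inv_cancel₀ (pow_ne_zero n (Real.sqrt_pos.2 ht).ne')]
    simp
  · simp [weightedData_eq_zero hw']

/-- The Jacobian √t^n of w' = w + √t u cancels the singular prefactor of the kernel, so that nothing
blows up as t → 0. -/
theorem heatSolution_eq_rescaled (hsupp : tsupport V₀ ⊆ hypSpace n) {t : ℝ} (ht : 0 < t)
    (ht1 : t ≤ 1) {w : EuclideanSpace ℝ (Fin n)} (hw : w ∈ hypSpace n) :
    heatSolution V₀ (t, w) = ∫ u, rescaledIntegrand V₀ (t, w) u := by
  have h0 : √t ^ n ≠ 0 := pow_ne_zero n (Real.sqrt_pos.2 ht).ne'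
  simp only [rescaledIntegrand_eq hsupp ht ht1 hw]
  rw [integral_const_mul, integral_const_mul,
    Measure.integral_comp_smul_of_nonneg volume (fun v => heatIntegrand V₀ (t, w) (w + v)) (√t)
      (hR := Real.sqrt_nonneg t),
    integral_add_left_eq_self (fun v => heatIntegrand V₀ (t, w) v) w, finrank_euclideanSpace_fin,
    heatSolution, Complex.real_smul, mul_left_comm, ← mul_assoc _ ((((√t) ^ n)⁻¹ : ℝ) : ℂ),
    ← Complex.ofReal_mul, mul_inv_cancel₀ h0]
  simp

theorem exists_coordinate_le (hcomp : HasCompactSupport V₀) :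
    ∃ M : ℝ, 1 ≤ M ∧ ∀ w ∈ tsupport V₀, w (lastIndex n) ≤ M := by
  obtain ⟨M, hM⟩ := IsCompact.exists_bound_of_continuousOn hcomp
    (contDiff_coordinate (lastIndex n)).continuous.continuousOn
  exact ⟨max M 1, le_max_right _ _, fun w hw => (le_abs_self _).trans
    ((hM w hw).trans (le_max_left _ _))⟩

theorem exists_norm_weightedData_le (hV₀ : ContDiff ℝ ∞ V₀) (hcomp : HasCompactSupport V₀)
    (hsupp : tsupport V₀ ⊆ hypSpace n) : ∃ G : ℝ, 0 ≤ G ∧ ∀ w, ‖weightedData V₀ w‖ ≤ G := by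
  obtain ⟨G, hG⟩ := IsCompact.exists_bound_of_continuousOn hcomp
    (contDiff_weightedData hV₀ hsupp).continuous.continuousOn
  refine ⟨max G 0, le_max_right _ _, fun w => ?_⟩
  by_cases hw : w ∈ tsupport V₀
  · exact (hG w hw).trans (le_max_left _ _)
  · rw [weightedData_eq_zero hw, norm_zero]; exact le_max_right _ _

/-- The norm contributes a factor t that cancels. What remains tends to |u|²/(2x_n²), the squared
length of u at w up to the factor 1/2. -/
theorem coshDist_add_sqrt_smul {t : ℝ} (ht : 0 < t) (w u : EuclideanSpace ℝ (Fin n)) :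
    (coshDist w (w + √t • u) - 1) / t =
      ‖u‖ ^ 2 / (2 * (w (lastIndex n) * (w + √t • u) (lastIndex n))) := by
  rw [coshDist, sub_add_cancel_left, norm_neg, norm_smul, mul_pow, Real.norm_eq_abs, sq_abs,
    Real.sq_sqrt ht.le]
  field_simp
  ring

/-- The integrable majorant of the rescaled integrands. -/
theorem integrable_one_add_norm_sq_rpow {n : ℕ} : Integrable
    fun u : EuclideanSpace ℝ (Fin n) => (1 + ‖u‖ ^ 2) ^ (-(((n : ℝ) + 1) / 2)) := by
  have := integrable_rpow_neg_one_add_norm_sq (E := EuclideanSpace ℝ (Fin n)) (μ := volume)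
    (r := (n : ℝ) + 1) (by simp)
  simpa only [neg_div] using this

/-- If the heights of w and of the points of the support are bounded above, then (cosh ρ - 1)/t is
at least |u|²/D with a fixed D. Without the bound X on the height of w this fails, and very high w
need a separate argument. -/
theorem exists_norm_rescaledIntegrand_le (hV₀ : ContDiff ℝ ∞ V₀) (hcomp : HasCompactSupport V₀)
    (hsupp : tsupport V₀ ⊆ hypSpace n) (X : ℝ) : ∃ C : ℝ, 0 ≤ C ∧ ∀ t w u, 0 < t → t ≤ 1 →
      w ∈ hypSpace n → w (lastIndex n) ≤ X →
      ‖rescaledIntegrand V₀ (t, w) u‖ ≤ C * (1 + ‖u‖ ^ 2) ^ (-(((n : ℝ) + 1) / 2)) := by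
  obtain ⟨M, hM1, hM⟩ := exists_coordinate_le hcomp
  obtain ⟨G, hG0, hG⟩ := exists_norm_weightedData_le hV₀ hcomp hsupp
  obtain ⟨C, hC0, hC⟩ := norm_integral_scaledIntegrand_le (a := ((n : ℝ) + 1) / 2) (by positivity)
  have hcn := heatConst_nonneg n
  -- D dominates 2 x_n x_n'. The maximum with 1 ensures D ≥ 1, so that the summand 1 beside |u|²/(2
  -- x_n x_n') is at least 1/D.
  set D : ℝ := 2 * (max X 1 * M) with hD
  have hD1 : 1 ≤ D := by nlinarith [le_max_right X 1]
  refine ⟨heatConst n * (C * D ^ (((n : ℝ) + 1) / 2)) * G, by positivity,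
    fun t w u ht ht1 hw hwX => ?_⟩
  by_cases hw' : w + √t • u ∈ tsupport V₀
  · have hx : 0 < w (lastIndex n) := hw
    have hx' : 0 < (w + √t • u) (lastIndex n) := hsupp hw'
    have hu : 0 ≤ ‖u‖ ^ 2 := by positivity
    have h1 := hC t (coshDist w (w + √t • u)) ht ht1 (one_le_coshDist hw (hsupp hw'))
    rw [coshDist_add_sqrt_smul ht] at h1
    have h2 : (1 + ‖u‖ ^ 2) / D ≤
        ‖u‖ ^ 2 / (2 * (w (lastIndex n) * (w + √t • u) (lastIndex n))) + 1 := by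
      have h3 : 2 * (w (lastIndex n) * (w + √t • u) (lastIndex n)) ≤ D := by
        rw [hD]
        have := hM _ hw'
        have := hwX.trans (le_max_left X 1)
        gcongr
      have h4 : ‖u‖ ^ 2 / D ≤ ‖u‖ ^ 2 / (2 * (w (lastIndex n) * (w + √t • u) (lastIndex n))) := by
        gcongr
      have h5 : 1 / D ≤ 1 := by rw [div_le_one (by linarith)]; exact hD1
      rw [add_div]; linarith
    have h6 : (‖u‖ ^ 2 / (2 * (w (lastIndex n) * (w + √t • u) (lastIndex n))) + 1) ^
        (-(((n : ℝ) + 1) / 2)) ≤ D ^ (((n : ℝ) + 1) / 2) *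
          (1 + ‖u‖ ^ 2) ^ (-(((n : ℝ) + 1) / 2)) := by
      refine (Real.rpow_le_rpow_of_nonpos (by positivity) h2
        (neg_nonpos.2 (by positivity))).trans (le_of_eq ?_)
      rw [Real.div_rpow (by positivity) (by linarith), Real.rpow_neg (x := D) (by linarith)]
      field_simp
    rw [rescaledIntegrand, norm_mul, norm_mul, Complex.norm_real, Real.norm_of_nonneg hcn]
    calc _ ≤ heatConst n * (C * (D ^ (((n : ℝ) + 1) / 2) *
          (1 + ‖u‖ ^ 2) ^ (-(((n : ℝ) + 1) / 2)))) * G := by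
          refine mul_le_mul ?_ (hG _) (norm_nonneg _) (by positivity)
          refine mul_le_mul_of_nonneg_left (h1.trans ?_) hcn
          exact mul_le_mul_of_nonneg_left h6 hC0
      _ = _ := by ring
  · rw [rescaledIntegrand, weightedData_eq_zero hw', mul_zero, norm_zero]
    positivity

/-- For 1 ≤ t ≤ T the integrand on Re y = 1 has one majorant: the Gaussian is widest at t = T, and
exp(1/4t) and t^(-1/2) are largest at t = 1. -/
theorem exists_norm_hypHeatKernel_le_of_one_le {T : ℝ} : ∃ C : ℝ, 0 ≤ C ∧ ∀ t, 1 ≤ t →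
    t ≤ T → ∀ w ∈ hypSpace n, ∀ w' ∈ hypSpace n, ‖hypHeatKernel n 1 t w w'‖ ≤ C := by
  have hm : 0 < 1 - Real.cos 1 := by linarith [cos_lt_one_of_mem_Ioo one_mem_Ioo_two_pi]
  have hcn := heatConst_nonneg n
  set a : ℝ := ((n : ℝ) + 1) / 2 with ha
  have ha0 : 0 ≤ a := by positivity
  by_cases hT : 0 < T
  swap
  · exact ⟨0, le_rfl, fun t h1 h2 => absurd (one_pos.trans_le (h1.trans h2)) hT⟩
  set m := 1 - Real.cos 1 with hmd
  set f : ℝ → ℝ := fun b => Real.exp (1 / 4) / (m / 4) ^ a *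
    (Real.exp (1 * |b|) * Real.exp (-(1 / (4 * T)) * b ^ 2)) with hf
  have hfi : Integrable f :=
    (integrable_exp_mul_abs_mul_exp_neg (by positivity) 1).const_mul _
  have hf0 : 0 ≤ ∫ b, f b := integral_nonneg fun b => by simp only [hf, Pi.zero_apply]; positivity
  refine ⟨heatConst n * ∫ b, f b, by positivity, fun t h1 h2 w hw w' hw' => ?_⟩
  have ht : 0 < t := one_pos.trans_le h1
  have hz := one_le_coshDist hw hw'
  rw [hypHeatKernel_eq_contour one_mem_Ioo_two_pi one_mem_Ioo_two_pi ht hw hw', norm_mul,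
    Complex.norm_real, Real.norm_of_nonneg (by positivity)]
  refine mul_le_mul (div_le_self hcn (Real.one_le_sqrt.2 h1)) ?_ (norm_nonneg _) hcn
  refine norm_integral_le_of_norm_le hfi (Filter.Eventually.of_forall fun b => ?_)
  refine (norm_contourIntegrand_le ha0 hz hm le_rfl b).trans ?_
  have h3 : (1 : ℝ) ^ 2 / (4 * t) ≤ 1 / 4 := by
    rw [one_pow]; gcongr; linarith
  have h4 : m / 4 ≤ m / 4 * coshDist w w' := le_mul_of_one_le_right (by positivity) hz
  have h5 : -(1 / (4 * t)) * b ^ 2 ≤ -(1 / (4 * T)) * b ^ 2 := by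
    have : 1 / (4 * T) ≤ 1 / (4 * t) := by gcongr
    nlinarith [sq_nonneg b]
  change _ ≤ Real.exp (1 / 4) / (m / 4) ^ a *
    (Real.exp (1 * |b|) * Real.exp (-(1 / (4 * T)) * b ^ 2))
  gcongr

/-- A height ratio of at least 4 forces cosh ρ - 1 ≥ 1/2, and then the scaled integral decays like
t^((n+1)/2), which absorbs the prefactor t^(-n/2). This covers the points that are too high for the
rescaled majorant. -/
theorem exists_norm_hypHeatKernel_le_of_far (n : ℕ) [NeZero n] : ∃ C : ℝ, 0 ≤ C ∧
    ∀ t, 0 < t → t ≤ 1 → ∀ w ∈ hypSpace n, ∀ w' ∈ hypSpace n, 4 * w' (lastIndex n) ≤ w (lastIndex n) →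
      ‖hypHeatKernel n 1 t w w'‖ ≤ C := by
  obtain ⟨C, hC0, hC⟩ := norm_integral_scaledIntegrand_le (a := ((n : ℝ) + 1) / 2) (by positivity)
  have hcn := heatConst_nonneg n
  refine ⟨heatConst n * (C * 2 ^ (((n : ℝ) + 1) / 2)), by positivity,
    fun t ht ht1 w hw w' hw' hfar => ?_⟩
  have hx : 0 < w (lastIndex n) := hw
  have hx' : 0 < w' (lastIndex n) := hw'
  have hs : 0 < √t := Real.sqrt_pos.2 ht
  have hz : 1 / 2 ≤ coshDist w w' - 1 := by
    rw [coshDist, add_sub_cancel_left, le_div_iff₀ (by positivity)]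
    have h1 : |w (lastIndex n) - w' (lastIndex n)| ≤ ‖w - w'‖ := by
      simpa using PiLp.norm_apply_le (w - w') (lastIndex n)
    have h2 : (w (lastIndex n) - w' (lastIndex n)) ^ 2 ≤ ‖w - w'‖ ^ 2 := by
      rw [← sq_abs]; gcongr
    nlinarith
  rw [hypHeatKernel_eq_scaled one_mem_Ioo_two_pi ht ht1 hw hw', norm_mul, norm_mul,
    Complex.norm_real, Complex.norm_real, Real.norm_of_nonneg hcn,
    Real.norm_of_nonneg (by positivity)]
  have h3 : ((coshDist w w' - 1) / t + 1) ^ (-(((n : ℝ) + 1) / 2)) ≤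
      2 ^ (((n : ℝ) + 1) / 2) * √t ^ n := by
    have h4 : 1 / (2 * t) ≤ (coshDist w w' - 1) / t + 1 := by
      have : 1 / 2 / t ≤ (coshDist w w' - 1) / t := by gcongr
      rw [div_div] at this; linarith
    refine (Real.rpow_le_rpow_of_nonpos (by positivity) h4
      (neg_nonpos.2 (by positivity))).trans ?_
    rw [one_div, Real.inv_rpow (by positivity), Real.rpow_neg (by positivity), inv_inv,
      Real.mul_rpow two_pos.le ht.le]
    gcongr
    rw [Real.sqrt_eq_rpow, ← Real.rpow_natCast, ← Real.rpow_mul ht.le]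
    exact Real.rpow_le_rpow_of_exponent_ge ht ht1 (by linarith)
  calc _ ≤ (√t ^ n)⁻¹ * (heatConst n * (C * (2 ^ (((n : ℝ) + 1) / 2) * √t ^ n))) := by
        gcongr
        exact (hC t _ ht ht1 (one_le_coshDist hw hw')).trans (mul_le_mul_of_nonneg_left h3 hC0)
    _ = _ := by field_simp

theorem norm_heatSolution_le_of_kernel_le (hV₀ : ContDiff ℝ ∞ V₀) (hcomp : HasCompactSupport V₀)
    (hsupp : tsupport V₀ ⊆ hypSpace n) {t C : ℝ} (ht : 0 < t)
    {w : EuclideanSpace ℝ (Fin n)} (hw : w ∈ hypSpace n)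
    (hK : ∀ w' ∈ tsupport V₀, ‖hypHeatKernel n 1 t w w'‖ ≤ C) :
    ‖heatSolution V₀ (t, w)‖ ≤ C * ∫ w', ‖weightedData V₀ w'‖ := by
  have hi : Integrable (weightedData V₀) :=
    (contDiff_weightedData hV₀ hsupp).continuous.integrable_of_hasCompactSupport
      (HasCompactSupport.intro hcomp fun w hw => weightedData_eq_zero hw)
  rw [heatSolution_eq_integral hsupp one_mem_Ioo_two_pi ht hw, ← integral_const_mul]
  refine norm_integral_le_of_norm_le (hi.norm.const_mul C) (Filter.Eventually.of_forall fun w' => ?_)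
  rw [norm_mul]
  by_cases hw' : w' ∈ tsupport V₀
  · exact mul_le_mul_of_nonneg_right (hK w' hw') (norm_nonneg _)
  · simp [weightedData_eq_zero hw']

/-- Three regimes, with M a bound for the heights in the support: t ≥ 1; t ≤ 1 with w higher than
4M, where the kernel itself is bounded; and t ≤ 1 with w below 4M, where the rescaled integrand has
a uniform majorant. -/
theorem exists_norm_heatSolution_le (hV₀ : ContDiff ℝ ∞ V₀) (hcomp : HasCompactSupport V₀)
    (hsupp : tsupport V₀ ⊆ hypSpace n) (T : ℝ) : ∃ B : ℝ, ∀ t, 0 < t → t ≤ T →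
      ∀ w ∈ hypSpace n, ‖heatSolution V₀ (t, w)‖ ≤ B := by
  obtain ⟨M, hM1, hM⟩ := exists_coordinate_le hcomp
  obtain ⟨C₁, hC₁, h₁⟩ := exists_norm_rescaledIntegrand_le hV₀ hcomp hsupp (4 * M)
  obtain ⟨C₂, hC₂, h₂⟩ := exists_norm_hypHeatKernel_le_of_far n
  obtain ⟨C₃, hC₃, h₃⟩ := exists_norm_hypHeatKernel_le_of_one_le (n := n) (T := T)
  refine ⟨max (∫ u : EuclideanSpace ℝ (Fin n), C₁ * (1 + ‖u‖ ^ 2) ^ (-(((n : ℝ) + 1) / 2)))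
    (max (C₂ * ∫ w', ‖weightedData V₀ w'‖) (C₃ * ∫ w', ‖weightedData V₀ w'‖)),
    fun t ht htT w hw => ?_⟩
  rcases le_total t 1 with ht1 | ht1
  · rcases le_total (w (lastIndex n)) (4 * M) with hwM | hwM
    · refine le_trans ?_ (le_max_left _ _)
      rw [heatSolution_eq_rescaled hsupp ht ht1 hw]
      exact norm_integral_le_of_norm_le (integrable_one_add_norm_sq_rpow.const_mul _)
        (Filter.Eventually.of_forall fun u => h₁ t w u ht ht1 hw hwM)
    · refine le_trans ?_ ((le_max_left _ _).trans (le_max_right _ _))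
      exact norm_heatSolution_le_of_kernel_le hV₀ hcomp hsupp ht hw fun w' hw' =>
        h₂ t ht ht1 w hw w' (hsupp hw') (by linarith [hM w' hw'])
  · refine le_trans ?_ ((le_max_right _ _).trans (le_max_right _ _))
    exact norm_heatSolution_le_of_kernel_le hV₀ hcomp hsupp ht hw fun w' hw' =>
      h₃ t ht1 htT w hw w' (hsupp hw')

/-! ### The limit at time zero -/

theorem tendsto_add_sqrt_smul {n : ℕ} (w₀ u : EuclideanSpace ℝ (Fin n)) : Filter.Tendsto
      (fun p : ℝ × EuclideanSpace ℝ (Fin n) => p.2 + √p.1 • u)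
      (nhdsWithin 0 (Ioi 0) ×ˢ nhds w₀) (nhds w₀) := by
  have h : Continuous (fun p : ℝ × EuclideanSpace ℝ (Fin n) => p.2 + √p.1 • u) :=
    continuous_snd.add ((Real.continuous_sqrt.comp continuous_fst).smul continuous_const)
  have h1 := h.tendsto (0, w₀)
  simp only [Real.sqrt_zero, zero_smul, add_zero, nhds_prod_eq] at h1
  exact h1.mono_left (Filter.prod_mono nhdsWithin_le_nhds le_rfl)

/-- Dominated convergence in the rescaled integral: for each u the integrand tends to a Gaussian
times the weighted data at w₀. The limit is taken in (t, w) jointly, as continuity up to t = 0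
demands. -/
theorem tendsto_heatSolution_zero (hV₀ : ContDiff ℝ ∞ V₀) (hcomp : HasCompactSupport V₀)
    (hsupp : tsupport V₀ ⊆ hypSpace n) {w₀ : EuclideanSpace ℝ (Fin n)} (hw₀ : w₀ ∈ hypSpace n) :
    Filter.Tendsto (heatSolution V₀) (nhdsWithin 0 (Ioi 0) ×ˢ nhds w₀) (nhds (V₀ w₀)) := by
  set l : Filter (ℝ × EuclideanSpace ℝ (Fin n)) := nhdsWithin 0 (Ioi 0) ×ˢ nhds w₀ with hl
  have hx0 : 0 < w₀ (lastIndex n) := hw₀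
  have hT : Filter.Tendsto (fun p : ℝ × EuclideanSpace ℝ (Fin n) => p.1) l
    (nhdsWithin 0 (Ioi 0)) := Filter.tendsto_fst
  have hW : Filter.Tendsto (fun p : ℝ × EuclideanSpace ℝ (Fin n) => p.2) l (nhds w₀) :=
    Filter.tendsto_snd
  have hcoord : Continuous fun w : EuclideanSpace ℝ (Fin n) => w (lastIndex n) :=
    (contDiff_coordinate (lastIndex n)).continuous
  have ht0 : ∀ᶠ p in l, 0 < p.1 := (tendsto_nhdsWithin_iff.1 hT).2
  have ht1 : ∀ᶠ p in l, p.1 ≤ 1 := (tendsto_nhds_of_tendsto_nhdsWithin hT).eventually_le_const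
    zero_lt_one
  have hwH : ∀ᶠ p in l, p.2 ∈ hypSpace n := hW.eventually (isOpen_hypSpace.mem_nhds hw₀)
  have hwX : ∀ᶠ p in l, p.2 (lastIndex n) ≤ w₀ (lastIndex n) + 1 :=
    ((hcoord.tendsto w₀).comp hW).eventually_le_const (by linarith)
  obtain ⟨C, hC0, hC⟩ := exists_norm_rescaledIntegrand_le hV₀ hcomp hsupp (w₀ (lastIndex n) + 1)
  -- The normalized limit Gaussian has total mass equal to the n-th power of the last coordinate of
  -- w₀, which cancels the volume density in `weightedData`.
  have hlim : ∫ u : EuclideanSpace ℝ (Fin n), (((4 * Real.pi) ^ (-((n : ℝ) / 2)) *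
      Real.exp (-(‖u‖ ^ 2 / (2 * (w₀ (lastIndex n) * w₀ (lastIndex n))) / 2)) : ℝ) : ℂ) *
        weightedData V₀ w₀ = V₀ w₀ := by
    rw [integral_mul_const, integral_complex_ofReal, integral_const_mul]
    have h1 := GaussianFourier.integral_rexp_neg_mul_sq_norm (V := EuclideanSpace ℝ (Fin n))
      (b := 1 / (4 * w₀ (lastIndex n) ^ 2)) (by positivity)
    have h2 : ∀ u : EuclideanSpace ℝ (Fin n),
        -(‖u‖ ^ 2 / (2 * (w₀ (lastIndex n) * w₀ (lastIndex n))) / 2) =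
          -(1 / (4 * w₀ (lastIndex n) ^ 2)) * ‖u‖ ^ 2 := fun u => by field_simp; ring
    simp only [h2]
    rw [h1, finrank_euclideanSpace_fin]
    have h3 : Real.pi / (1 / (4 * w₀ (lastIndex n) ^ 2)) = 4 * Real.pi * w₀ (lastIndex n) ^ 2 := by
      field_simp
    rw [h3, Real.mul_rpow (x := 4 * Real.pi) (by positivity) (by positivity), ← mul_assoc,
      ← Real.rpow_add (by positivity), neg_add_cancel, Real.rpow_zero, one_mul,
      ← Real.rpow_natCast, ← Real.rpow_mul hx0.le, weightedData]
    have h4 : ((2 : ℕ) : ℝ) * ((n : ℝ) / 2) = n := by push_cast; ring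
    rw [h4, Real.rpow_natCast, mul_left_comm, ← Complex.ofReal_mul,
      mul_one_div_cancel (pow_ne_zero n hx0.ne')]
    simp
  have hmain : Filter.Tendsto (fun p => ∫ u, rescaledIntegrand V₀ p u) l (nhds (V₀ w₀)) := by
    rw [← hlim]
    refine tendsto_integral_filter_of_dominated_convergence
      (fun u => C * (1 + ‖u‖ ^ 2) ^ (-(((n : ℝ) + 1) / 2))) ?_ ?_
      (integrable_one_add_norm_sq_rpow.const_mul _) ?_
    · filter_upwards [ht0, ht1, hwH] with p h0 h1 h2
      have : rescaledIntegrand V₀ p = fun u => ((√p.1 ^ n : ℝ) : ℂ) *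
          ((-Complex.I * (heatConst n : ℂ)) * heatIntegrand V₀ (p.1, p.2) (p.2 + √p.1 • u)) :=
        funext fun u => rescaledIntegrand_eq hsupp h0 h1 h2 u
      rw [this]
      refine Continuous.aestronglyMeasurable (continuous_const.mul (continuous_const.mul ?_))
      exact (contDiffOn_heatIntegrand hV₀ hsupp).continuousOn.comp_continuous
        (f := fun u => ((p.1, p.2), p.2 + √p.1 • u)) (by fun_prop)
        fun u => ⟨⟨h0, h2⟩, mem_univ _⟩
    · filter_upwards [ht0, ht1, hwH, hwX] with p h0 h1 h2 h3
      exact Filter.Eventually.of_forall fun u => hC p.1 p.2 u h0 h1 h2 h3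
    · refine Filter.Eventually.of_forall fun u => ?_
      have hu := tendsto_add_sqrt_smul w₀ u
      have hr : 0 ≤ ‖u‖ ^ 2 / (2 * (w₀ (lastIndex n) * w₀ (lastIndex n))) := by positivity
      rw [← heatConst_mul_integral_euclideanIntegrand n hr]
      refine Filter.Tendsto.mul (Filter.Tendsto.const_mul _ ?_)
        (((contDiff_weightedData hV₀ hsupp).continuous.tendsto w₀).comp hu)
      refine tendsto_integral_scaledIntegrand (by positivity) hr hT ?_ ?_
      · filter_upwards [hwH, hu.eventually (isOpen_hypSpace.mem_nhds hw₀)] with p h1 h2 using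
          one_le_coshDist h1 h2
      · have : Filter.Tendsto (fun p : ℝ × EuclideanSpace ℝ (Fin n) => ‖u‖ ^ 2 /
            (2 * (p.2 (lastIndex n) * (p.2 + √p.1 • u) (lastIndex n)))) l
            (nhds (‖u‖ ^ 2 / (2 * (w₀ (lastIndex n) * w₀ (lastIndex n))))) :=
          tendsto_const_nhds.div (((hcoord.tendsto w₀).comp hW).mul
            ((hcoord.tendsto w₀).comp hu) |>.const_mul 2) (by positivity)
        refine this.congr' ?_
        filter_upwards [ht0] with p h0 using (coshDist_add_sqrt_smul h0 _ _).symm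
  refine hmain.congr' ?_
  filter_upwards [ht0, ht1, hwH] with p h0 h1 h2 using (heatSolution_eq_rescaled hsupp h0 h1 h2).symm

/-- The solution of the Cauchy problem. -/
noncomputable def cauchySolution (V₀ : EuclideanSpace ℝ (Fin n) → ℂ) (t : ℝ)
    (w : EuclideanSpace ℝ (Fin n)) : ℂ :=
  if t ≤ 0 then V₀ w else heatSolution V₀ (t, w)

theorem cauchySolution_of_pos {t : ℝ} (ht : 0 < t) : cauchySolution V₀ t =
    fun w => heatSolution V₀ (t, w) :=
  funext fun _ => if_neg ht.not_ge

theorem continuousOn_cauchySolution (hV₀ : ContDiff ℝ ∞ V₀) (hcomp : HasCompactSupport V₀)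
    (hsupp : tsupport V₀ ⊆ hypSpace n) :
    ContinuousOn (fun p : ℝ × EuclideanSpace ℝ (Fin n) => cauchySolution V₀ p.1 p.2)
      (Ici 0 ×ˢ hypSpace n) := by
  rintro ⟨t, w⟩ ⟨ht, hw⟩
  rcases (show 0 ≤ t from ht).eq_or_lt with rfl | ht
  · have h1 : Filter.Tendsto (fun p : ℝ × EuclideanSpace ℝ (Fin n) => cauchySolution V₀ p.1 p.2)
        (nhdsWithin 0 (Ioi 0) ×ˢ nhds w) (nhds (V₀ w)) := by
      refine (tendsto_heatSolution_zero hV₀ hcomp hsupp hw).congr' ?_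
      filter_upwards [Filter.tendsto_fst.eventually self_mem_nhdsWithin] with p hp
      rw [cauchySolution_of_pos hp]
    have h2 : Filter.Tendsto (fun p : ℝ × EuclideanSpace ℝ (Fin n) => cauchySolution V₀ p.1 p.2)
        (pure 0 ×ˢ nhds w) (nhds (V₀ w)) := by
      refine ((hV₀.continuous.tendsto w).comp Filter.tendsto_snd).congr' ?_
      filter_upwards [Filter.tendsto_fst.eventually (Filter.mem_pure.2 (mem_singleton (0 : ℝ)))]
        with p hp
      simp [cauchySolution, mem_singleton_iff.1 hp]
    -- Near time zero either t > 0, where the limit was just computed, or t = 0, where the function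
    -- is V₀ itself.
    have h3 : nhdsWithin ((0 : ℝ), w) (Ici 0 ×ˢ hypSpace n) ≤
        (nhdsWithin 0 (Ioi 0) ×ˢ nhds w) ⊔ (pure 0 ×ˢ nhds w) := by
      rw [nhdsWithin_prod_eq, ← Filter.sup_prod]
      refine Filter.prod_mono ?_ nhdsWithin_le_nhds
      rw [← Ioi_insert, nhdsWithin_insert, sup_comm]
    have h4 : cauchySolution V₀ 0 w = V₀ w := by simp [cauchySolution]
    rw [ContinuousWithinAt, h4]
    exact (h1.sup h2).mono_left h3
  · have hp : (t, w) ∈ Ioi (0 : ℝ) ×ˢ hypSpace n := ⟨ht, hw⟩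
    have h1 := (contDiffOn_heatSolution hV₀ hcomp hsupp).continuousOn.continuousAt
      (isOpen_Ioi_prod_hypSpace.mem_nhds hp)
    refine (h1.congr ?_).continuousWithinAt
    filter_upwards [isOpen_Ioi_prod_hypSpace.mem_nhds hp] with p hp
    rw [cauchySolution_of_pos hp.1]

end

section

/-! ### The growth condition -/

variable {n : ℕ} [NeZero n]

theorem hypOrigin_mem : hypOrigin n ∈ hypSpace n := by simp [hypOrigin, hypSpace]

theorem coshDist_hypOrigin (w : EuclideanSpace ℝ (Fin n)) :
    coshDist w (hypOrigin n) = 1 + ‖w - hypOrigin n‖ ^ 2 / (2 * w (lastIndex n)) := by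
  rw [coshDist]; simp [hypOrigin]

theorem coshDist_comm (w w' : EuclideanSpace ℝ (Fin n)) : coshDist w w' = coshDist w' w := by
  rw [coshDist, coshDist, norm_sub_rev, mul_comm (w (lastIndex n))]

/-- With x the last coordinate, (x - 1)² ≤ |w - w₀|² ≤ 2(S - 1)x gives x² + 1 ≤ 2Sx, from which all
three bounds follow. -/
theorem coordinate_bounds_of_coshDist_le {w : EuclideanSpace ℝ (Fin n)} (hw : w ∈ hypSpace n)
    {S : ℝ} (hS : coshDist w (hypOrigin n) ≤ S) :
    w (lastIndex n) ≤ 2 * S ∧ 1 / (2 * S) ≤ w (lastIndex n) ∧ ‖w - hypOrigin n‖ ≤ 2 * S := by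
  have hx : 0 < w (lastIndex n) := hw
  have h1 : |w (lastIndex n) - 1| ≤ ‖w - hypOrigin n‖ := by
    simpa [hypOrigin] using PiLp.norm_apply_le (w - hypOrigin n) (lastIndex n)
  have h2 : (w (lastIndex n) - 1) ^ 2 ≤ ‖w - hypOrigin n‖ ^ 2 := by
    rw [← sq_abs]; gcongr
  rw [coshDist_hypOrigin] at hS
  have hS1 : 1 ≤ S := le_trans (le_add_of_nonneg_right (by positivity)) hS
  have h3 : ‖w - hypOrigin n‖ ^ 2 ≤ (S - 1) * (2 * w (lastIndex n)) := by
    rw [← div_le_iff₀ (by positivity)]; linarith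
  have h4 : w (lastIndex n) ≤ 2 * S := by nlinarith
  refine ⟨h4, ?_, ?_⟩
  · rw [div_le_iff₀ (by positivity)]; nlinarith
  · refine abs_le_of_sq_le_sq' ?_ (by positivity) |>.2
    nlinarith

theorem hypMeasure_apply_le {s k : Set (EuclideanSpace ℝ (Fin n))} (hk : MeasurableSet k)
    (hsk : s ∩ hypSpace n ⊆ k) {c : ℝ} (hc : ∀ w ∈ k, 1 / w (lastIndex n) ^ n ≤ c) :
    hypMeasure n s ≤ ENNReal.ofReal c * volume k := by
  rw [hypMeasure, withDensity_apply', Measure.restrict_restrict' isOpen_hypSpace.measurableSet]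
  refine (lintegral_mono_set hsk).trans ?_
  refine (setLIntegral_mono' hk fun w hw => ENNReal.ofReal_le_ofReal (hc w hw)).trans ?_
  rw [setLIntegral_const]

theorem ae_hypMeasure_mem : ∀ᵐ w ∂hypMeasure n, w ∈ hypSpace n :=
  (withDensity_absolutelyContinuous _ _).ae_le (ae_restrict_mem isOpen_hypSpace.measurableSet)

/-- A crude count suffices. With S = exp R the ball lies in a Euclidean ball of radius 2S at heights
at least 1/(2S), so both its Euclidean volume and the density are O(Sⁿ), and exp(2nR) ≤ exp(n +
nR²). -/
theorem exists_hypMeasure_ball_le (n : ℕ) [NeZero n] : ∃ A a : ℝ, 0 ≤ A ∧ ∀ R > 0,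
    hypMeasure n {w | hypDist (hypOrigin n) w < R} ≤ ENNReal.ofReal (A * Real.exp (a * R ^ 2)) := by
  set v : ℝ := (volume (Metric.closedBall (0 : EuclideanSpace ℝ (Fin n)) 1)).toReal with hv
  refine ⟨4 ^ n * v * Real.exp n, n, by positivity, fun R hR => ?_⟩
  set S := Real.exp R with hS
  have hS0 : 0 < S := Real.exp_pos R
  have hsub : {w | hypDist (hypOrigin n) w < R} ∩ hypSpace n ⊆
      Metric.closedBall (hypOrigin n) (2 * S) ∩ {w | 1 / (2 * S) ≤ w (lastIndex n)} := by
    rintro w ⟨hw1, hw⟩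
    have h1 : coshDist w (hypOrigin n) ≤ S := by
      rw [coshDist_comm, ← cosh_hypDist hypOrigin_mem hw]
      refine (cosh_le_exp_abs _).trans ?_
      rw [abs_of_nonneg (hypDist_nonneg _ _)]
      exact Real.exp_le_exp.2 (le_of_lt hw1)
    obtain ⟨-, h2, h3⟩ := coordinate_bounds_of_coshDist_le hw h1
    exact ⟨by rwa [Metric.mem_closedBall, dist_eq_norm], h2⟩
  have hmeas : MeasurableSet (Metric.closedBall (hypOrigin n) (2 * S) ∩
      {w : EuclideanSpace ℝ (Fin n) | 1 / (2 * S) ≤ w (lastIndex n)}) :=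
    Metric.isClosed_closedBall.measurableSet.inter (isClosed_le continuous_const
      (contDiff_coordinate (lastIndex n)).continuous).measurableSet
  refine (hypMeasure_apply_le (c := (2 * S) ^ n) hmeas hsub fun w hw => ?_).trans ?_
  · have h1 : 1 / (2 * S) ≤ w (lastIndex n) := hw.2
    have h2 : (1 / (2 * S)) ^ n ≤ w (lastIndex n) ^ n := by gcongr
    rw [one_div, inv_pow] at h2
    rw [one_div]
    exact inv_le_of_inv_le₀ (by positivity) h2
  · have h1 : volume (Metric.closedBall (hypOrigin n) (2 * S) ∩
        {w : EuclideanSpace ℝ (Fin n) | 1 / (2 * S) ≤ w (lastIndex n)}) ≤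
        ENNReal.ofReal ((2 * S) ^ n * v) := by
      refine (measure_mono inter_subset_left).trans (le_of_eq ?_)
      rw [Measure.addHaar_closedBall' _ _ (by positivity), finrank_euclideanSpace_fin,
        ENNReal.ofReal_mul (by positivity), hv,
        ENNReal.ofReal_toReal (isCompact_closedBall _ _).measure_ne_top]
    calc _ ≤ ENNReal.ofReal ((2 * S) ^ n) * ENNReal.ofReal ((2 * S) ^ n * v) := by gcongr
      _ = ENNReal.ofReal ((2 * S) ^ n * ((2 * S) ^ n * v)) :=
        (ENNReal.ofReal_mul (by positivity)).symm
      _ ≤ _ := by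
        refine ENNReal.ofReal_le_ofReal ?_
        have h2 : S ^ n * S ^ n ≤ Real.exp n * Real.exp (n * R ^ 2) := by
          rw [hS, ← Real.exp_nat_mul, ← Real.exp_add, ← Real.exp_add]
          refine Real.exp_le_exp.2 ?_
          have : (0 : ℝ) ≤ n := n.cast_nonneg
          nlinarith [sq_nonneg (R - 1)]
        calc _ = 4 ^ n * v * (S ^ n * S ^ n) := by
              rw [mul_pow, show (4 : ℝ) = 2 * 2 by norm_num, mul_pow (2 : ℝ) 2]; ring
          _ ≤ 4 ^ n * v * (Real.exp n * Real.exp (n * R ^ 2)) := by gcongr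
          _ = _ := by ring

theorem enorm_sub_sq_le {x y : ℂ} {B : ℝ} (hy : ‖y‖ ≤ B) :
    ‖x - y‖ₑ ^ 2 ≤ 2 * ‖x‖ₑ ^ 2 + ENNReal.ofReal (2 * B ^ 2) := by
  have h1 : ‖x - y‖ ^ 2 ≤ 2 * ‖x‖ ^ 2 + 2 * B ^ 2 := by
    have h2 := norm_sub_le x y
    have h3 := norm_nonneg (x - y)
    have h4 := norm_nonneg y
    nlinarith [sq_nonneg (‖x‖ - B)]
  have h5 : (2 : ENNReal) = ENNReal.ofReal 2 := by simp
  rw [← ofReal_norm, ← ofReal_norm, ← ENNReal.ofReal_pow (norm_nonneg _),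
    ← ENNReal.ofReal_pow (norm_nonneg _), h5, ← ENNReal.ofReal_mul two_pos.le,
    ← ENNReal.ofReal_add (by positivity) (by positivity)]
  exact ENNReal.ofReal_le_ofReal h1

/-- The volume bound for balls puts bounded functions into the growth class, and |x - y|² ≤ 2|x|² +
2|y|² handles the difference. With V' = 0 it serves existence, in general uniqueness. -/
theorem HasGaussianGrowth.sub_of_bounded {V V' : ℝ → EuclideanSpace ℝ (Fin n) → ℂ}
    (hV' : HasGaussianGrowth n V') (hV : ∀ T, ∃ B, ∀ t, 0 < t → t ≤ T →
      ∀ w ∈ hypSpace n, ‖V t w‖ ≤ B) :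
    HasGaussianGrowth n fun t w => V' t w - V t w := by
  intro T hT
  obtain ⟨B, hB⟩ := hV T
  obtain ⟨A₁, a₁, h₁⟩ := hV' T hT
  obtain ⟨A₂, a₂, hA₂, h₂⟩ := exists_hypMeasure_ball_le n
  refine ⟨2 * |A₁| + 2 * B ^ 2 * A₂ * T, max a₁ a₂, fun R hR => ?_⟩
  set D : Set (EuclideanSpace ℝ (Fin n)) := {w | hypDist (hypOrigin n) w < R} with hD
  have h3 : ∀ t ∈ Ioo 0 T, ∫⁻ w in D, ‖V' t w - V t w‖ₑ ^ 2 ∂hypMeasure n ≤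
      2 * (∫⁻ w in D, ‖V' t w‖ₑ ^ 2 ∂hypMeasure n) +
        ENNReal.ofReal (2 * B ^ 2) * ENNReal.ofReal (A₂ * Real.exp (a₂ * R ^ 2)) := by
    intro t ht
    calc _ ≤ ∫⁻ w in D, (2 * ‖V' t w‖ₑ ^ 2 + ENNReal.ofReal (2 * B ^ 2)) ∂hypMeasure n := by
          refine lintegral_mono_ae (ae_restrict_of_ae ?_)
          filter_upwards [ae_hypMeasure_mem] with w hw
          exact enorm_sub_sq_le (hB t ht.1 ht.2.le w hw)
      _ = 2 * (∫⁻ w in D, ‖V' t w‖ₑ ^ 2 ∂hypMeasure n) +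
          ENNReal.ofReal (2 * B ^ 2) * hypMeasure n D := by
          -- Only the constant summand has to be measurable; nothing is assumed about the
          -- measurability of V'.
          rw [lintegral_add_right _ measurable_const, lintegral_const_mul' _ _ (by simp),
            setLIntegral_const]
      _ ≤ _ := by gcongr; exact h₂ R hR
  have h4 : A₁ * Real.exp (a₁ * R ^ 2) ≤ |A₁| * Real.exp (max a₁ a₂ * R ^ 2) := by
    gcongr
    · exact le_abs_self A₁
    · exact le_max_left _ _
  have h5 : A₂ * Real.exp (a₂ * R ^ 2) ≤ A₂ * Real.exp (max a₁ a₂ * R ^ 2) := by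
    gcongr
    exact le_max_right _ _
  have h6 : (2 : ENNReal) = ENNReal.ofReal 2 := by simp
  calc _ ≤ ∫⁻ t in Ioo 0 T, (2 * (∫⁻ w in D, ‖V' t w‖ₑ ^ 2 ∂hypMeasure n) +
        ENNReal.ofReal (2 * B ^ 2) * ENNReal.ofReal (A₂ * Real.exp (a₂ * R ^ 2))) :=
        setLIntegral_mono' measurableSet_Ioo h3
    _ = 2 * (∫⁻ t in Ioo 0 T, ∫⁻ w in D, ‖V' t w‖ₑ ^ 2 ∂hypMeasure n) +
        ENNReal.ofReal (2 * B ^ 2) * ENNReal.ofReal (A₂ * Real.exp (a₂ * R ^ 2)) *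
          ENNReal.ofReal T := by
        rw [lintegral_add_right _ measurable_const, lintegral_const_mul' _ _ (by simp),
          setLIntegral_const, Real.volume_Ioo, sub_zero]
    _ ≤ ENNReal.ofReal 2 * ENNReal.ofReal (|A₁| * Real.exp (max a₁ a₂ * R ^ 2)) +
        ENNReal.ofReal (2 * B ^ 2) * ENNReal.ofReal (A₂ * Real.exp (max a₁ a₂ * R ^ 2)) *
          ENNReal.ofReal T := by
        refine add_le_add (mul_le_mul' h6.le ((h₁ R hR).trans (ENNReal.ofReal_le_ofReal h4))) ?_
        gcongr
    _ = _ := by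
        rw [← ENNReal.ofReal_mul two_pos.le, ← ENNReal.ofReal_mul (by positivity),
          ← ENNReal.ofReal_mul (by positivity), ← ENNReal.ofReal_add (by positivity)
          (by positivity)]
        congr 1; ring

theorem hasGaussianGrowth_of_bounded {V : ℝ → EuclideanSpace ℝ (Fin n) → ℂ}
    (hV : ∀ T, ∃ B, ∀ t, 0 < t → t ≤ T → ∀ w ∈ hypSpace n, ‖V t w‖ ≤ B) :
    HasGaussianGrowth n V := by
  have h0 : HasGaussianGrowth n fun _ _ => 0 := fun T _ => ⟨0, 0, fun R _ => by simp⟩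
  simpa [HasGaussianGrowth] using h0.sub_of_bounded hV

theorem exists_norm_cauchySolution_le {V₀ : EuclideanSpace ℝ (Fin n) → ℂ} (hV₀ : ContDiff ℝ ∞ V₀)
    (hcomp : HasCompactSupport V₀) (hsupp : tsupport V₀ ⊆ hypSpace n) (T : ℝ) :
    ∃ B, ∀ t, 0 < t → t ≤ T → ∀ w ∈ hypSpace n, ‖cauchySolution V₀ t w‖ ≤ B := by
  obtain ⟨B, hB⟩ := exists_norm_heatSolution_le hV₀ hcomp hsupp T
  exact ⟨B, fun t ht htT w hw => by rw [cauchySolution_of_pos ht]; exact hB t ht htT w hw⟩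

/-! ### The representation formula -/

theorem integrable_hypMeasure_iff {f : EuclideanSpace ℝ (Fin n) → ℂ} :
    Integrable f (hypMeasure n) ↔ IntegrableOn
      (fun w => ((1 / w (lastIndex n) ^ n : ℝ) : ℂ) * f w) (hypSpace n) := by
  have hm : Measurable fun w : EuclideanSpace ℝ (Fin n) =>
      (1 / w (lastIndex n) ^ n).toNNReal :=
    ((contDiff_coordinate (lastIndex n)).continuous.measurable.pow_const n |>.const_div 1).real_toNNReal
  have h := integrable_withDensity_iff_integrable_smul (μ := volume.restrict (hypSpace n))
    (E := ℂ) (g := f) hm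
  refine h.trans (integrable_congr ?_)
  filter_upwards [ae_restrict_mem isOpen_hypSpace.measurableSet] with w hw
  have hx : 0 < w (lastIndex n) := hw
  simp only [NNReal.smul_def, Complex.real_smul]
  rw [Real.coe_toNNReal _ (by positivity)]

theorem integral_hypMeasure (f : EuclideanSpace ℝ (Fin n) → ℂ) :
    ∫ w, f w ∂hypMeasure n = ∫ w in hypSpace n, ((1 / w (lastIndex n) ^ n : ℝ) : ℂ) * f w := by
  have hm : Measurable fun w : EuclideanSpace ℝ (Fin n) =>
      (1 / w (lastIndex n) ^ n).toNNReal :=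
    ((contDiff_coordinate (lastIndex n)).continuous.measurable.pow_const n |>.const_div 1).real_toNNReal
  have h := integral_withDensity_eq_integral_smul (μ := volume.restrict (hypSpace n)) hm f
  refine h.trans (integral_congr_ae ?_)
  filter_upwards [ae_restrict_mem isOpen_hypSpace.measurableSet] with w hw
  have hx : 0 < w (lastIndex n) := hw
  simp only [NNReal.smul_def, Complex.real_smul]
  rw [Real.coe_toNNReal _ (by positivity)]

theorem integrable_hypHeatKernel_mul {V₀ : EuclideanSpace ℝ (Fin n) → ℂ} (hV₀ : ContDiff ℝ ∞ V₀)
    (hcomp : HasCompactSupport V₀) (hsupp : tsupport V₀ ⊆ hypSpace n) {σ t : ℝ}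
    (hσ : σ ∈ Ioo 0 (2 * Real.pi)) (ht : 0 < t) {w : EuclideanSpace ℝ (Fin n)}
    (hw : w ∈ hypSpace n) :
    Integrable (fun w' => hypHeatKernel n σ t w w' * V₀ w') (hypMeasure n) := by
  rw [integrable_hypMeasure_iff]
  have h1 : Integrable (fun w' => hypHeatKernel n σ t w w' * weightedData V₀ w') := by
    simp only [← mul_heatIntegrand hsupp hσ ht hw]
    exact (integrable_of_contDiffOn hcomp (fun p _ x hx => heatIntegrand_eq_zero p hx)
      (contDiffOn_heatIntegrand hV₀ hsupp) (⟨ht, hw⟩ : (t, w) ∈ Ioi 0 ×ˢ hypSpace n)).const_mul _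
  refine h1.integrableOn.congr_fun (fun w' _ => ?_) isOpen_hypSpace.measurableSet
  simp only [weightedData]; ring

theorem heatSolution_eq_integral_hypMeasure {V₀ : EuclideanSpace ℝ (Fin n) → ℂ}
    (hsupp : tsupport V₀ ⊆ hypSpace n) {σ t : ℝ} (hσ : σ ∈ Ioo 0 (2 * Real.pi)) (ht : 0 < t)
    {w : EuclideanSpace ℝ (Fin n)} (hw : w ∈ hypSpace n) :
    heatSolution V₀ (t, w) = ∫ w', hypHeatKernel n σ t w w' * V₀ w' ∂hypMeasure n := by
  rw [heatSolution_eq_integral hsupp hσ ht hw, integral_hypMeasure,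
    ← setIntegral_eq_integral_of_forall_compl_eq_zero (s := hypSpace n)]
  · congr 1; ext w'; simp only [weightedData]; ring
  · intro w' hw'
    rw [weightedData_eq_zero fun h => hw' (hsupp h), mul_zero]

/-! ### The solution property -/

theorem fderiv_slice_eq_comp {F : Type*} [NormedAddCommGroup F] [NormedSpace ℝ F]
    {f : ℝ × EuclideanSpace ℝ (Fin n) → F} (hf : ContDiffOn ℝ ∞ f (Ioi 0 ×ˢ hypSpace n))
    {p : ℝ × EuclideanSpace ℝ (Fin n)} (hp : p ∈ Ioi 0 ×ˢ hypSpace n) :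
    fderiv ℝ (fun w => f (p.1, w)) p.2 =
      (fderiv ℝ f p).comp (ContinuousLinearMap.inr ℝ ℝ (EuclideanSpace ℝ (Fin n))) :=
  ((hf.differentiableAt_of_isOpen isOpen_Ioi_prod_hypSpace hp).hasFDerivAt.comp p.2
    (hasFDerivAt_prodMk_right p.1 p.2)).fderiv

theorem contDiffOn_fderiv_comp_inr {F : Type*} [NormedAddCommGroup F] [NormedSpace ℝ F]
    {f : ℝ × EuclideanSpace ℝ (Fin n) → F} (hf : ContDiffOn ℝ ∞ f (Ioi 0 ×ˢ hypSpace n)) :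
    ContDiffOn ℝ ∞ (fun p => (fderiv ℝ f p).comp
      (ContinuousLinearMap.inr ℝ ℝ (EuclideanSpace ℝ (Fin n)))) (Ioi 0 ×ˢ hypSpace n) :=
  ((contDiffOn_infty_iff_fderiv_of_isOpen isOpen_Ioi_prod_hypSpace).1 hf).2.clm_comp
    contDiffOn_const

theorem isHypHeatSolution_cauchySolution {V₀ : EuclideanSpace ℝ (Fin n) → ℂ}
    (hV₀ : ContDiff ℝ ∞ V₀) (hcomp : HasCompactSupport V₀) (hsupp : tsupport V₀ ⊆ hypSpace n) :
    IsHypHeatSolution n V₀ (cauchySolution V₀) := by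
  have hF := contDiffOn_heatSolution hV₀ hcomp hsupp
  have hO := isOpen_Ioi_prod_hypSpace (n := n)
  have htime : ∀ t > 0, ∀ w, (fun s => cauchySolution V₀ s w) =ᶠ[nhds t]
      fun s => heatSolution V₀ (s, w) := fun t ht w => by
    filter_upwards [Ioi_mem_nhds ht] with s hs
    rw [cauchySolution_of_pos hs]
  have hderiv := fun (t : ℝ) (ht : 0 < t) (w) (hw : w ∈ hypSpace n) =>
    deriv_slice_left (hF.differentiableAt_of_isOpen hO (⟨ht, hw⟩ : (t, w) ∈ Ioi 0 ×ˢ hypSpace n))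
  have hspace : ∀ p ∈ Ioi (0 : ℝ) ×ˢ hypSpace n, fderiv ℝ (cauchySolution V₀ p.1) p.2 =
      (fderiv ℝ (heatSolution V₀) p).comp (ContinuousLinearMap.inr ℝ ℝ _) := fun p hp => by
    rw [cauchySolution_of_pos hp.1, fderiv_slice_eq_comp hF hp]
  refine ⟨continuousOn_cauchySolution hV₀ hcomp hsupp, ?_, ?_, ?_, ?_, ?_, ?_, ?_⟩
  · exact fun t ht w hw => ((htime t ht w).differentiableAt_iff).2 (hderiv t ht w hw).differentiableAt
  · refine (contDiffOn_fderiv_apply hF (1, 0)).continuousOn.congr fun p hp => ?_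
    rw [(htime p.1 hp.1 p.2).deriv_eq, (hderiv p.1 hp.1 p.2 hp.2).deriv]
  · intro t ht
    rw [cauchySolution_of_pos ht]
    exact (contDiffOn_slice hF ht).of_le two_le_infty
  · exact (contDiffOn_fderiv_comp_inr hF).continuousOn.congr hspace
  · refine (contDiffOn_fderiv_comp_inr (contDiffOn_fderiv_comp_inr hF)).continuousOn.congr
      fun p hp => ?_
    refine Eq.trans (Filter.EventuallyEq.fderiv_eq ?_)
      (fderiv_slice_eq_comp (contDiffOn_fderiv_comp_inr hF) hp)
    filter_upwards [isOpen_hypSpace.mem_nhds hp.2] with w hw using hspace (p.1, w) ⟨hp.1, hw⟩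
  · intro t ht w hw
    rw [(htime t ht w).deriv_eq, cauchySolution_of_pos ht]
    exact hypLaplacian_heatSolution hV₀ hcomp hsupp ht hw
  · intro w _
    simp [cauchySolution]

end

section

/-! ### Integrals over compact sets -/

section CompactIntegral

variable {E : Type*} [NormedAddCommGroup E] [NormedSpace ℝ E] [MeasurableSpace E] [BorelSpace E]
  {μ : Measure E} [IsFiniteMeasureOnCompacts μ] {K : Set E}

theorem ContinuousOn.curry_left {X Y Z : Type*} [TopologicalSpace X] [TopologicalSpace Y]
    [TopologicalSpace Z] {f : X → Y → Z} {s : Set X} {K : Set Y}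
    (hf : ContinuousOn (fun p : X × Y => f p.1 p.2) (s ×ˢ K)) {x : X} (hx : x ∈ s) :
    ContinuousOn (f x) K :=
  hf.comp (f := fun y => (x, y)) (by fun_prop) fun _ hy => ⟨hx, hy⟩

theorem ContinuousOn.curry_right {X Y Z : Type*} [TopologicalSpace X] [TopologicalSpace Y]
    [TopologicalSpace Z] {f : X → Y → Z} {s : Set X} {K : Set Y}
    (hf : ContinuousOn (fun p : X × Y => f p.1 p.2) (s ×ˢ K)) {y : Y} (hy : y ∈ K) :
    ContinuousOn (fun x => f x y) s :=
  hf.comp (f := fun x => (x, y)) (by fun_prop) fun _ hx => ⟨hx, hy⟩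

theorem continuousOn_setIntegral_of_isCompact (hK : IsCompact K) {a b : ℝ} {f : ℝ → E → ℝ}
    (hf : ContinuousOn (fun p : ℝ × E => f p.1 p.2) (Icc a b ×ˢ K)) :
    ContinuousOn (fun t => ∫ w in K, f t w ∂μ) (Icc a b) := by
  obtain ⟨C, hC⟩ := (isCompact_Icc.prod hK).exists_bound_of_continuousOn hf
  refine continuousOn_of_dominated (bound := fun _ => C) (fun t ht => ?_) (fun t ht => ?_)
    (integrableOn_const hK.measure_ne_top) ?_
  · exact (hf.curry_left ht).aestronglyMeasurable_of_isCompact hK hK.measurableSet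
  · filter_upwards [ae_restrict_mem hK.measurableSet] with w hw using hC (t, w) ⟨ht, hw⟩
  · filter_upwards [ae_restrict_mem hK.measurableSet] with w hw using hf.curry_right hw

theorem hasDerivAt_setIntegral_of_isCompact (hK : IsCompact K) {U : Set ℝ} (hU : IsOpen U)
    {f f' : ℝ → E → ℝ} (hf : ContinuousOn (fun p : ℝ × E => f p.1 p.2) (U ×ˢ K))
    (hf' : ContinuousOn (fun p : ℝ × E => f' p.1 p.2) (U ×ˢ K))
    (hd : ∀ t ∈ U, ∀ w ∈ K, HasDerivAt (fun s => f s w) (f' t w) t) {t : ℝ} (ht : t ∈ U) :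
    HasDerivAt (fun t => ∫ w in K, f t w ∂μ) (∫ w in K, f' t w ∂μ) t := by
  obtain ⟨ε, hε, hεU⟩ := Metric.nhds_basis_closedBall.mem_iff.1 (hU.mem_nhds ht)
  obtain ⟨C, hC⟩ := ((isCompact_closedBall t ε).prod hK).exists_bound_of_continuousOn
    (hf'.mono (prod_mono hεU Subset.rfl))
  refine (hasDerivAt_integral_of_dominated_loc_of_deriv_le (bound := fun _ => C)
    (Metric.closedBall_mem_nhds t hε) ?_ ((hf.curry_left ht).integrableOn_compact hK) ?_ ?_
    (integrableOn_const hK.measure_ne_top) ?_).2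
  · filter_upwards [hU.mem_nhds ht] with s hs
    exact (hf.curry_left hs).aestronglyMeasurable_of_isCompact hK hK.measurableSet
  · exact (hf'.curry_left ht).aestronglyMeasurable_of_isCompact hK hK.measurableSet
  · filter_upwards [ae_restrict_mem hK.measurableSet] with w hw s hs using hC (s, w) ⟨hs, hw⟩
  · filter_upwards [ae_restrict_mem hK.measurableSet] with w hw s hs using hd s (hεU hs) w hw

/-- Integration by parts against the constant 1, whose derivative is 0. The divergence theorem for
the energy flux reduces to this, one direction at a time. -/
theorem setIntegral_lineDeriv_eq_zero [FiniteDimensional ℝ E] {μ : Measure E} [μ.IsAddHaarMeasure]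
    (hK : IsCompact K) {g g' : E → ℝ} {v : E} (hg : ContinuousOn g K) (hg' : ContinuousOn g' K)
    (h0 : ∀ w ∉ K, g w = 0) (h0' : ∀ w ∉ K, g' w = 0)
    (hd : ∀ w, HasLineDerivAt ℝ g (g' w) w v) : ∫ w in K, g' w ∂μ = 0 := by
  have hi : ∀ {f : E → ℝ}, ContinuousOn f K → (∀ w ∉ K, f w = 0) → Integrable f μ := fun hf h =>
    (integrableOn_iff_integrable_of_support_subset fun w hw => by
      by_contra hwK; exact hw (h w hwK)).1 (hf.integrableOn_compact hK)
  have h1 := integral_bilinear_hasLineDerivAt_right_eq_neg_left_of_integrable (μ := μ)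
    (f := fun _ => (1 : ℝ)) (f' := fun _ => 0) (g := g) (g' := g') (v := v)
    (B := ContinuousLinearMap.mul ℝ ℝ) (by simp) (by simpa using hi hg' h0')
    (by simpa using hi hg h0) (fun w _ => hasDerivAt_const _ _) (fun w _ => hd w)
  rw [setIntegral_eq_integral_of_forall_compl_eq_zero h0']
  simpa using h1

end CompactIntegral

/-! ### The weight of the energy estimate -/

theorem exists_abs_deriv_smoothTransition_le :
    ∃ C : ℝ, 0 ≤ C ∧ ∀ x, |deriv Real.smoothTransition x| ≤ C := by
  have hc : Continuous (deriv Real.smoothTransition) :=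
    (Real.smoothTransition.contDiff (n := 1)).continuous_deriv le_rfl
  obtain ⟨C, hC⟩ := (isCompact_Icc (a := (0 : ℝ)) (b := 1)).exists_bound_of_continuousOn
    hc.continuousOn
  refine ⟨max C 0, le_max_right _ _, fun x => ?_⟩
  by_cases hx : x ∈ Icc (0 : ℝ) 1
  · exact (hC x hx).trans (le_max_left _ _)
  · have : deriv Real.smoothTransition x = 0 := by
      rcases not_and_or.1 hx with h | h
      · have : Real.smoothTransition =ᶠ[nhds x] fun _ => 0 := by
          filter_upwards [Iio_mem_nhds (not_le.1 h)] with y hy using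
            Real.smoothTransition.zero_of_nonpos (le_of_lt hy)
        rw [this.deriv_eq, deriv_const]
      · have : Real.smoothTransition =ᶠ[nhds x] fun _ => 1 := by
          filter_upwards [Ioi_mem_nhds (not_le.1 h)] with y hy using
            Real.smoothTransition.one_of_one_le (le_of_lt hy)
        rw [this.deriv_eq, deriv_const]
    rw [this, abs_zero]; exact le_max_right _ _

theorem deriv_smoothTransition_of_nonpos {x : ℝ} (hx : x ≤ 0) :
    deriv Real.smoothTransition x = 0 := by
  refine IsLocalMin.deriv_eq_zero (Filter.Eventually.of_forall fun y => ?_)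
  rw [Real.smoothTransition.zero_of_nonpos hx]; exact Real.smoothTransition.nonneg y

theorem deriv_smoothTransition_of_one_le {x : ℝ} (hx : 1 ≤ x) :
    deriv Real.smoothTransition x = 0 := by
  refine IsLocalMax.deriv_eq_zero (Filter.Eventually.of_forall fun y => ?_)
  rw [Real.smoothTransition.one_of_one_le hx]; exact Real.smoothTransition.le_one y

/-- A smooth cutoff in the radius, equal to `1` up to `R` and to `0` from `2 R` on. -/
noncomputable def radialCutoff (R r : ℝ) : ℝ := Real.smoothTransition (2 - r / R)

/-- The derivative of `radialCutoff R`. -/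
noncomputable def radialCutoffDeriv (R r : ℝ) : ℝ := -(deriv Real.smoothTransition (2 - r / R) / R)

/-- A Gaussian factor that absorbs the drift of the energy. -/
noncomputable def gaussFactor (κ s t r : ℝ) : ℝ := Real.exp (-(r ^ 2 / (4 * (s - t))) - κ * t)

theorem hasDerivAt_radialCutoff (R r : ℝ) :
    HasDerivAt (radialCutoff R) (radialCutoffDeriv R r) r := by
  have h1 : HasDerivAt Real.smoothTransition (deriv Real.smoothTransition (2 - r / R)) (2 - r / R) :=
    ((Real.smoothTransition.contDiff (n := 1)).differentiable (by simp) _).hasDerivAt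
  refine (h1.comp r (((hasDerivAt_id r).div_const R).const_sub 2)).congr_deriv ?_
  rw [radialCutoffDeriv]; ring

theorem hasDerivAt_gaussFactor_right (κ s t r : ℝ) :
    HasDerivAt (gaussFactor κ s t) (gaussFactor κ s t r * -(r / (2 * (s - t)))) r := by
  refine (((((hasDerivAt_id r).pow 2).div_const (4 * (s - t))).neg.sub_const (κ * t)).exp).congr_deriv ?_
  simp only [gaussFactor, Pi.neg_apply, Pi.pow_apply, id_eq]
  congr 1
  -- For s = t both quotients are 0 by the convention for division by zero, so no hypothesis on s
  -- and t is needed.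
  rcases eq_or_ne (s - t) 0 with h | h
  · simp [h]
  · push_cast; field_simp; norm_num; ring

/-- With q = r/(2(s - t)), the exponent -r²/(4(s - t)) has radial derivative -q and time derivative
-q². The time derivative thus pays exactly for the square of the gradient when |∇r| ≤ 1, and κ pays
for the zeroth-order term. -/
theorem hasDerivAt_gaussFactor_left {κ s t r : ℝ} (h : t < s) :
    HasDerivAt (fun t => gaussFactor κ s t r)
      (gaussFactor κ s t r * (-((r / (2 * (s - t))) ^ 2) - κ)) t := by
  have h0 : s - t ≠ 0 := (sub_pos.2 h).ne'
  have h1 : HasDerivAt (fun t => -(r ^ 2 / (4 * (s - t))) - κ * t)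
      (-((r / (2 * (s - t))) ^ 2) - κ) t := by
    refine (((hasDerivAt_const t (r ^ 2)).div (((hasDerivAt_id t).const_sub s).const_mul 4)
      (by simpa using h0)).neg.sub ((hasDerivAt_id t).const_mul κ)).congr_deriv ?_
    simp only [id_eq]
    field_simp
    ring
  exact h1.exp

theorem radialCutoff_eq_zero {R r : ℝ} (hR : 0 < R) (h : 2 * R ≤ r) : radialCutoff R r = 0 :=
  Real.smoothTransition.zero_of_nonpos (sub_nonpos.2 ((le_div_iff₀ hR).2 h))

theorem radialCutoff_eq_one {R r : ℝ} (hR : 0 < R) (h : r ≤ R) : radialCutoff R r = 1 :=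
  Real.smoothTransition.one_of_one_le (by linarith [(div_le_one hR).2 h])

theorem radialCutoffDeriv_eq_zero {R r : ℝ} (hR : 0 < R) (h : r ≤ R ∨ 2 * R ≤ r) :
    radialCutoffDeriv R r = 0 := by
  rw [radialCutoffDeriv]
  rcases h with h | h
  · rw [deriv_smoothTransition_of_one_le (by linarith [(div_le_one hR).2 h])]; simp
  · rw [deriv_smoothTransition_of_nonpos (sub_nonpos.2 ((le_div_iff₀ hR).2 h))]; simp

theorem gaussFactor_pos (κ s t r : ℝ) : 0 < gaussFactor κ s t r := Real.exp_pos _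

theorem continuous_radialCutoff (R : ℝ) : Continuous (radialCutoff R) :=
  continuous_iff_continuousAt.2 fun r => (hasDerivAt_radialCutoff R r).continuousAt

theorem continuous_radialCutoffDeriv (R : ℝ) : Continuous (radialCutoffDeriv R) :=
  ((((Real.smoothTransition.contDiff (n := 1)).continuous_deriv le_rfl).comp
    (continuous_const.sub (continuous_id.div_const R))).div_const R).neg

theorem continuousOn_gaussFactor (κ s : ℝ) :
    ContinuousOn (fun p : ℝ × ℝ => gaussFactor κ s p.1 p.2) (Iio s ×ˢ univ) := by
  refine Real.continuous_exp.comp_continuousOn (ContinuousOn.sub (ContinuousOn.neg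
    (ContinuousOn.div (by fun_prop) (by fun_prop) fun p hp => ?_)) (by fun_prop))
  have : 0 < s - p.1 := sub_pos.2 hp.1
  positivity

/-- The error term of the energy estimate is small far out. -/
theorem exists_radialCutoffDeriv_sq_mul_gaussFactor_le : ∃ C : ℝ, 0 ≤ C ∧
    ∀ κ δ R s t r : ℝ, 0 ≤ κ → 0 < δ → 0 < R → 0 ≤ t → t < s → s - t ≤ 2 * δ →
      radialCutoffDeriv R r ^ 2 * gaussFactor κ s t r ≤
        C / R ^ 2 * Real.exp (-(R ^ 2 / (8 * δ))) := by
  obtain ⟨C, hC0, hC⟩ := exists_abs_deriv_smoothTransition_le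
  refine ⟨C ^ 2, by positivity, fun κ δ R s t r hκ hδ hR ht hts hst => ?_⟩
  by_cases hr : r ≤ R
  · rw [radialCutoffDeriv_eq_zero hR (Or.inl hr)]
    simp only [ne_eq, OfNat.ofNat_ne_zero, not_false_eq_true, zero_pow, zero_mul]; positivity
  · have hr' := not_le.1 hr
    refine mul_le_mul ?_ ?_ (gaussFactor_pos _ _ _ _).le (by positivity)
    · rw [radialCutoffDeriv, neg_sq, div_pow]
      have := hC (2 - r / R)
      have : deriv Real.smoothTransition (2 - r / R) ^ 2 ≤ C ^ 2 := by rw [← sq_abs]; gcongr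
      gcongr
    · refine Real.exp_le_exp.2 ?_
      have h1 : R ^ 2 / (8 * δ) ≤ r ^ 2 / (4 * (s - t)) := by
        have : 0 < s - t := sub_pos.2 hts
        rw [show 8 * δ = 4 * (2 * δ) by ring]
        gcongr
      nlinarith

/-- The term 2‖D‖²φ² is split into halves, and each half completes the square with one cross term.
The cutoff term costs 4φ'²; the Gaussian term costs φ²q², which is exactly the negative term on the
left. -/
theorem energy_density_le {ι : Type*} [Fintype ι] (U : ℂ) (D : ι → ℂ) {g : ι → ℝ}
    (hg : ∑ i, g i ^ 2 ≤ 1) (φ φ' q : ℝ) :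
    ‖U‖ ^ 2 * (φ ^ 2 * -q ^ 2)
      - ∑ i, (2 * ‖D i‖ ^ 2 * φ ^ 2 + 2 * inner ℝ U (D i) * (g i * (2 * φ * φ' + φ ^ 2 * -q)))
      ≤ 4 * ‖U‖ ^ 2 * φ' ^ 2 := by
  have h : ∀ i, -(2 * ‖D i‖ ^ 2 * φ ^ 2 +
      2 * inner ℝ U (D i) * (g i * (2 * φ * φ' + φ ^ 2 * -q))) ≤
        g i ^ 2 * (‖U‖ ^ 2 * (4 * φ' ^ 2 + φ ^ 2 * q ^ 2)) := by
    intro i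
    have h1 := sq_nonneg ‖φ • D i + (2 * g i * φ') • U‖
    have h2 := sq_nonneg ‖φ • D i - (g i * φ * q) • U‖
    rw [norm_add_sq_real, norm_smul, norm_smul, real_inner_smul_left, real_inner_smul_right,
      real_inner_comm, mul_pow, mul_pow, Real.norm_eq_abs, Real.norm_eq_abs, sq_abs, sq_abs] at h1
    rw [norm_sub_sq_real, norm_smul, norm_smul, real_inner_smul_left, real_inner_smul_right,
      real_inner_comm, mul_pow, mul_pow, Real.norm_eq_abs, Real.norm_eq_abs, sq_abs, sq_abs] at h2
    linarith
  have h3 := Finset.sum_le_sum fun i (_ : i ∈ Finset.univ) => h i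
  rw [Finset.sum_neg_distrib, ← Finset.sum_mul] at h3
  have h4 : (∑ i, g i ^ 2) * (‖U‖ ^ 2 * (4 * φ' ^ 2 + φ ^ 2 * q ^ 2)) ≤
      1 * (‖U‖ ^ 2 * (4 * φ' ^ 2 + φ ^ 2 * q ^ 2)) := by gcongr
  linarith

end

section

/-! ### The divergence form of the energy identity -/

variable {n : ℕ} [NeZero n]

/-- A smooth substitute for the distance from the base point. -/
noncomputable def logDist (w : EuclideanSpace ℝ (Fin n)) : ℝ := Real.log (coshDist w (hypOrigin n))

theorem continuousOn_logDist : ContinuousOn (logDist (n := n)) (hypSpace n) :=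
  ContinuousOn.log (contDiffOn_coshDist_left hypOrigin_mem).continuousOn fun _ hw =>
    (coshDist_pos hw hypOrigin_mem).ne'

/-- A compact ball of the half space around the base point. -/
def hypBall (n : ℕ) [NeZero n] (r : ℝ) : Set (EuclideanSpace ℝ (Fin n)) :=
  {w | w ∈ hypSpace n ∧ logDist w ≤ r}

theorem hypBall_subset {r : ℝ} : hypBall n r ⊆ hypSpace n := fun _ hw => hw.1

theorem isCompact_hypBall (r : ℝ) : IsCompact (hypBall n r) := by
  have hmem : ∀ {w : EuclideanSpace ℝ (Fin n)}, w ∈ hypBall n r → coshDist w (hypOrigin n) ≤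
      Real.exp r := fun {w} hw => (Real.log_le_iff_le_exp (coshDist_pos hw.1 hypOrigin_mem)).1 hw.2
  -- Multiplied out by the last coordinate, the condition is closed in all of ℝⁿ. The lower bound
  -- for that coordinate keeps the set away from the boundary and makes membership in the half space
  -- automatic.
  have heq : hypBall n r = {w | ‖w - hypOrigin n‖ ^ 2 ≤ (Real.exp r - 1) * (2 * w (lastIndex n))} ∩
      {w : EuclideanSpace ℝ (Fin n) | 1 / (2 * Real.exp r) ≤ w (lastIndex n)} := by
    ext w
    constructor
    · intro hw
      have hx : 0 < w (lastIndex n) := hw.1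
      refine ⟨?_, (coordinate_bounds_of_coshDist_le hw.1 (hmem hw)).2.1⟩
      have := hmem hw
      rw [coshDist_hypOrigin] at this
      rw [mem_ofPred_eq, ← div_le_iff₀ (by positivity)]
      linarith
    · rintro ⟨h1, h2⟩
      have hx : 0 < w (lastIndex n) := lt_of_lt_of_le (by positivity) h2
      refine ⟨hx, (Real.log_le_iff_le_exp (coshDist_pos hx hypOrigin_mem)).2 ?_⟩
      rw [mem_ofPred_eq, ← div_le_iff₀ (by positivity)] at h1
      rw [coshDist_hypOrigin]
      linarith
  have hc := (contDiff_coordinate (lastIndex n)).continuous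
  refine Metric.isCompact_of_isClosed_isBounded ?_ ?_
  · rw [heq]
    refine IsClosed.inter (isClosed_le (by fun_prop) ?_) (isClosed_le continuous_const hc)
    exact continuous_const.mul (continuous_const.mul hc)
  · refine (Metric.isBounded_closedBall (x := hypOrigin n) (r := 2 * Real.exp r)).subset
      fun w hw => ?_
    rw [Metric.mem_closedBall, dist_eq_norm]
    exact (coordinate_bounds_of_coshDist_le hw.1 (hmem hw)).2.2

/-- The weight of the energy. -/
noncomputable def energyWeight (κ s R t r : ℝ) : ℝ := radialCutoff R r ^ 2 * gaussFactor κ s t r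

/-- The radial derivative of the weight of the energy. -/
noncomputable def energyWeightDeriv (κ s R t r : ℝ) : ℝ :=
  (2 * radialCutoff R r * radialCutoffDeriv R r + radialCutoff R r ^ 2 * -(r / (2 * (s - t)))) *
    gaussFactor κ s t r

theorem hasDerivAt_energyWeight (κ s R t r : ℝ) :
    HasDerivAt (energyWeight κ s R t) (energyWeightDeriv κ s R t r) r := by
  refine (((hasDerivAt_radialCutoff R r).pow 2).mul
    (hasDerivAt_gaussFactor_right κ s t r)).congr_deriv ?_
  simp only [energyWeightDeriv, Pi.pow_apply]
  push_cast
  ring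

theorem energyWeight_eq_zero {κ s R t r : ℝ} (hR : 0 < R) (h : 2 * R ≤ r) :
    energyWeight κ s R t r = 0 := by
  rw [energyWeight, radialCutoff_eq_zero hR h]; ring

theorem energyWeightDeriv_eq_zero {κ s R t r : ℝ} (hR : 0 < R) (h : 2 * R ≤ r) :
    energyWeightDeriv κ s R t r = 0 := by
  rw [energyWeightDeriv, radialCutoff_eq_zero hR h]; ring

theorem energyWeight_nonneg (κ s R t r : ℝ) : 0 ≤ energyWeight κ s R t r :=
  mul_nonneg (sq_nonneg _) (gaussFactor_pos _ _ _ _).le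

theorem continuousOn_energyWeight (κ s R : ℝ) :
    ContinuousOn (fun p : ℝ × ℝ => energyWeight κ s R p.1 p.2) (Iio s ×ˢ univ) :=
  (((continuous_radialCutoff R).comp continuous_snd).pow 2).continuousOn.mul
    (continuousOn_gaussFactor κ s)

theorem continuous_energyWeight (κ s R t : ℝ) : Continuous (energyWeight κ s R t) :=
  continuous_iff_continuousAt.2 fun r => (hasDerivAt_energyWeight κ s R t r).continuousAt

theorem continuous_energyWeightDeriv (κ s R t : ℝ) : Continuous (energyWeightDeriv κ s R t) := by
  have h1 := continuous_radialCutoff R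
  have h2 := continuous_radialCutoffDeriv R
  have h3 : Continuous (gaussFactor κ s t) :=
    continuous_iff_continuousAt.2 fun r => (hasDerivAt_gaussFactor_right κ s t r).continuousAt
  unfold energyWeightDeriv
  fun_prop

/-- The volume density times the squared conformal factor of the half space. -/
noncomputable def fluxDensity (n : ℕ) (x : ℝ) : ℝ := x ^ 2 / x ^ n

/-- This is how the first-order term (2 - n)x_n ∂_n of 𝓛_n arises from the divergence form. -/
theorem hasDerivAt_fluxDensity (n : ℕ) {x : ℝ} (hx : x ≠ 0) :
    HasDerivAt (fluxDensity n) ((2 - n) * x / x ^ n) x := by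
  refine ((hasDerivAt_pow 2 x).div (hasDerivAt_pow n x) (pow_ne_zero n hx)).congr_deriv ?_
  rcases Nat.eq_zero_or_pos n with rfl | hn
  · simp
  · obtain ⟨m, rfl⟩ := Nat.exists_eq_add_of_le' hn
    simp only [Nat.add_sub_cancel]
    push_cast
    field_simp
    ring

/-- The `i`-th component of the energy flux on the half space. -/
noncomputable def energyFlux (u : EuclideanSpace ℝ (Fin n) → ℂ) (κ s R t : ℝ) (i : Fin n)
    (w : EuclideanSpace ℝ (Fin n)) : ℝ :=
  2 * inner ℝ (u w) (fderiv ℝ u w (EuclideanSpace.single i 1)) *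
    energyWeight κ s R t (logDist w) * fluxDensity n (w (lastIndex n))

/-- The derivative of the `i`-th component of the energy flux in the direction `i`. -/
noncomputable def energyFluxDeriv (u : EuclideanSpace ℝ (Fin n) → ℂ) (κ s R t : ℝ) (i : Fin n)
    (w : EuclideanSpace ℝ (Fin n)) : ℝ :=
  2 * (‖fderiv ℝ u w (EuclideanSpace.single i 1)‖ ^ 2 +
      inner ℝ (u w) (fderiv ℝ (fun w => fderiv ℝ u w (EuclideanSpace.single i 1)) w
        (EuclideanSpace.single i 1))) *
      energyWeight κ s R t (logDist w) * fluxDensity n (w (lastIndex n))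
    + 2 * inner ℝ (u w) (fderiv ℝ u w (EuclideanSpace.single i 1)) *
      (energyWeightDeriv κ s R t (logDist w) *
        (coshDistPartial (hypOrigin n) i w / coshDist w (hypOrigin n))) *
      fluxDensity n (w (lastIndex n))
    + 2 * inner ℝ (u w) (fderiv ℝ u w (EuclideanSpace.single i 1)) *
      energyWeight κ s R t (logDist w) *
      ((2 - n) * w (lastIndex n) / w (lastIndex n) ^ n *
        (EuclideanSpace.single i (1 : ℝ)) (lastIndex n))

theorem hasLineDerivAt_energyFlux {u : EuclideanSpace ℝ (Fin n) → ℂ}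
    (hu : ContDiffOn ℝ 2 u (hypSpace n)) (κ s R t : ℝ) (i : Fin n) {w : EuclideanSpace ℝ (Fin n)}
    (hw : w ∈ hypSpace n) :
    HasLineDerivAt ℝ (energyFlux u κ s R t i) (energyFluxDeriv u κ s R t i w) w
      (EuclideanSpace.single i 1) := by
  have hx : w (lastIndex n) ≠ 0 := ne_of_gt hw
  have hat : ContDiffAt ℝ 2 u w := hu.contDiffAt (isOpen_hypSpace.mem_nhds hw)
  have hU : HasDerivAt (fun σ : ℝ => u (w + σ • EuclideanSpace.single i (1 : ℝ)))
      (fderiv ℝ u w (EuclideanSpace.single i 1)) 0 :=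
    (hat.differentiableAt (by simp)).hasFDerivAt.hasLineDerivAt _
  have hdd : DifferentiableAt ℝ (fun w => fderiv ℝ u w (EuclideanSpace.single i (1 : ℝ))) w :=
    ((hat.fderiv_right (m := 1) (by norm_num)).differentiableAt (by simp)).clm_apply
      (differentiableAt_const _)
  have hU1 : HasDerivAt (fun σ : ℝ => fderiv ℝ u (w + σ • EuclideanSpace.single i (1 : ℝ))
      (EuclideanSpace.single i (1 : ℝ)))
      (fderiv ℝ (fun w => fderiv ℝ u w (EuclideanSpace.single i 1)) w
        (EuclideanSpace.single i 1)) 0 := hdd.hasFDerivAt.hasLineDerivAt _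
  have h0 : w + (0 : ℝ) • EuclideanSpace.single i (1 : ℝ) = w := by simp
  have hL : HasDerivAt (fun σ : ℝ => logDist (w + σ • EuclideanSpace.single i (1 : ℝ)))
      (coshDistPartial (hypOrigin n) i w / coshDist w (hypOrigin n)) 0 := by
    have := (hasDerivAt_coshDist_line hw hypOrigin_mem i).log
      (by rw [h0]; exact (coshDist_pos hw hypOrigin_mem).ne')
    rwa [h0] at this
  have hΘ : HasDerivAt (fun σ : ℝ => energyWeight κ s R t
      (logDist (w + σ • EuclideanSpace.single i (1 : ℝ)))) _ 0 :=
    HasDerivAt.comp_of_eq (h₂ := energyWeight κ s R t) 0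
      (hasDerivAt_energyWeight κ s R t (logDist w)) hL (by rw [h0])
  have hxl := hasDerivAt_line_aux (x := w (lastIndex n))
    (c := (EuclideanSpace.single i (1 : ℝ)) (lastIndex n))
  have hW : HasDerivAt (fun σ : ℝ => fluxDensity n
      ((w + σ • EuclideanSpace.single i (1 : ℝ)) (lastIndex n))) _ 0 :=
    HasDerivAt.comp_of_eq (h₂ := fluxDensity n) 0
      (hasDerivAt_fluxDensity n hx) hxl (by simp)
  have := (((hU.inner ℝ hU1).const_mul 2).mul hΘ).mul hW
  refine HasDerivAt.congr_deriv this ?_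
  simp only [h0, energyFluxDeriv, real_inner_self_eq_norm_sq, Pi.mul_apply]
  ring

theorem continuousOn_energyFlux {u : EuclideanSpace ℝ (Fin n) → ℂ}
    (hu : ContDiffOn ℝ 2 u (hypSpace n)) (κ s R t : ℝ) (i : Fin n) :
    ContinuousOn (energyFlux u κ s R t i) (hypSpace n) ∧
      ContinuousOn (energyFluxDeriv u κ s R t i) (hypSpace n) := by
  have h1 : ContDiffOn ℝ 1 (fderiv ℝ u) (hypSpace n) :=
    hu.fderiv_of_isOpen isOpen_hypSpace (by norm_num)
  have h2 : ContDiffOn ℝ 1 (fun w => fderiv ℝ u w (EuclideanSpace.single i 1)) (hypSpace n) :=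
    h1.clm_apply contDiffOn_const
  have h3 : ContinuousOn (fun w => fderiv ℝ (fun w => fderiv ℝ u w (EuclideanSpace.single i 1)) w
      (EuclideanSpace.single i 1)) (hypSpace n) :=
    (h2.continuousOn_fderiv_of_isOpen isOpen_hypSpace le_rfl).clm_apply continuousOn_const
  have hc : ContinuousOn (fun w : EuclideanSpace ℝ (Fin n) => w (lastIndex n)) (hypSpace n) :=
    (contDiff_coordinate (lastIndex n)).continuous.continuousOn
  have hc0 : ∀ w ∈ hypSpace n, w (lastIndex n) ^ n ≠ 0 := fun w hw => pow_ne_zero n (ne_of_gt hw)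
  have hW : ContinuousOn (fun w : EuclideanSpace ℝ (Fin n) => fluxDensity n (w (lastIndex n)))
      (hypSpace n) := (hc.pow 2).div (hc.pow n) hc0
  have hΘ := (continuous_energyWeight κ s R t).comp_continuousOn (continuousOn_logDist (n := n))
  have hΘ' := (continuous_energyWeightDeriv κ s R t).comp_continuousOn
    (continuousOn_logDist (n := n))
  have hi := (hu.continuousOn.inner (𝕜 := ℝ) h2.continuousOn).const_mul 2
  have hZ : ContinuousOn (fun w => coshDist w (hypOrigin n)) (hypSpace n) :=
    (contDiffOn_coshDist_left hypOrigin_mem).continuousOn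
  have hZ' := (contDiffOn_coshDistPartial (n := n) hypOrigin_mem i).continuousOn
  refine ⟨(hi.mul hΘ).mul hW, ?_⟩
  exact ((((((h2.continuousOn.norm.pow 2).add (hu.continuousOn.inner (𝕜 := ℝ) h3)).const_mul
    2).mul hΘ).mul hW).add ((hi.mul (hΘ'.mul (hZ'.div hZ fun w hw =>
      (coshDist_pos hw hypOrigin_mem).ne'))).mul hW)).add ((hi.mul hΘ).mul
      ((((continuousOn_const.mul hc).div (hc.pow n) hc0)).mul continuousOn_const))

/-- The weight and its radial derivative vanish beyond `logDist` = 2R. The flux, extended by zero,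
is therefore line differentiable on all of ℝⁿ and has compact support. -/
theorem setIntegral_energyFluxDeriv_eq_zero {u : EuclideanSpace ℝ (Fin n) → ℂ}
    (hu : ContDiffOn ℝ 2 u (hypSpace n)) (κ s t : ℝ) {R : ℝ} (hR : 0 < R) (i : Fin n) :
    ∫ w in hypBall n (2 * R), energyFluxDeriv u κ s R t i w = 0 := by
  have hK := isCompact_hypBall (n := n) (2 * R)
  have h0 : ∀ w ∈ hypSpace n, w ∉ hypBall n (2 * R) → energyFlux u κ s R t i w = 0 := by
    intro w hw hwK
    have : 2 * R ≤ logDist w := le_of_lt (not_le.1 fun h => hwK ⟨hw, h⟩)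
    rw [energyFlux, energyWeight_eq_zero hR this]; ring
  have h0' : ∀ w ∈ hypSpace n, w ∉ hypBall n (2 * R) → energyFluxDeriv u κ s R t i w = 0 := by
    intro w hw hwK
    have : 2 * R ≤ logDist w := le_of_lt (not_le.1 fun h => hwK ⟨hw, h⟩)
    rw [energyFluxDeriv, energyWeight_eq_zero hR this, energyWeightDeriv_eq_zero hR this]; ring
  have hc := continuousOn_energyFlux hu κ s R t i
  have hind : ∀ (f : EuclideanSpace ℝ (Fin n) → ℝ), EqOn ((hypBall n (2 * R)).indicator f) f
    (hypBall n (2 * R)) := fun f => eqOn_indicator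
  have hmain := setIntegral_lineDeriv_eq_zero (μ := volume) hK
    (g := (hypBall n (2 * R)).indicator (energyFlux u κ s R t i))
    (g' := (hypBall n (2 * R)).indicator (energyFluxDeriv u κ s R t i))
    (v := EuclideanSpace.single i 1)
    ((hc.1.mono hypBall_subset).congr (hind _)) ((hc.2.mono hypBall_subset).congr (hind _))
    (fun w hw => indicator_of_notMem hw _) (fun w hw => indicator_of_notMem hw _) ?_
  · rw [← hmain]
    exact setIntegral_congr_fun hK.measurableSet (hind _).symm
  · intro w
    by_cases hw : w ∈ hypSpace n
    · have h1 : (hypBall n (2 * R)).indicator (energyFluxDeriv u κ s R t i) w =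
          energyFluxDeriv u κ s R t i w := indicator_apply_eq_self.2 (h0' w hw)
      rw [h1]
      refine (hasLineDerivAt_energyFlux hu κ s R t i hw).congr_of_eventuallyEq ?_
      filter_upwards [isOpen_hypSpace.mem_nhds hw] with v hv using
        indicator_apply_eq_self.2 (h0 v hv)
    · have hwK : w ∉ hypBall n (2 * R) := fun h => hw h.1
      rw [indicator_of_notMem hwK]
      have h1 : HasLineDerivAt ℝ (fun _ : EuclideanSpace ℝ (Fin n) => (0 : ℝ)) 0 w
        (EuclideanSpace.single i 1) := hasDerivAt_const _ _
      refine h1.congr_of_eventuallyEq ?_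
      filter_upwards [hK.isClosed.isOpen_compl.mem_nhds hwK] with v hv using
        indicator_of_notMem hv _

end

section

/-! ### The energy estimate and uniqueness -/

variable {n : ℕ} [NeZero n]

theorem inner_hypLaplacian {u : EuclideanSpace ℝ (Fin n) → ℂ} (hu : ContDiffOn ℝ 2 u (hypSpace n))
    {w : EuclideanSpace ℝ (Fin n)} (hw : w ∈ hypSpace n) :
    inner ℝ (u w) (hypLaplacian u w) = w (lastIndex n) ^ 2 *
      (∑ i, inner ℝ (u w) (fderiv ℝ (fun w => fderiv ℝ u w (EuclideanSpace.single i 1)) w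
        (EuclideanSpace.single i 1))) + (2 - n) * w (lastIndex n) *
        inner ℝ (u w) (fderiv ℝ u w (EuclideanSpace.single (lastIndex n) 1)) +
      ((n : ℝ) - 1) ^ 2 / 4 * ‖u w‖ ^ 2 := by
  have hdd : DifferentiableAt ℝ (fderiv ℝ u) w := ((hu.contDiffAt
    (isOpen_hypSpace.mem_nhds hw)).fderiv_right (m := 1) (by norm_num)).differentiableAt (by simp)
  have h : hypLaplacian u w = (w (lastIndex n) ^ 2) •
      (∑ i, fderiv ℝ (fun w => fderiv ℝ u w (EuclideanSpace.single i 1)) w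
        (EuclideanSpace.single i 1)) + ((2 - n) * w (lastIndex n)) •
        fderiv ℝ u w (EuclideanSpace.single (lastIndex n) 1) +
      (((n : ℝ) - 1) ^ 2 / 4) • u w := by
    rw [hypLaplacian, laplacian_eq_sum_fderiv hdd]
    simp only [Complex.real_smul]
    push_cast
    rfl
  rw [h, inner_add_right, inner_add_right, real_inner_smul_right, real_inner_smul_right,
    real_inner_smul_right, inner_sum, real_inner_self_eq_norm_sq]

/-- The squared hyperbolic gradient of log cosh ρ is (cosh² ρ - 1)/cosh² ρ. Unlike ρ, this function
is also smooth at the base point. -/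
theorem sum_sq_conformal_le_one {w : EuclideanSpace ℝ (Fin n)} (hw : w ∈ hypSpace n) :
    ∑ i, (w (lastIndex n) * (coshDistPartial (hypOrigin n) i w / coshDist w (hypOrigin n))) ^ 2
      ≤ 1 := by
  have hZ := coshDist_pos hw (hypOrigin_mem (n := n))
  have h := sum_coshDistPartial_sq hw (hypOrigin_mem (n := n))
  have e : ∀ i, (w (lastIndex n) *
      (coshDistPartial (hypOrigin n) i w / coshDist w (hypOrigin n))) ^ 2 =
      w (lastIndex n) ^ 2 / coshDist w (hypOrigin n) ^ 2 * coshDistPartial (hypOrigin n) i w ^ 2 :=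
    fun i => by ring
  simp only [e]
  rw [← Finset.mul_sum, div_mul_eq_mul_div, h, div_le_one (by positivity)]
  linarith

/-- Subtracting the divergence of the flux replaces 2⟨u, 𝓛u⟩ by -2|∇u|² and cross terms with the
gradient of the weight, which is the situation of `energy_density_le` with D and g scaled by x_n.
The remaining 2 · (n - 1)²/4 · |u|² is cancelled by κ. -/
theorem energy_pointwise_le {u : EuclideanSpace ℝ (Fin n) → ℂ}
    (hu : ContDiffOn ℝ 2 u (hypSpace n)) (s R t : ℝ) {w : EuclideanSpace ℝ (Fin n)}
    (hw : w ∈ hypSpace n) {κ : ℝ} (hκ : κ = ((n : ℝ) - 1) ^ 2 / 2) :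
    (2 * inner ℝ (u w) (hypLaplacian u w) * energyWeight κ s R t (logDist w) +
        ‖u w‖ ^ 2 * (radialCutoff R (logDist w) ^ 2 * (gaussFactor κ s t (logDist w) *
          (-((logDist w / (2 * (s - t))) ^ 2) - κ)))) / w (lastIndex n) ^ n
      - ∑ i, energyFluxDeriv u κ s R t i w ≤
    4 * ‖u w‖ ^ 2 * (radialCutoffDeriv R (logDist w) ^ 2 * gaussFactor κ s t (logDist w)) /
      w (lastIndex n) ^ n := by
  have hx : 0 < w (lastIndex n) := hw
  set x := w (lastIndex n) with hxd
  set r := logDist w with hr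
  set φ := radialCutoff R r with hφ
  set φ' := radialCutoffDeriv R r with hφ'
  set e := gaussFactor κ s t r with he
  have he0 : 0 < e := gaussFactor_pos _ _ _ _
  set q := r / (2 * (s - t)) with hq
  set D : Fin n → ℂ := fun i => x • fderiv ℝ u w (EuclideanSpace.single i 1) with hD
  set g : Fin n → ℝ := fun i => x * (coshDistPartial (hypOrigin n) i w / coshDist w (hypOrigin n))
    with hg
  have h1 := energy_density_le (u w) D (g := g) (sum_sq_conformal_le_one hw) φ φ' q
  have hΘ : energyWeight κ s R t r = φ ^ 2 * e := rfl
  have hΘ' : energyWeightDeriv κ s R t r = (2 * φ * φ' + φ ^ 2 * -q) * e := rfl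
  have h2 : ∀ i, energyFluxDeriv u κ s R t i w =
      e / x ^ n * (2 * ‖D i‖ ^ 2 * φ ^ 2 + 2 * inner ℝ (u w) (D i) *
        (g i * (2 * φ * φ' + φ ^ 2 * -q))) +
      2 * (φ ^ 2 * e) * x ^ 2 / x ^ n * inner ℝ (u w)
        (fderiv ℝ (fun w => fderiv ℝ u w (EuclideanSpace.single i 1)) w
        (EuclideanSpace.single i 1)) +
      (EuclideanSpace.single i (1 : ℝ)) (lastIndex n) * (2 * (φ ^ 2 * e) * ((2 - n) * x / x ^ n) *
        inner ℝ (u w) (fderiv ℝ u w (EuclideanSpace.single i 1))) := by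
    intro i
    simp only [energyFluxDeriv, ← hxd, ← hr, hΘ, hΘ', fluxDensity, hD, hg, norm_smul,
      real_inner_smul_right, mul_pow, Real.norm_eq_abs, sq_abs]
    ring
  have h3 : ∑ i, energyFluxDeriv u κ s R t i w = e / x ^ n *
      (∑ i, (2 * ‖D i‖ ^ 2 * φ ^ 2 + 2 * inner ℝ (u w) (D i) *
        (g i * (2 * φ * φ' + φ ^ 2 * -q)))) +
      2 * (φ ^ 2 * e) / x ^ n * (inner ℝ (u w) (hypLaplacian u w) -
        ((n : ℝ) - 1) ^ 2 / 4 * ‖u w‖ ^ 2) := by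
    simp only [h2]
    rw [Finset.sum_add_distrib, Finset.sum_add_distrib, sum_single_last, ← Finset.mul_sum,
      ← Finset.mul_sum, inner_hypLaplacian hu hw, ← hxd]
    ring
  have h4 := mul_le_mul_of_nonneg_left h1 (show 0 ≤ e / x ^ n by positivity)
  rw [h3, hΘ]
  calc _ = e / x ^ n * (‖u w‖ ^ 2 * (φ ^ 2 * -q ^ 2) - ∑ i, (2 * ‖D i‖ ^ 2 * φ ^ 2 +
        2 * inner ℝ (u w) (D i) * (g i * (2 * φ * φ' + φ ^ 2 * -q)))) := by rw [hκ]; ring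
    _ ≤ _ := h4
    _ = _ := by ring

/-- The energy density of a solution. -/
noncomputable def energyDensity (u : ℝ → EuclideanSpace ℝ (Fin n) → ℂ) (κ s R t : ℝ)
    (w : EuclideanSpace ℝ (Fin n)) : ℝ :=
  ‖u t w‖ ^ 2 * energyWeight κ s R t (logDist w) / w (lastIndex n) ^ n

/-- The mass density of a solution. -/
noncomputable def massDensity (u : ℝ → EuclideanSpace ℝ (Fin n) → ℂ) (t : ℝ)
    (w : EuclideanSpace ℝ (Fin n)) : ℝ :=
  ‖u t w‖ ^ 2 / w (lastIndex n) ^ n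

/-- The time derivative of the energy density of a solution. -/
noncomputable def energyDensityDeriv (u : ℝ → EuclideanSpace ℝ (Fin n) → ℂ) (κ s R t : ℝ)
    (w : EuclideanSpace ℝ (Fin n)) : ℝ :=
  (2 * inner ℝ (u t w) (deriv (fun s => u s w) t) * energyWeight κ s R t (logDist w) +
    ‖u t w‖ ^ 2 * (radialCutoff R (logDist w) ^ 2 * (gaussFactor κ s t (logDist w) *
      (-((logDist w / (2 * (s - t))) ^ 2) - κ)))) / w (lastIndex n) ^ n

/-! ### Regularity of the energy in time, and the energy inequality -/

theorem continuousOn_time_logDist {s : ℝ} {S : Set ℝ} {G : ℝ × ℝ → ℝ} (hS : S ⊆ Iio s)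
    (hG : ContinuousOn G (Iio s ×ˢ univ)) :
    ContinuousOn (fun p : ℝ × EuclideanSpace ℝ (Fin n) => G (p.1, logDist p.2))
      (S ×ˢ hypSpace n) :=
  hG.comp (continuous_fst.continuousOn.prodMk
    (continuousOn_logDist.comp continuous_snd.continuousOn fun _ hp => hp.2))
    fun p hp => ⟨hS hp.1, mem_univ _⟩

theorem continuousOn_coordinate_pow {S : Set ℝ} :
    ContinuousOn (fun p : ℝ × EuclideanSpace ℝ (Fin n) => p.2 (lastIndex n) ^ n) (S ×ˢ hypSpace n) :=
  (((contDiff_coordinate (lastIndex n)).continuous.comp continuous_snd).pow n).continuousOn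

theorem coordinate_pow_ne_zero {S : Set ℝ} :
    ∀ p ∈ S ×ˢ hypSpace n, p.2 (lastIndex n) ^ n ≠ 0 :=
  fun _ hp => pow_ne_zero n (ne_of_gt hp.2)

variable {u : ℝ → EuclideanSpace ℝ (Fin n) → ℂ}

theorem continuousOn_massDensity (hu : IsHypHeatSolution n 0 u) :
    ContinuousOn (fun p : ℝ × EuclideanSpace ℝ (Fin n) => massDensity u p.1 p.2)
      (Ici 0 ×ˢ hypSpace n) :=
  (hu.continuousOn.norm.pow 2).div continuousOn_coordinate_pow coordinate_pow_ne_zero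

theorem continuousOn_energyDensity (hu : IsHypHeatSolution n 0 u) (κ s R : ℝ) :
    ContinuousOn (fun p : ℝ × EuclideanSpace ℝ (Fin n) => energyDensity u κ s R p.1 p.2)
      (Ico 0 s ×ˢ hypSpace n) :=
  (((hu.continuousOn.mono (prod_mono Ico_subset_Ici_self Subset.rfl)).norm.pow 2).mul
    (continuousOn_time_logDist (G := fun p => energyWeight κ s R p.1 p.2)
      (fun _ h => h.2) (continuousOn_energyWeight κ s R))).div
    continuousOn_coordinate_pow coordinate_pow_ne_zero

theorem continuousOn_energyDensityDeriv (hu : IsHypHeatSolution n 0 u) (κ s R : ℝ) :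
    ContinuousOn (fun p : ℝ × EuclideanSpace ℝ (Fin n) => energyDensityDeriv u κ s R p.1 p.2)
      (Ioo 0 s ×ˢ hypSpace n) := by
  have hU := hu.continuousOn.mono (prod_mono ((Ioo_subset_Ico_self (b := s)).trans
    Ico_subset_Ici_self) (Subset.refl (hypSpace n)))
  have hU' := hu.continuousOn_deriv_time.mono (prod_mono (s₂ := Ioi 0) (fun x (h : x ∈ Ioo 0 s) => h.1)
    (Subset.refl (hypSpace n)))
  have hs : Ioo 0 s ⊆ Iio s := fun _ h => h.2
  have h1 := continuousOn_time_logDist (n := n) (G := fun p => energyWeight κ s R p.1 p.2) hs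
    (continuousOn_energyWeight κ s R)
  have h2 : ContinuousOn (fun p : ℝ × ℝ => radialCutoff R p.2 ^ 2 * (gaussFactor κ s p.1 p.2 *
      (-((p.2 / (2 * (s - p.1))) ^ 2) - κ))) (Iio s ×ˢ univ) := by
    refine (((continuous_radialCutoff R).comp continuous_snd).pow 2).continuousOn.mul
      ((continuousOn_gaussFactor κ s).mul (((continuousOn_snd.div (by fun_prop)
        fun p hp => ?_).pow 2).neg.sub continuousOn_const))
    have : 0 < s - p.1 := sub_pos.2 hp.1
    positivity
  exact ((((hU.inner (𝕜 := ℝ) hU').const_mul 2).mul h1).add ((hU.norm.pow 2).mul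
    (continuousOn_time_logDist hs h2))).div continuousOn_coordinate_pow coordinate_pow_ne_zero

theorem hasDerivAt_energyDensity (hu : IsHypHeatSolution n 0 u) (κ R : ℝ) {s t : ℝ} (ht : 0 < t)
    (hts : t < s) {w : EuclideanSpace ℝ (Fin n)} (hw : w ∈ hypSpace n) :
    HasDerivAt (fun t => energyDensity u κ s R t w) (energyDensityDeriv u κ s R t w) t := by
  have h1 := (hu.differentiableAt_time t ht w hw).hasDerivAt
  have h2 := ((hasDerivAt_gaussFactor_left (κ := κ) (r := logDist w) hts).const_mul
    (radialCutoff R (logDist w) ^ 2))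
  refine ((h1.norm_sq.mul h2).div_const (w (lastIndex n) ^ n)).congr_deriv ?_
  rw [energyDensityDeriv, energyWeight]

/-- The fluxes integrate to zero over the ball that carries the weight, so the pointwise inequality
may be integrated and leaves only the error of the cutoff. -/
theorem integral_energyDensityDeriv_le (hu : IsHypHeatSolution n 0 u) {κ : ℝ}
    (hκ : κ = ((n : ℝ) - 1) ^ 2 / 2) {s t R B : ℝ} (hR : 0 < R) (ht : 0 < t) (hts : t < s)
    (hB : ∀ r, radialCutoffDeriv R r ^ 2 * gaussFactor κ s t r ≤ B) :
    ∫ w in hypBall n (2 * R), energyDensityDeriv u κ s R t w ≤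
      4 * B * ∫ w in hypBall n (2 * R), massDensity u t w := by
  have hK := isCompact_hypBall (n := n) (2 * R)
  have hsp := hu.contDiffOn_space t ht
  have hflux : ∀ i, IntegrableOn (energyFluxDeriv (u t) κ s R t i) (hypBall n (2 * R)) := fun i =>
    ((continuousOn_energyFlux hsp κ s R t i).2.mono hypBall_subset).integrableOn_compact hK
  have hd : IntegrableOn (energyDensityDeriv u κ s R t) (hypBall n (2 * R)) :=
    (((continuousOn_energyDensityDeriv hu κ s R).curry_left (f := energyDensityDeriv u κ s R)
      ⟨ht, hts⟩).mono hypBall_subset).integrableOn_compact hK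
  have hm : IntegrableOn (massDensity u t) (hypBall n (2 * R)) :=
    (((continuousOn_massDensity hu).curry_left (f := massDensity u)
      ht.le).mono hypBall_subset).integrableOn_compact hK
  have h0 : ∫ w in hypBall n (2 * R), ∑ i, energyFluxDeriv (u t) κ s R t i w = 0 := by
    rw [integral_finsetSum _ fun i _ => hflux i]
    exact Finset.sum_eq_zero fun i _ => setIntegral_energyFluxDeriv_eq_zero hsp κ s t hR i
  have hsum : IntegrableOn (fun w => ∑ i, energyFluxDeriv (u t) κ s R t i w)
    (hypBall n (2 * R)) := integrable_finsetSum _ fun i _ => hflux i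
  calc _ = ∫ w in hypBall n (2 * R), (energyDensityDeriv u κ s R t w -
        ∑ i, energyFluxDeriv (u t) κ s R t i w) := by
        rw [integral_sub hd hsum, h0, sub_zero]
    _ ≤ ∫ w in hypBall n (2 * R), 4 * B * massDensity u t w := by
        refine setIntegral_mono_on (hd.sub hsum) (hm.const_mul _) hK.measurableSet fun w hw => ?_
        have hx : 0 < w (lastIndex n) := hw.1
        rw [energyDensityDeriv, ← hu.heat_eq t ht w hw.1]
        refine (energy_pointwise_le hsp s R t hw.1 hκ).trans ?_
        rw [massDensity, ← mul_div_assoc]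
        have := mul_le_mul_of_nonneg_left (hB (logDist w))
          (show 0 ≤ 4 * ‖u t w‖ ^ 2 by positivity)
        gcongr ?_ / _
        linarith
    _ = _ := integral_const_mul _ _

/-- The differential inequality is integrated from τ, where the energy is zero. At the end points
only continuity of the energy is needed, which matters for τ = 0. -/
theorem energy_le (hu : IsHypHeatSolution n 0 u) {κ : ℝ} (hκ : κ = ((n : ℝ) - 1) ^ 2 / 2)
    {τ s t R B : ℝ} (hR : 0 < R) (hτ : 0 ≤ τ) (hτt : τ ≤ t) (hts : t < s)
    (h0 : ∀ w ∈ hypSpace n, u τ w = 0)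
    (hB : ∀ t' r, τ < t' → t' < t → radialCutoffDeriv R r ^ 2 * gaussFactor κ s t' r ≤ B) :
    ∫ w in hypBall n (2 * R), energyDensity u κ s R t w ≤
      4 * B * ∫ t' in τ..t, ∫ w in hypBall n (2 * R), massDensity u t' w := by
  have hK := isCompact_hypBall (n := n) (2 * R)
  have hsub : Icc τ t ⊆ Ico 0 s := fun x hx => ⟨hτ.trans hx.1, hx.2.trans_lt hts⟩
  have hc := continuousOn_setIntegral_of_isCompact (μ := volume) hK
    ((continuousOn_energyDensity hu κ s R).mono (prod_mono hsub hypBall_subset))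
  have hm := continuousOn_setIntegral_of_isCompact (μ := volume) hK
    ((continuousOn_massDensity hu).mono (prod_mono (hsub.trans Ico_subset_Ici_self) hypBall_subset))
  have hd : ∀ x ∈ Ioo τ t, HasDerivAt (fun t => ∫ w in hypBall n (2 * R), energyDensity u κ s R t w)
      (∫ w in hypBall n (2 * R), energyDensityDeriv u κ s R x w) x := fun x hx =>
    hasDerivAt_setIntegral_of_isCompact hK (U := Ioo 0 s) isOpen_Ioo
      ((continuousOn_energyDensity hu κ s R).mono (prod_mono Ioo_subset_Ico_self hypBall_subset))
      ((continuousOn_energyDensityDeriv hu κ s R).mono (prod_mono Subset.rfl hypBall_subset))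
      (fun t ht w hw => hasDerivAt_energyDensity hu κ R ht.1 ht.2 hw.1)
      ⟨hτ.trans_lt hx.1, hx.2.trans hts⟩
  have h1 := intervalIntegral.sub_le_integral_of_hasDeriv_right_of_le hτt hc
    (fun x hx => (hd x hx).hasDerivWithinAt)
    ((hm.integrableOn_Icc).const_mul (4 * B))
    fun x hx => integral_energyDensityDeriv_le hu hκ hR (hτ.trans_lt hx.1) (hx.2.trans hts)
      fun r => hB x r hx.1 hx.2
  have h2 : ∫ w in hypBall n (2 * R), energyDensity u κ s R τ w = 0 := by
    rw [setIntegral_congr_fun hK.measurableSet (g := fun _ => 0)]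
    · simp
    · intro w hw
      simp [energyDensity, h0 w hw.1]
  rw [h2, sub_zero, intervalIntegral.integral_const_mul] at h1
  exact h1

/-- From exp(ρ)/2 < cosh ρ ≤ exp(2R) and e > 2 one gets ρ < 2R + 1, which relates the balls of the
energy to those of the growth condition. -/
theorem hypBall_subset_hypDist_lt (R : ℝ) :
    hypBall n (2 * R) ⊆ {w | hypDist (hypOrigin n) w < 2 * R + 1} := by
  intro w hw
  have h1 : coshDist w (hypOrigin n) ≤ Real.exp (2 * R) :=
    (Real.log_le_iff_le_exp (coshDist_pos hw.1 hypOrigin_mem)).1 hw.2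
  rw [coshDist_comm, ← cosh_hypDist hypOrigin_mem hw.1, Real.cosh_eq] at h1
  have h2 := Real.exp_pos (-hypDist (hypOrigin n) w)
  have h3 : (2 : ℝ) < Real.exp 1 := by linarith [Real.exp_one_gt_d9]
  refine Real.exp_lt_exp.1 ?_
  rw [Real.exp_add]
  nlinarith [Real.exp_pos (2 * R)]

theorem lintegral_massDensity_le (t R : ℝ) :
    ∫⁻ w in hypBall n (2 * R), ENNReal.ofReal (massDensity u t w) ≤
      ∫⁻ w in {w | hypDist (hypOrigin n) w < 2 * R + 1}, ‖u t w‖ₑ ^ 2 ∂hypMeasure n := by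
  have hK := (isCompact_hypBall (n := n) (2 * R)).measurableSet
  refine le_trans (le_of_eq ?_) (lintegral_mono_set (hypBall_subset_hypDist_lt R))
  have hm : Measurable fun w : EuclideanSpace ℝ (Fin n) =>
      ENNReal.ofReal (1 / w (lastIndex n) ^ n) :=
    ((contDiff_coordinate (lastIndex n)).continuous.measurable.pow_const n
      |>.const_div 1).ennreal_ofReal
  rw [hypMeasure, setLIntegral_withDensity_eq_setLIntegral_mul_non_measurable _ hm _ hK
    (Filter.Eventually.of_forall fun _ => ENNReal.ofReal_lt_top), Measure.restrict_restrict hK,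
    inter_eq_left.2 hypBall_subset]
  refine setLIntegral_congr_fun hK fun w hw => ?_
  have hx : 0 < w (lastIndex n) := hw.1
  simp only [Pi.mul_apply]
  rw [← ofReal_norm, ← ENNReal.ofReal_pow (norm_nonneg _), ← ENNReal.ofReal_mul (by positivity),
    massDensity]
  congr 1
  ring

theorem massDensity_nonneg (t : ℝ) {w : EuclideanSpace ℝ (Fin n)} (hw : w ∈ hypSpace n) :
    0 ≤ massDensity u t w := by
  have hx : 0 < w (lastIndex n) := hw
  rw [massDensity]; positivity

/-- Transfers the growth bound from lower integrals to Bochner integrals: the mass density is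
continuous and nonnegative on the compact ball, so the two kinds of integral agree. -/
theorem integral_massDensity_le (hu : IsHypHeatSolution n 0 u) {τ t T R M : ℝ} (hτ : 0 ≤ τ)
    (hτt : τ ≤ t) (htT : t ≤ T) (hM : 0 ≤ M)
    (hg : ∫⁻ t in Ioo 0 T, ∫⁻ w in {w | hypDist (hypOrigin n) w < 2 * R + 1}, ‖u t w‖ₑ ^ 2
      ∂(hypMeasure n) ≤ ENNReal.ofReal M) :
    ∫ t' in τ..t, ∫ w in hypBall n (2 * R), massDensity u t' w ≤ M := by
  have hK := isCompact_hypBall (n := n) (2 * R)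
  have hsub : Icc τ t ⊆ Ici 0 := fun x hx => hτ.trans hx.1
  have hm := continuousOn_setIntegral_of_isCompact (μ := volume) hK
    ((continuousOn_massDensity hu).mono (prod_mono hsub hypBall_subset))
  have hnn : ∀ t', 0 ≤ ∫ w in hypBall n (2 * R), massDensity u t' w := fun t' =>
    setIntegral_nonneg hK.measurableSet fun w hw => massDensity_nonneg t' hw.1
  rw [intervalIntegral.integral_of_le hτt, integral_Ioc_eq_integral_Ioo,
    ← ENNReal.ofReal_le_ofReal_iff hM]
  refine le_trans ?_ hg
  rw [ofReal_integral_eq_lintegral_ofReal (hm.integrableOn_Icc.mono_set Ioo_subset_Icc_self)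
    (Filter.Eventually.of_forall hnn)]
  refine (setLIntegral_mono' measurableSet_Ioo fun t' ht' => ?_).trans
    (lintegral_mono_set (Ioo_subset_Ioo hτ htT))
  rw [ofReal_integral_eq_lintegral_ofReal]
  · exact lintegral_massDensity_le t' R
  · exact (((continuousOn_massDensity hu).curry_left (f := massDensity u)
      (hτ.trans ht'.1.le)).mono hypBall_subset).integrableOn_compact hK
  · filter_upwards [ae_restrict_mem hK.measurableSet] with w hw using massDensity_nonneg t' hw.1

end

/-! ### Vanishing of solutions with zero initial data -/

section

variable {n : ℕ} [NeZero n]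

/-- If u(t, w₁) ≠ 0, a small ball around w₁, on which the cutoff is 1 for large R, contributes an
energy of at least some c > 0 independent of R, while the total energy is at most D/R². -/
theorem eq_zero_of_energy_le {u : ℝ → EuclideanSpace ℝ (Fin n) → ℂ} {κ s t D : ℝ}
    (hc : ContinuousOn (u t) (hypSpace n)) (hD : 0 ≤ D)
    (hE : ∀ R, 1 ≤ R → ∫ w in hypBall n (2 * R), energyDensity u κ s R t w ≤ D / R ^ 2)
    (hi : ∀ R, IntegrableOn (energyDensity u κ s R t) (hypBall n (2 * R)))
    {w₁ : EuclideanSpace ℝ (Fin n)} (hw₁ : w₁ ∈ hypSpace n) : u t w₁ = 0 := by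
  by_contra hne
  set f : EuclideanSpace ℝ (Fin n) → ℝ := fun w =>
    ‖u t w‖ ^ 2 * gaussFactor κ s t (logDist w) / w (lastIndex n) ^ n with hf
  have hx₁ : 0 < w₁ (lastIndex n) := hw₁
  have hf1 : 0 < f w₁ := by
    have := gaussFactor_pos κ s t (logDist w₁)
    have := norm_pos_iff.2 hne
    simp only [hf]; positivity
  have hfc : ContinuousOn f (hypSpace n) :=
    ((hc.norm.pow 2).mul ((continuous_iff_continuousAt.2 fun r =>
      (hasDerivAt_gaussFactor_right κ s t r).continuousAt).comp_continuousOn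
        continuousOn_logDist)).div
      ((contDiff_coordinate (lastIndex n)).continuous.continuousOn.pow n)
      fun w hw => pow_ne_zero n (ne_of_gt hw)
  have hH := isOpen_hypSpace.mem_nhds hw₁
  have hev : ∀ᶠ w in nhds w₁, w ∈ hypSpace n ∧ f w₁ / 2 < f w ∧ logDist w < logDist w₁ + 1 :=
    Filter.Eventually.and hH (((hfc.continuousAt hH).eventually_const_lt (half_lt_self hf1)).and
      ((continuousOn_logDist.continuousAt hH).eventually_lt_const (lt_add_one _)))
  obtain ⟨ε, hε, hball⟩ := Metric.nhds_basis_closedBall.mem_iff.1 hev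
  set v := (volume (Metric.closedBall w₁ ε)).toReal with hv
  have hv0 : 0 < v := ENNReal.toReal_pos (Metric.measure_closedBall_pos volume w₁ hε).ne'
    (isCompact_closedBall _ _).measure_ne_top
  set c := f w₁ / 2 * v with hcd
  have hc0 : 0 < c := by positivity
  -- R > D/c together with R ≥ 1 contradicts c ≤ D/R², and R ≥ `logDist w₁` + 1 makes the cutoff
  -- equal to 1 on the small ball.
  set R := max 1 (logDist w₁ + 1) + D / c with hR
  have hDc : 0 ≤ D / c := by positivity
  have hR1 : 1 ≤ R := le_add_of_le_of_nonneg (le_max_left _ _) hDc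
  have hRD : D / c < R := by
    have := le_max_left 1 (logDist w₁ + 1); linarith
  have hRr : logDist w₁ + 1 ≤ R := le_add_of_le_of_nonneg (le_max_right _ _) hDc
  have hR0 : 0 < R := one_pos.trans_le hR1
  have hsub : Metric.closedBall w₁ ε ⊆ hypBall n (2 * R) := fun w hw =>
    ⟨(hball hw).1, by linarith [(hball hw).2.2]⟩
  have h1 : c ≤ ∫ w in Metric.closedBall w₁ ε, energyDensity u κ s R t w := by
    have h2 : ∫ _ in Metric.closedBall w₁ ε, f w₁ / 2 = c := by
      rw [setIntegral_const, smul_eq_mul, mul_comm]; rfl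
    rw [← h2]
    refine setIntegral_mono_on (integrableOn_const (isCompact_closedBall _ _).measure_ne_top)
      ((hi R).mono_set hsub) Metric.isClosed_closedBall.measurableSet fun w hw => ?_
    have h3 := hball hw
    rw [energyDensity, energyWeight, radialCutoff_eq_one hR0 (by linarith [h3.2.2]), one_pow, one_mul]
    exact h3.2.1.le
  have h2 : ∫ w in Metric.closedBall w₁ ε, energyDensity u κ s R t w ≤
      ∫ w in hypBall n (2 * R), energyDensity u κ s R t w := by
    refine setIntegral_mono_set (hi R) ?_ hsub.eventuallyLE
    filter_upwards [ae_restrict_mem (isCompact_hypBall (2 * R)).measurableSet] with w hw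
    have hx : 0 < w (lastIndex n) := hw.1
    have := energyWeight_nonneg κ s R t (logDist w)
    simp only [energyDensity, Pi.zero_apply]; positivity
  have h3 := h1.trans (h2.trans (hE R hR1))
  rw [le_div_iff₀ (by positivity)] at h3
  rw [div_lt_iff₀ hc0] at hRD
  nlinarith

/-- The Gaussian becomes singular at s = τ + 2δ, so s - t' lies between δ and 2δ on the step, and
for r ≥ R the weight is at most exp(-R²/(8δ)). The smallness of δ makes this compensate the growth
of the mass, and the energy is O(R⁻²). -/
theorem eq_zero_of_gaussianGrowth_step {u : ℝ → EuclideanSpace ℝ (Fin n) → ℂ}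
    (hu : IsHypHeatSolution n 0 u) {T A a δ : ℝ} (hδ : 0 < δ) (hδa : 72 * δ * |a| ≤ 1)
    (hg : ∀ R > 0, ∫⁻ t in Ioo 0 T, ∫⁻ w in {w | hypDist (hypOrigin n) w < R}, ‖u t w‖ₑ ^ 2
      ∂(hypMeasure n) ≤ ENNReal.ofReal (A * Real.exp (a * R ^ 2))) {τ t : ℝ} (hτ : 0 ≤ τ)
    (hτt : τ ≤ t) (htδ : t ≤ τ + δ) (htT : t ≤ T) (h0 : ∀ w ∈ hypSpace n, u τ w = 0)
    {w : EuclideanSpace ℝ (Fin n)} (hw : w ∈ hypSpace n) : u t w = 0 := by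
  obtain ⟨C, hC0, hC⟩ := exists_radialCutoffDeriv_sq_mul_gaussFactor_le
  have hts : t < τ + 2 * δ := by linarith
  have ht0 : 0 ≤ t := hτ.trans hτt
  refine eq_zero_of_energy_le (κ := ((n : ℝ) - 1) ^ 2 / 2) (s := τ + 2 * δ) (D := 4 * C * |A|)
    (hu.continuousOn.curry_left ht0) (by positivity) (fun R hR => ?_) (fun R => ?_) hw
  · have hR0 : 0 < R := one_pos.trans_le hR
    set M := |A| * Real.exp (R ^ 2 / (8 * δ)) with hM
    have hM0 : 0 ≤ M := by positivity
    have hMle : A * Real.exp (a * (2 * R + 1) ^ 2) ≤ M := by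
      -- For R ≥ 1 one has (2R + 1)² ≤ 9R²; together with the 8 of R²/(8δ) this accounts for the
      -- constant 72.
      have h1 : a * (2 * R + 1) ^ 2 ≤ R ^ 2 / (8 * δ) := by
        rw [le_div_iff₀ (by positivity)]
        have h2 : a * (2 * R + 1) ^ 2 ≤ |a| * (9 * R ^ 2) :=
          mul_le_mul (le_abs_self a) (by nlinarith) (by positivity) (abs_nonneg a)
        nlinarith [sq_nonneg R]
      exact mul_le_mul (le_abs_self A) (Real.exp_le_exp.2 h1) (Real.exp_pos _).le (abs_nonneg A)
    have hmass := integral_massDensity_le hu (R := R) hτ hτt htT hM0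
      ((hg (2 * R + 1) (by positivity)).trans (ENNReal.ofReal_le_ofReal hMle))
    have henergy := energy_le hu (κ := ((n : ℝ) - 1) ^ 2 / 2) rfl hR0 hτ hτt hts h0
      fun t' r h1 h2 => hC (((n : ℝ) - 1) ^ 2 / 2) δ R (τ + 2 * δ) t' r (by positivity) hδ hR0
        (hτ.trans h1.le) (h2.trans hts) (by linarith)
    refine henergy.trans ((mul_le_mul_of_nonneg_left hmass (by positivity)).trans (le_of_eq ?_))
    rw [hM, Real.exp_neg]
    have := (Real.exp_pos (R ^ 2 / (8 * δ))).ne'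
    field_simp
  · exact (((continuousOn_energyDensity hu _ _ R).curry_left
      (f := energyDensity u (((n : ℝ) - 1) ^ 2 / 2) (τ + 2 * δ) R)
      ⟨ht0, hts⟩).mono hypBall_subset).integrableOn_compact (isCompact_hypBall _)

/-- Uniqueness for the heat equation in the class of functions of Gaussian growth. -/
theorem IsHypHeatSolution.eq_zero {u : ℝ → EuclideanSpace ℝ (Fin n) → ℂ}
    (hu : IsHypHeatSolution n 0 u) (hg : HasGaussianGrowth n u) {t : ℝ} (ht : 0 ≤ t)
    {w : EuclideanSpace ℝ (Fin n)} (hw : w ∈ hypSpace n) : u t w = 0 := by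
  -- One time horizon beyond t fixes A and a, hence one step length δ for the whole interval [0, t].
  -- Adding 1 keeps the horizon positive when t = 0.
  obtain ⟨A, a, hA⟩ := hg (t + 1) (by linarith)
  set δ : ℝ := 1 / (72 * (|a| + 1)) with hδ
  have hδ0 : 0 < δ := by positivity
  have hδa : 72 * δ * |a| ≤ 1 := by
    rw [hδ, mul_one_div, div_mul_eq_mul_div, div_le_one (by positivity)]
    linarith [abs_nonneg a]
  have hk : ∀ k : ℕ, k * δ ≤ t → ∀ w ∈ hypSpace n, u (k * δ) w = 0 := by
    intro k
    induction k with
    | zero => intro _ w hw; simpa using hu.initial w hw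
    | succ k ih =>
      intro h w hw
      push_cast at h ⊢
      exact eq_zero_of_gaussianGrowth_step hu hδ0 hδa hA (τ := k * δ) (by positivity)
        (by linarith) (by linarith) (by linarith) (ih (by linarith)) hw
  have h1 : ⌊t / δ⌋₊ * δ ≤ t := (le_div_iff₀ hδ0).1 (Nat.floor_le (by positivity))
  have h2 : t ≤ ⌊t / δ⌋₊ * δ + δ := by
    have := ((div_lt_iff₀ hδ0).1 (Nat.lt_floor_add_one (t / δ))).le
    linarith
  exact eq_zero_of_gaussianGrowth_step hu hδ0 hδa hA (by positivity) h1 h2 (by linarith)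
    (hk _ h1) hw

/-! ### Differences of solutions and the conclusion -/

theorem hypLaplacian_sub {f g : EuclideanSpace ℝ (Fin n) → ℂ} (hf : ContDiffOn ℝ 2 f (hypSpace n))
    (hg : ContDiffOn ℝ 2 g (hypSpace n)) {w : EuclideanSpace ℝ (Fin n)} (hw : w ∈ hypSpace n) :
    hypLaplacian (fun w => f w - g w) w = hypLaplacian f w - hypLaplacian g w := by
  have hf' := hf.contDiffAt (isOpen_hypSpace.mem_nhds hw)
  have hg' := hg.contDiffAt (isOpen_hypSpace.mem_nhds hw)
  have h1 : Laplacian.laplacian (fun w => f w - g w) w =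
      Laplacian.laplacian f w - Laplacian.laplacian g w := by
    have h2 : Laplacian.laplacian (f + -g) w = Laplacian.laplacian f w + Laplacian.laplacian (-g) w :=
      hf'.laplacian_add hg'.neg
    have h3 : (f + -g) = fun w => f w - g w := by ext; simp [sub_eq_add_neg]
    rw [h3, InnerProductSpace.laplacian_neg] at h2
    simpa [sub_eq_add_neg] using h2
  rw [hypLaplacian, hypLaplacian, hypLaplacian, h1,
    fderiv_fun_sub (hf'.differentiableAt (by simp)) (hg'.differentiableAt (by simp))]
  simp only [sub_apply]
  ring

theorem ContinuousOn.sub_bilinear {X E F : Type*} [TopologicalSpace X] [NormedAddCommGroup E]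
    [NormedSpace ℝ E] [NormedAddCommGroup F] [NormedSpace ℝ F] {f g : X → E →L[ℝ] E →L[ℝ] F}
    {s : Set X} (hf : ContinuousOn f s) (hg : ContinuousOn g s) :
    ContinuousOn (fun x => f x - g x) s :=
  hf.sub hg

theorem IsHypHeatSolution.sub {V₀ : EuclideanSpace ℝ (Fin n) → ℂ}
    {V V' : ℝ → EuclideanSpace ℝ (Fin n) → ℂ} (hV : IsHypHeatSolution n V₀ V)
    (hV' : IsHypHeatSolution n V₀ V') : IsHypHeatSolution n 0 fun t w => V t w - V' t w := by
  have hderiv : ∀ t > 0, ∀ w ∈ hypSpace n, deriv (fun s => V s w - V' s w) t =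
      deriv (fun s => V s w) t - deriv (fun s => V' s w) t := fun t ht w hw =>
    deriv_fun_sub (hV.differentiableAt_time t ht w hw) (hV'.differentiableAt_time t ht w hw)
  have hat : ∀ {V}, IsHypHeatSolution n V₀ V → ∀ t > 0, ∀ w ∈ hypSpace n, ContDiffAt ℝ 2 (V t) w :=
    fun h t ht w hw => (h.contDiffOn_space t ht).contDiffAt (isOpen_hypSpace.mem_nhds hw)
  have hfd : ∀ t > 0, ∀ w ∈ hypSpace n, fderiv ℝ (fun w => V t w - V' t w) w =
      fderiv ℝ (V t) w - fderiv ℝ (V' t) w := fun t ht w hw =>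
    fderiv_fun_sub ((hat hV t ht w hw).differentiableAt (by simp))
      ((hat hV' t ht w hw).differentiableAt (by simp))
  refine ⟨hV.continuousOn.sub hV'.continuousOn, ?_, ?_, ?_, ?_, ?_, ?_, ?_⟩
  · exact fun t ht w hw =>
      (hV.differentiableAt_time t ht w hw).fun_sub (hV'.differentiableAt_time t ht w hw)
  · exact (hV.continuousOn_deriv_time.sub hV'.continuousOn_deriv_time).congr
      fun p hp => hderiv p.1 hp.1 p.2 hp.2
  · exact fun t ht => (hV.contDiffOn_space t ht).sub (hV'.contDiffOn_space t ht)
  · exact (hV.continuousOn_fderiv_space.sub hV'.continuousOn_fderiv_space).congr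
      fun p hp => hfd p.1 hp.1 p.2 hp.2
  · refine (hV.continuousOn_fderiv_fderiv_space.sub_bilinear
      hV'.continuousOn_fderiv_fderiv_space).congr fun p hp => ?_
    have hev : fderiv ℝ (fun w => V p.1 w - V' p.1 w) =ᶠ[nhds p.2]
        fun w => fderiv ℝ (V p.1) w - fderiv ℝ (V' p.1) w := by
      filter_upwards [isOpen_hypSpace.mem_nhds hp.2] with w hw using hfd p.1 hp.1 w hw
    refine hev.fderiv_eq.trans (fderiv_fun_sub ?_ ?_)
    · exact ((hat hV p.1 hp.1 p.2 hp.2).fderiv_right (m := 1) (by norm_num)).differentiableAt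
        (by simp)
    · exact ((hat hV' p.1 hp.1 p.2 hp.2).fderiv_right (m := 1) (by norm_num)).differentiableAt
        (by simp)
  · intro t ht w hw
    rw [hderiv t ht w hw, hypLaplacian_sub (hV.contDiffOn_space t ht) (hV'.contDiffOn_space t ht) hw,
      hV.heat_eq t ht w hw, hV'.heat_eq t ht w hw]
  · intro w hw
    simp [hV.initial w hw, hV'.initial w hw]

end

theorem theorem3 (n : ℕ) [NeZero n] (V₀ : EuclideanSpace ℝ (Fin n) → ℂ)
    (hV₀ : ContDiff ℝ ∞ V₀) (hcomp : HasCompactSupport V₀) (hsupp : tsupport V₀ ⊆ hypSpace n) :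
    ∃ V : ℝ → EuclideanSpace ℝ (Fin n) → ℂ,
      (IsHypHeatSolution n V₀ V ∧ HasGaussianGrowth n V) ∧
      (∀ V' : ℝ → EuclideanSpace ℝ (Fin n) → ℂ,
        IsHypHeatSolution n V₀ V' → HasGaussianGrowth n V' →
          ∀ t ≥ 0, ∀ w ∈ hypSpace n, V' t w = V t w) ∧
      ∀ σ ∈ Ioo (0 : ℝ) (2 * Real.pi), ∀ t > 0, ∀ w ∈ hypSpace n,
        (∀ w' ∈ hypSpace n,
          Integrable (fun b : ℝ =>
            hypHeatIntegrand n t w w' ((σ : ℂ) + (b : ℂ) * Complex.I))) ∧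
        Integrable (fun w' => hypHeatKernel n σ t w w' * V₀ w') (hypMeasure n) ∧
        V t w = ∫ w', hypHeatKernel n σ t w w' * V₀ w' ∂(hypMeasure n) := by
  have hsol := isHypHeatSolution_cauchySolution hV₀ hcomp hsupp
  have hbdd := exists_norm_cauchySolution_le hV₀ hcomp hsupp
  refine ⟨cauchySolution V₀, ⟨hsol, hasGaussianGrowth_of_bounded hbdd⟩,
    fun V' hV' hg t ht w hw => ?_, fun σ hσ t ht w hw => ⟨fun w' hw' => ?_,
      integrable_hypHeatKernel_mul hV₀ hcomp hsupp hσ ht hw, ?_⟩⟩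
  -- The difference of two solutions has zero data, and it keeps Gaussian growth because the
  -- constructed solution is bounded on each (0, T] × ℍⁿ.
  · exact sub_eq_zero.1 ((hV'.sub hsol).eq_zero (hg.sub_of_bounded hbdd) ht hw)
  · rw [hypHeatIntegrand_eq t hw hw']
    exact integrable_contourIntegrand (by positivity) ht (one_le_coshDist hw hw') hσ
  · rw [cauchySolution_of_pos ht]
    exact heatSolution_eq_integral_hypMeasure hsupp hσ ht hw
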